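/- Let $\eta^1,\eta^2,\eta^3$ be the left-invariant coframe on $\mathbb S^3=SU(2)$ with $d\eta^1=-2\,\eta^2\wedge\eta^3$ and cyclically. For a nonempty open interval $J\subset\mathbb R$ and smooth positive functions $F,C$ of $z\in J$ consider on $J\times\mathbb S^3$ the metric $$g=C\Big(\tfrac1{4F}dz^2+F(\eta^1)^2+(\eta^2)^2+(\eta^3)^2\Big),$$ with orthonormal coframe $\sigma^0=\sqrt{C/4F}\,dz$, $\sigma^1=\sqrt{CF}\,\eta^1$, $\sigma^2=\sqrt C\,\eta^2$, $\sigma^3=\sqrt C\,\eta^3$ and dual frame $f_0,\dots,f_3$. For a sign $s=\pm1$ let $J^{s}=-s f_0\otimes\sigma^1+s f_1\otimes\sigma^0-f_2\otimes\sigma^3+f_3\otimes\sigma^2$. Let $T(z,u)=(z,u^{-1})$, let $R$ be the matrix-valued function with $R_{00}=1$, $R_{0i}=R_{i0}=0$ and $T^*\eta^i=\sum_jR_{ij}\eta^j$ for $i,j=1,2,3$ (it is orthogonal, of determinant $-1$), and let $I^{s}$ be the $g$-compatible almost complex structure whose matrix in the frame $(f_i)$ is $R^{t}J^{-s}R$.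 Thus $I^s$ and $J^s$ induce the same orientation. Put $\omega_I^{s}=g(I^{s}\cdot,\cdot)$. (1) For each $s=\pm1$ the following are equivalent: (a) $d\omega_I^{s}=0$; (b) $I^{s}$ is a Kähler structure for $g$ (integrable, $g$-compatible, with closed fundamental form); (c) there are constants $C_0>0$ and $C_1$ with $1+C_1e^{sz}>0$ on $J$ and $$F=(1+C_1e^{sz})^2,\qquad C=\frac{C_0e^{sz}}{(1+C_1e^{sz})^2}\qquad\text{on }J.$$ In this case $g$ is Ricci-flat. (2) For $c\in\{0,-1,1\}$ let $g_c$ be the metric with $F=(1+ce^{sz})^2$, $C=e^{sz}/(1+ce^{sz})^2$ on $M_c=\{z:1+ce^{sz}>0\}\times\mathbb S^3$; $I^s$ is Kähler for each $g_c$. If $I^{s}$ is Kähler for $g$, then for some $c\in\{0,-1,1\}$ and some translation $\tau$ of $z$ with $(J+\tau)\times\mathbb S^3\subset M_c$, $(J\times\mathbb S^3,g)$ is homothetic to $((J+\tau)\times\mathbb S^3,g_c)$. The metric $g_0$ is flat, while $g_{-1}$ and $g_1$ are nowhere flat, and $(M_{-1},g_{-1})$ and $(M_1,g_1)$ are not homothetic.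 So, up to homothety (and restriction to a subinterval), there are exactly two non-flat metrics of this form for which $I^{s}$ is Kähler: (i) The first is $F=(1-e^{sz})^2$, $C=e^{sz}/(1-e^{sz})^2$ on $sz<0$ (for $I^-$: $F=(1-e^{-z})^2$ on $z>0$). It is the classic Taub-NUT metric: for each $m>0$ there is a homothety $\varphi$ from it onto $g^{TN}_m=\frac14\frac{r+m}{r-m}dr^2+4m^2\frac{r-m}{r+m}(\eta^1)^2+(r^2-m^2)\big((\eta^2)^2+(\eta^3)^2\big)$ on $\{r>m\}\times\mathbb S^3$, with $\varphi^*g^{TN}_m=4m^2g_{-1}$. It has an ALF end at $z=0$ and a nut at $z=-s\infty$. (ii) The second is $F=(1+e^{sz})^2$, $C=e^{sz}/(1+e^{sz})^2$ on $z\in\mathbb R$. It has a nut at $z=-s\infty$ and a curvature singularity at $z=s\infty$: as $sz\to\infty$, $|{\rm Rm}|\to\infty$, at a finite distance. Here a nut at an end means that adding one point to the end gives a ball in $\mathbb R^4$ over which the metric extends to a smooth Riemannian metric. An ALF end means that the end is diffeomorphic to $(R,\infty)\times\mathbb S^3$, with coordinate $\rho$ on the first factor and some $R>0$, so that for some constant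 $L>0$, $g$ differs from $d\rho^2+L^2(\eta^1)^2+4\rho^2\big((\eta^2)^2+(\eta^3)^2\big)$ (the circle bundle of constant fibre length over the outside of a ball in flat $\mathbb R^3$) by a relative error $O(1/\rho)$, and $|{\rm Rm}|=O(\rho^{-3})$. -/

import Mathlib

open Filter Set Topology
open scoped Quaternion ContDiff

namespace UTwo

/-- Four-dimensional Euclidean space, as the quaternions.  `ℝ × S³` is identified with the
punctured space by `(t, u) ↦ exp t • u`; left translation of `S³` by a unit quaternion `a` is then
`x ↦ a * x`. -/
abbrev Quat : Type := ℍ[ℝ]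

/-! ### Riemannian geometry on open subsets of `Quat` -/

section Geometry

/-- A field of bilinear forms, in particular a metric. -/
abbrev BilinField : Type := Quat → LinearMap.BilinForm ℝ Quat

/-- A field of endomorphisms of the tangent spaces. -/
abbrev EndField : Type := Quat → Module.End ℝ Quat

/-- The basis `1, i, j, k`, which supplies the Cartesian coordinates. -/
noncomputable def stdBasis : Module.Basis (Fin 4) ℝ Quat :=
  QuaternionAlgebra.basisOneIJK (-1 : ℝ) 0 (-1)

/-- The partial derivative in the `i`-th Cartesian direction. -/
noncomputable def pd (i : Fin 4) (f : Quat → ℝ) (x : Quat) : ℝ := fderiv ℝ f x (stdBasis i)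

/-- The matrix `g_{ij}`. -/
noncomputable def gram (g : BilinField) (x : Quat) : Matrix (Fin 4) (Fin 4) ℝ :=
  Matrix.of fun i j => g x (stdBasis i) (stdBasis j)

/-- Christoffel symbols `Γ^k_{ij}` of the Levi-Civita connection. -/
noncomputable def christoffel (g : BilinField) (k i j : Fin 4) (x : Quat) : ℝ :=
  (1 / 2) * ∑ l, (gram g x)⁻¹ k l *
    (pd i (fun y => gram g y j l) x + pd j (fun y => gram g y i l) x
      - pd l (fun y => gram g y i j) x)

/-- The curvature `R^l_{k i j}`, that is, `R(∂_i, ∂_j) ∂_k = ∑ l, R^l_{k i j} ∂_l`. -/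
noncomputable def riemann (g : BilinField) (l k i j : Fin 4) (x : Quat) : ℝ :=
  pd i (christoffel g l j k) x - pd j (christoffel g l i k) x
    + ∑ m, (christoffel g l i m x * christoffel g m j k x
      - christoffel g l j m x * christoffel g m i k x)

/-- The Ricci tensor `Ric_{kj} = ∑ l, R^l_{k l j}`. -/
noncomputable def ricci (g : BilinField) (k j : Fin 4) (x : Quat) : ℝ :=
  ∑ l, riemann g l k l j x

/-- The squared norm `|Rm|² = g_{ab} g^{kc} g^{id} g^{je} R^a_{k i j} R^b_{c d e}`. -/
noncomputable def riemannNormSq (g : BilinField) (x : Quat) : ℝ :=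
  ∑ a, ∑ k, ∑ i, ∑ j, ∑ b, ∑ c, ∑ d, ∑ e,
    gram g x a b * (gram g x)⁻¹ k c * (gram g x)⁻¹ i d * (gram g x)⁻¹ j e *
      (riemann g a k i j x * riemann g b c d e x)

def RicciFlatOn (U : Set Quat) (g : BilinField) : Prop := ∀ x ∈ U, ∀ k j, ricci g k j x = 0

def FlatOn (U : Set Quat) (g : BilinField) : Prop := ∀ x ∈ U, ∀ l k i j, riemann g l k i j x = 0

/-- `g` is a smooth Riemannian metric on `U`. -/
structure IsRiemannianOn (U : Set Quat) (g : BilinField) : Prop where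
  smooth : ∀ v w, ContDiffOn ℝ ∞ (fun x => g x v w) U
  symm : ∀ x ∈ U, ∀ v w, g x v w = g x w v
  pos : ∀ x ∈ U, ∀ v, v ≠ 0 → 0 < g x v v

/-- `φ` is a diffeomorphism from `U` onto `V`. -/
def IsDiffeo (φ : Quat → Quat) (U V : Set Quat) : Prop :=
  MapsTo φ U V ∧ ContDiffOn ℝ ∞ φ U ∧
    ∃ ψ : Quat → Quat, MapsTo ψ V U ∧ ContDiffOn ℝ ∞ ψ V ∧ InvOn ψ φ U V

/-- `φ : U → V` is a homothety with `φ^* h = lam • g`. -/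
def IsHomothety (lam : ℝ) (φ : Quat → Quat) (U : Set Quat) (g : BilinField)
    (V : Set Quat) (h : BilinField) : Prop :=
  0 < lam ∧ IsDiffeo φ U V ∧
    ∀ x ∈ U, ∀ v w, h (φ x) (fderiv ℝ φ x v) (fderiv ℝ φ x w) = lam * g x v w

def Homothetic (U : Set Quat) (g : BilinField) (V : Set Quat) (h : BilinField) : Prop :=
  ∃ lam φ, IsHomothety lam φ U g V h

/-- On `U`, the bilinear field `B` is (alternating, differentiable and) a closed 2-form. -/
def IsClosedTwoFormOn (U : Set Quat) (B : BilinField) : Prop :=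
  ∃ β : Quat → Quat [⋀^Fin 2]→L[ℝ] ℝ,
    DifferentiableOn ℝ β U ∧ (∀ x ∈ U, ∀ v w, β x ![v, w] = B x v w) ∧
      ∀ x ∈ U, extDeriv β x = 0

/-- The Nijenhuis tensor `[Iv, Iw] - I[Iv, w] - I[v, Iw] - [v, w]`, evaluated on the constant
vector fields `v` and `w` (it is a tensor). -/
noncomputable def nijenhuis (I : EndField) (v w x : Quat) : Quat :=
  VectorField.lieBracket ℝ (fun y => I y v) (fun y => I y w) x
    - I x (VectorField.lieBracket ℝ (fun y => I y v) (fun _ => w) x)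
    - I x (VectorField.lieBracket ℝ (fun _ => v) (fun y => I y w) x)
    - VectorField.lieBracket ℝ (fun _ => v) (fun _ => w) x

/-- The 2-form `g(I ·, ·)`. -/
noncomputable def fundamentalForm (g : BilinField) (I : EndField) : BilinField :=
  fun x => (g x).comp (I x) LinearMap.id

/-- `I` is a Kähler structure for `g` on `U`: an integrable `g`-compatible almost complex structure
whose fundamental form is closed. -/
structure IsKahlerOn (U : Set Quat) (g : BilinField) (I : EndField) : Prop where
  smooth : ∀ v, ContDiffOn ℝ ∞ (fun x => I x v) U
  sq : ∀ x ∈ U, ∀ v, I x (I x v) = -v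
  compatible : ∀ x ∈ U, ∀ v w, g x (I x v) (I x w) = g x v w
  integrable : ∀ x ∈ U, ∀ v w, nijenhuis I v w x = 0
  closed : IsClosedTwoFormOn U (fundamentalForm g I)

end Geometry

/-! ### `U(2)`-invariant metrics on `J × S³` -/

section Ansatz

/-- The coordinate `z` on `ℝ × S³`. -/
noncomputable def height (x : Quat) : ℝ := Real.log ‖x‖

/-- `J × S³`. -/
def shell (J : Set ℝ) : Set Quat := {x | x ≠ 0 ∧ height x ∈ J}

/-- The left-invariant coframe: `η⁰ = dz`, and `η¹, η², η³` are the components along `i, j, k` of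
the Maurer-Cartan form `x⁻¹ dx`, so that `dη¹ = -2 η² ∧ η³` and cyclically. -/
noncomputable def eta (i : Fin 4) (x : Quat) : Quat →ₗ[ℝ] ℝ :=
  stdBasis.coord i ∘ₗ LinearMap.mulLeft ℝ x⁻¹

/-- The dual left-invariant frame: `e₀ = ∂/∂z`, and `e₁, e₂, e₃` are `x i, x j, x k`. -/
noncomputable def frame (i : Fin 4) (x : Quat) : Quat := x * stdBasis i

/-- `A(t) dt² + B(t) (η¹)² + C(t) ((η²)² + (η³)²)`, with `t` the coordinate on the first factor of
`ℝ × S³`. -/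
noncomputable def uMetric (A B C : ℝ → ℝ) : BilinField := fun x =>
  A (height x) • LinearMap.BilinForm.linMulLin (eta 0 x) (eta 0 x)
    + B (height x) • LinearMap.BilinForm.linMulLin (eta 1 x) (eta 1 x)
    + C (height x) • (LinearMap.BilinForm.linMulLin (eta 2 x) (eta 2 x)
      + LinearMap.BilinForm.linMulLin (eta 3 x) (eta 3 x))

/-- `C (dz² / (4F) + F (η¹)² + (η²)² + (η³)²)`. -/
noncomputable def zMetric (F C : ℝ → ℝ) : BilinField :=
  uMetric (fun z => C z * (1 / (4 * F z))) (fun z => C z * F z) C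

/-- `J` is a nonempty open interval, and `F`, `C` are smooth and positive on it. -/
structure IsAnsatz (J : Set ℝ) (F C : ℝ → ℝ) : Prop where
  isOpen : IsOpen J
  interval : J.OrdConnected
  nonempty : J.Nonempty
  smoothF : ContDiffOn ℝ ∞ F J
  smoothC : ContDiffOn ℝ ∞ C J
  posF : ∀ z ∈ J, 0 < F z
  posC : ∀ z ∈ J, 0 < C z

/-- The lengths of `e₀, e₁, e₂, e₃` for `zMetric F C`. -/
noncomputable def scale (F C : ℝ → ℝ) (i : Fin 4) (x : Quat) : ℝ :=
  ![√(C (height x) / (4 * F (height x))), √(C (height x) * F (height x)),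
    √(C (height x)), √(C (height x))] i

/-- The orthonormal coframe `σ^i`. -/
noncomputable def sigma (F C : ℝ → ℝ) (i : Fin 4) (x : Quat) : Quat →ₗ[ℝ] ℝ :=
  scale F C i x • eta i x

/-- The orthonormal frame `f_i` dual to `σ^i`. -/
noncomputable def unitFrame (F C : ℝ → ℝ) (i : Fin 4) (x : Quat) : Quat :=
  (scale F C i x)⁻¹ • frame i x

/-- The matrix of `J^s` in an orthonormal frame:
`-s f₀ ⊗ σ¹ + s f₁ ⊗ σ⁰ - f₂ ⊗ σ³ + f₃ ⊗ σ²`, for `s = ±1`. -/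
def jMatrix (s : ℝ) : Matrix (Fin 4) (Fin 4) ℝ :=
  !![0, -s, 0, 0; s, 0, 0, 0; 0, 0, 0, -1; 0, 0, 1, 0]

/-- The inversion `T(z, u) = (z, u⁻¹)` of `ℝ × S³` is quaternionic conjugation `x ↦ star x`, and
the right-invariant coframe is `T^* η^i`. This is the matrix of `T^*`, with
`T^* η^i = ∑ j, (tMatrix x) i j • η^j`. -/
noncomputable def tMatrix (x : Quat) : Matrix (Fin 4) (Fin 4) ℝ :=
  Matrix.of fun i j => eta i (star x) (star (frame j x))

/-- The matrix of `I^s` in the orthonormal frame `f_i`: that of `J^{-s}`, conjugated by the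
orthogonal matrix of `T`. -/
noncomputable def iMatrix (s : ℝ) (x : Quat) : Matrix (Fin 4) (Fin 4) ℝ :=
  (tMatrix x).transpose * jMatrix (-s) * tMatrix x

/-- The almost complex structure `I^s`, `s = ±1`, for the metric `zMetric F C`. -/
noncomputable def iStructure (s : ℝ) (F C : ℝ → ℝ) : EndField := fun x =>
  ∑ a, ∑ b, iMatrix s x a b • (sigma F C b x).smulRight (unitFrame F C a x)

end Ansatz

/-! ### The explicit metrics -/

section Models

noncomputable def modelF (s c : ℝ) (z : ℝ) : ℝ := (1 + c * Real.exp (s * z)) ^ 2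

noncomputable def modelC (s c₀ c : ℝ) (z : ℝ) : ℝ :=
  c₀ * Real.exp (s * z) / (1 + c * Real.exp (s * z)) ^ 2

/-- `F = (1 + C₁ e^{sz})²` and `C = C₀ e^{sz} / (1 + C₁ e^{sz})²` on `J` for some constants,
with `√F = 1 + C₁ e^{sz}` the positive square root. -/
def HasModelForm (s : ℝ) (J : Set ℝ) (F C : ℝ → ℝ) : Prop :=
  ∃ C₀ C₁ : ℝ, 0 < C₀ ∧ ∀ z ∈ J,
    0 < 1 + C₁ * Real.exp (s * z) ∧ F z = modelF s C₁ z ∧ C z = modelC s C₀ C₁ z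

/-- The maximal interval for the constant `c`. -/
def modelDomain (s c : ℝ) : Set ℝ := {z | 0 < 1 + c * Real.exp (s * z)}

/-- The metric with `C₀ = 1` and `C₁ = c`. -/
noncomputable def model (s c : ℝ) : BilinField := zMetric (modelF s c) (modelC s 1 c)

/-- The classic Taub-NUT metric of mass parameter `m`, with `r` the coordinate on the interval:
`(1/4) (r+m)/(r-m) dr² + 4m² (r-m)/(r+m) (η¹)² + (r²-m²) ((η²)² + (η³)²)`, on `r > m`. -/
noncomputable def taubNUT (m : ℝ) : BilinField :=
  uMetric (fun r => 1 / 4 * ((r + m) / (r - m))) (fun r => 4 * m ^ 2 * ((r - m) / (r + m)))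
    (fun r => r ^ 2 - m ^ 2)

end Models

/-! ### Ends.  An end of `U` is given by a filter `l`. -/

section Ends

/-- `(U, g)` has a nut at the end `l`: adding a single point there gives a ball on which the
metric is smooth. -/
def HasNut (U : Set Quat) (g : BilinField) (l : Filter Quat) : Prop :=
  ∃ W ∈ l, IsOpen W ∧ W ⊆ U ∧ ∃ r : ℝ, 0 < r ∧ ∃ h : BilinField,
    IsRiemannianOn (Metric.ball 0 r) h ∧ ∃ Φ : Quat → Quat,
      IsHomothety 1 Φ W g (Metric.ball 0 r \ {0}) h ∧ Tendsto Φ l (𝓝 0)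

/-- The model `dρ² + L² (η¹)² + 4ρ² ((η²)² + (η³)²)` at an ALF end: `4 ((η²)² + (η³)²)` is the pull
back of the round metric of `S²` by the Hopf map, so this is a circle bundle with fibres of length
`2πL` over the outside of a ball in flat `ℝ³`. -/
noncomputable def alfModel (L : ℝ) : BilinField :=
  uMetric (fun _ => 1) (fun _ => L ^ 2) (fun ρ => 4 * ρ ^ 2)

/-- `(U, g)` is asymptotically locally flat at the end `l`: a neighbourhood of the end is a Hopf
circle bundle over the outside of a ball in `ℝ³`, on which `g` is asymptotic, with relative error
`O(1/ρ)`, to the model metric with fibres of constant length, and `|Rm| = O(ρ⁻³)`.  (So the end is complete,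
the volume growth is cubic and the tangent cone at infinity is `ℝ³`.) -/
def HasALFEnd (U : Set Quat) (g : BilinField) (l : Filter Quat) : Prop :=
  ∃ W ∈ l, IsOpen W ∧ W ⊆ U ∧ ∃ R L K : ℝ, 0 < R ∧ 0 < L ∧ ∃ Φ : Quat → Quat,
    IsDiffeo Φ W (shell (Ioi R)) ∧ Tendsto (fun x => height (Φ x)) l atTop ∧
      ∀ x ∈ W,
        (∀ v, |g x v v - alfModel L (Φ x) (fderiv ℝ Φ x v) (fderiv ℝ Φ x v)| ≤
          K / height (Φ x) * alfModel L (Φ x) (fderiv ℝ Φ x v) (fderiv ℝ Φ x v)) ∧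
        √(riemannNormSq g x) ≤ K / height (Φ x) ^ 3

/-- `g` has a curvature singularity at a finite distance as `s z → +∞`: `|Rm|²` tends to infinity,
and each radial curve `t ↦ exp t • u`, whose velocity is `exp t • u`, has finite length towards
this end. -/
def HasCurvatureSingularity (s : ℝ) (g : BilinField) : Prop :=
  Tendsto (riemannNormSq g) (comap (fun x => s * height x) atTop) atTop ∧
    ∀ u : Quat, ‖u‖ = 1 →
      MeasureTheory.IntegrableOn
        (fun t : ℝ => √(g (Real.exp t • u) (Real.exp t • u) (Real.exp t • u))) {t | 0 < s * t}

end Ends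

end UTwo

open UTwo

/-!
The points of `J × S³` are the quaternions `x ≠ 0` with `log |x| ∈ J`, and every object of the
theorem is expressed in the left-invariant frame: a tangent vector `v` at `x` is replaced by
`p = x⁻¹ v`. The derivative of `x⁻¹ v` along `u` is `-(x⁻¹ u) (x⁻¹ v)`, so that Christoffel symbols,
curvature, exterior derivatives and Nijenhuis tensors, all defined through Cartesian partial
derivatives, become algebra of quaternions with coefficients depending on `z` only.

*The Kähler condition.* In the left-invariant frame `I^s` is determined by `f = √F` and by the
Hopf image `n = x⁻¹ i x`; after rescaling the frame it is multiplication by `± n`, from the left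
or from the right (`iMatrix_eq`, `iStructure_apply`). As `n` varies by `dn = [n, p]`, the exterior
derivative of the fundamental form has only two independent components, and it vanishes if and
only if `C' = s C (2/f - 1)` and `(C f)' = s C` (`isClosedTwoFormOn_fundamentalForm_iff`). These
equations say that `(f - 1) e^{-sz}` and `C f² e^{-sz}` are constant, which is the model form
(`hasModelForm_of_ode`). Conversely `f' = s (f - 1)` makes the Nijenhuis tensor vanish identically
(`nijenhuis_leftStructure`), whence `IsModelOn.isKahlerOn`.

*Curvature.* For the metrics of model form the Levi-Civita connection is exhibited explicitly and
identified by the Koszul formula (`christoffel_eq_of_isLeviCivita`,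
`IsModelOn.isInvariantLeviCivita`). In a frame of vectors of equal length its curvature is
`4 w (w - 1)` times a fixed traceless tensor of type `(1, -1/2, -1/2)`, where `w = 1 + C₁ e^{sz}`. Hence
the metrics are Ricci-flat, and `|Rm|² = 384 C₁² w⁶ / C₀²` (`IsModelOn.riemannNormSq_eq`), so that
the curvature vanishes if and only if `C₁ = 0`.

*Homotheties.* Those constructed are radial maps `(z, u) ↦ (k z, u)`, which preserve `η¹, η², η³`
and pull back `η⁰` to `k' η⁰`. A translation of `z` reduces `C₁` to its sign. With `q = e^{sz}`,
the radial coordinates are `r = m (1 + q) / (1 - q)` for the Taub-NUT metric,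
`ρ = 1 / (2 (1 - q))` at the ALF end, and `|y|² = q` at the nuts, where the metric extends as `nutMetric`.

*The metrics `g_{-1}` and `g_1` are not homothetic.* The function `-log (1 - q)` is unbounded on
`M_{-1}` and has bounded gradient, since the end `q → 1` is complete. On `M_1` a function with
bounded gradient is bounded, because the radial derivative is dominated by that of `2 arctan √q`
and the unit sphere is compact (`exists_forall_le_of_fderiv_radial_le`).
-/

namespace UTwo

/-! ### Left-invariant calculus on the punctured quaternions -/

/-- The quaternion with the given coordinates. -/
def quat (a b c d : ℝ) : Quat := ⟨a, b, c, d⟩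

@[simp] lemma re_quat (a b c d : ℝ) : (quat a b c d).re = a := rfl
@[simp] lemma imI_quat (a b c d : ℝ) : (quat a b c d).imI = b := rfl
@[simp] lemma imJ_quat (a b c d : ℝ) : (quat a b c d).imJ = c := rfl
@[simp] lemma imK_quat (a b c d : ℝ) : (quat a b c d).imK = d := rfl

lemma repr_stdBasis_apply (a i : Fin 4) :
    ![(stdBasis a).re, (stdBasis a).imI, (stdBasis a).imJ, (stdBasis a).imK] i
      = if a = i then 1 else 0 := by
  have h := congrArg (fun f => f i) (stdBasis.repr_self a)
  simp only [Finsupp.single_apply] at h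
  exact h

@[simp] lemma re_stdBasis (a : Fin 4) : (stdBasis a).re = if a = 0 then 1 else 0 :=
  repr_stdBasis_apply a 0

@[simp] lemma imI_stdBasis (a : Fin 4) : (stdBasis a).imI = if a = 1 then 1 else 0 :=
  repr_stdBasis_apply a 1

@[simp] lemma imJ_stdBasis (a : Fin 4) : (stdBasis a).imJ = if a = 2 then 1 else 0 :=
  repr_stdBasis_apply a 2

@[simp] lemma imK_stdBasis (a : Fin 4) : (stdBasis a).imK = if a = 3 then 1 else 0 :=
  repr_stdBasis_apply a 3

@[simp] lemma coord_zero (v : Quat) : stdBasis.coord 0 v = v.re := rfl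
@[simp] lemma coord_one (v : Quat) : stdBasis.coord 1 v = v.imI := rfl
@[simp] lemma coord_two (v : Quat) : stdBasis.coord 2 v = v.imJ := rfl
@[simp] lemma coord_three (v : Quat) : stdBasis.coord 3 v = v.imK := rfl

@[simp] lemma eta_zero (x v : Quat) : eta 0 x v = (x⁻¹ * v).re := rfl
@[simp] lemma eta_one (x v : Quat) : eta 1 x v = (x⁻¹ * v).imI := rfl
@[simp] lemma eta_two (x v : Quat) : eta 2 x v = (x⁻¹ * v).imJ := rfl
@[simp] lemma eta_three (x v : Quat) : eta 3 x v = (x⁻¹ * v).imK := rfl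

/-- The Cartesian coordinates as continuous linear forms. -/
noncomputable def coordCLM (i : Fin 4) : Quat →L[ℝ] ℝ :=
  LinearMap.toContinuousLinearMap (stdBasis.coord i)

lemma coordCLM_apply (i : Fin 4) (v : Quat) : coordCLM i v = stdBasis.coord i v := rfl

@[simp] lemma coordCLM_zero (v : Quat) : coordCLM 0 v = v.re := rfl
@[simp] lemma coordCLM_one (v : Quat) : coordCLM 1 v = v.imI := rfl
@[simp] lemma coordCLM_two (v : Quat) : coordCLM 2 v = v.imJ := rfl
@[simp] lemma coordCLM_three (v : Quat) : coordCLM 3 v = v.imK := rfl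

lemma sum_coord (v : Quat) : ∑ i, stdBasis.coord i v • stdBasis i = v :=
  stdBasis.sum_repr v

/-- The derivative of `y ↦ y⁻¹ * v` at `x`, namely `u ↦ -(x⁻¹ u) (x⁻¹ v)`. -/
noncomputable def maurerCartanDeriv (x v : Quat) : Quat →L[ℝ] Quat :=
  -((ContinuousLinearMap.mul ℝ Quat).flip (x⁻¹ * v) ∘L ContinuousLinearMap.mul ℝ Quat x⁻¹)

@[simp] lemma maurerCartanDeriv_apply (x v u : Quat) :
    maurerCartanDeriv x v u = -(x⁻¹ * u * (x⁻¹ * v)) := by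
  simp [maurerCartanDeriv]

lemma hasFDerivAt_inv_mul {x : Quat} (hx : x ≠ 0) (v : Quat) :
    HasFDerivAt (fun y : Quat => y⁻¹ * v) (maurerCartanDeriv x v) x := by
  have h := (hasFDerivAt_inv' (𝕜 := ℝ) hx).mul_const' v
  refine h.congr_fderiv ?_
  ext1 u
  simp [mul_assoc]

/-- The derivative of `height` at `x`, that is, `η⁰`. -/
noncomputable def heightDeriv (x : Quat) : Quat →L[ℝ] ℝ :=
  coordCLM 0 ∘L ContinuousLinearMap.mul ℝ Quat x⁻¹

@[simp] lemma heightDeriv_apply (x u : Quat) : heightDeriv x u = (x⁻¹ * u).re := rfl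

lemma norm_sq_eq (x : Quat) : ‖x‖ ^ 2 = x.re ^ 2 + x.imI ^ 2 + x.imJ ^ 2 + x.imK ^ 2 := by
  rw [← Quaternion.normSq_def', Quaternion.normSq_eq_norm_mul_self, sq]

lemma inv_eq (x : Quat) : x⁻¹ = (‖x‖ ^ 2)⁻¹ • star x := by
  rw [sq, ← Quaternion.normSq_eq_norm_mul_self]; rfl

lemma hasFDerivAt_height {x : Quat} (hx : x ≠ 0) : HasFDerivAt height (heightDeriv x) x := by
  have h1 := ((hasStrictFDerivAt_norm_sq x).hasFDerivAt).log
    (pow_ne_zero 2 (norm_ne_zero_iff.2 hx))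
  have h2 := h1.const_mul (1 / 2 : ℝ)
  have h3 : height = fun y : Quat => 1 / 2 * Real.log (‖y‖ ^ 2) := by
    funext y; simp [height, Real.log_pow]
  rw [h3]
  refine h2.congr_fderiv ?_
  ext1 u
  simp only [heightDeriv_apply, inv_eq, Algebra.smul_mul_assoc, Quaternion.re_smul, smul_eq_mul,
    smul_apply, innerSL_apply_apply, Quaternion.inner_def]
  simp
  ring

lemma continuousAt_height {x : Quat} (hx : x ≠ 0) : ContinuousAt height x :=
  (hasFDerivAt_height hx).continuousAt

lemma contDiffAt_height {x : Quat} (hx : x ≠ 0) : ContDiffAt ℝ ∞ height x :=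
  (contDiffAt_norm ℝ hx).log (norm_ne_zero_iff.2 hx)

lemma contDiffAt_inv_quat {x : Quat} (hx : x ≠ 0) : ContDiffAt ℝ ∞ (fun y : Quat => y⁻¹) x := by
  have h := contDiffAt_ringInverse (n := ∞) ℝ (Units.mk0 x hx)
  simpa [Ring.inverse_eq_inv'] using h

lemma isOpen_shell {J : Set ℝ} (hJ : IsOpen J) : IsOpen (shell J) := by
  rw [isOpen_iff_mem_nhds]
  rintro x ⟨hx, hxJ⟩
  filter_upwards [isOpen_ne.mem_nhds hx, (continuousAt_height hx) (hJ.mem_nhds hxJ)] with y h1 h2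
  exact ⟨h1, h2⟩

lemma uMetric_apply (A B C : ℝ → ℝ) (x v w : Quat) :
    uMetric A B C x v w = A (height x) * ((x⁻¹ * v).re * (x⁻¹ * w).re)
      + B (height x) * ((x⁻¹ * v).imI * (x⁻¹ * w).imI)
      + C (height x) * ((x⁻¹ * v).imJ * (x⁻¹ * w).imJ + (x⁻¹ * v).imK * (x⁻¹ * w).imK) := by
  simp only [uMetric, LinearMap.add_apply, LinearMap.smul_apply,
    LinearMap.BilinForm.linMulLin_apply, eta_zero, eta_one, eta_two, eta_three, smul_eq_mul]

/-! ### The Levi-Civita connection and its curvature -/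

/-- The Koszul formula: a torsion-free metric connection `v ↦ dv + B(·, v)` at `x` has the
Christoffel symbols of `g` as its components. -/
lemma christoffel_eq_of_isLeviCivita {g : BilinField} {x : Quat} {B : Quat → Quat → Quat}
    (hdet : IsUnit (gram g x).det) (hsymm : ∀ v w, g x v w = g x w v)
    (htor : ∀ v w, B v w = B w v)
    (hmet : ∀ i j l, pd i (fun y => gram g y j l) x
      = g x (B (stdBasis i) (stdBasis j)) (stdBasis l)
        + g x (stdBasis j) (B (stdBasis i) (stdBasis l))) (k i j : Fin 4) :
    christoffel g k i j x = stdBasis.coord k (B (stdBasis i) (stdBasis j)) := by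
  have hb : ∀ l, pd i (fun y => gram g y j l) x + pd j (fun y => gram g y i l) x
      - pd l (fun y => gram g y i j) x
      = 2 * ∑ m, stdBasis.coord m (B (stdBasis i) (stdBasis j)) * gram g x m l := by
    intro l
    have h1 : g x (B (stdBasis i) (stdBasis j)) (stdBasis l)
        = ∑ m, stdBasis.coord m (B (stdBasis i) (stdBasis j)) * gram g x m l := by
      conv_lhs => rw [← sum_coord (B (stdBasis i) (stdBasis j))]
      simp only [map_sum, map_smul, LinearMap.sum_apply, LinearMap.smul_apply, smul_eq_mul]
      rfl
    rw [← h1, hmet, hmet, hmet, htor (stdBasis j) (stdBasis i), htor (stdBasis l) (stdBasis i),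
      htor (stdBasis l) (stdBasis j), hsymm (B (stdBasis i) (stdBasis l)),
      hsymm (stdBasis i) (B (stdBasis j) (stdBasis l))]
    ring
  have hG : ∀ m l, gram g x m l = gram g x l m := fun m l => hsymm _ _
  have hinv : ∀ m, ∑ l, (gram g x)⁻¹ k l * gram g x l m = (1 : Matrix (Fin 4) (Fin 4) ℝ) k m := by
    intro m
    rw [← Matrix.nonsing_inv_mul _ hdet, Matrix.mul_apply]
  calc christoffel g k i j x
      = 1 / 2 * ∑ l, (gram g x)⁻¹ k l *
        (2 * ∑ m, stdBasis.coord m (B (stdBasis i) (stdBasis j)) * gram g x m l) := by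
        simp only [christoffel, hb]
    _ = ∑ m, stdBasis.coord m (B (stdBasis i) (stdBasis j)) *
          ∑ l, (gram g x)⁻¹ k l * gram g x l m := by
        simp only [Finset.mul_sum]
        rw [Finset.sum_comm]
        refine Finset.sum_congr rfl fun m _ => Finset.sum_congr rfl fun l _ => ?_
        rw [hG m l]; ring
    _ = stdBasis.coord k (B (stdBasis i) (stdBasis j)) := by
        simp [hinv, Matrix.one_apply]

/-- The curvature in terms of the connection form `B` and its derivative, where `L v w u` is the
derivative of `B(v, w)` along `u`. -/
lemma riemann_eq_of_christoffel {g : BilinField} {x : Quat} {B : Quat → Quat →ₗ[ℝ] Quat →ₗ[ℝ] Quat}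
    {L : Quat → Quat → Quat →L[ℝ] Quat}
    (hB : ∀ᶠ y in 𝓝 x, ∀ k i j,
      christoffel g k i j y = stdBasis.coord k (B y (stdBasis i) (stdBasis j)))
    (hL : ∀ v w, HasFDerivAt (fun y => B y v w) (L v w) x) (l k i j : Fin 4) :
    riemann g l k i j x = stdBasis.coord l
      (L (stdBasis j) (stdBasis k) (stdBasis i) - L (stdBasis i) (stdBasis k) (stdBasis j)
        + B x (stdBasis i) (B x (stdBasis j) (stdBasis k))
        - B x (stdBasis j) (B x (stdBasis i) (stdBasis k))) := by
  have hpd : ∀ i j, pd i (christoffel g l j k) x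
      = stdBasis.coord l (L (stdBasis j) (stdBasis k) (stdBasis i)) := by
    intro i j
    have h := (coordCLM l).hasFDerivAt.comp x (hL (stdBasis j) (stdBasis k))
    have h' : HasFDerivAt (christoffel g l j k) _ x :=
      h.congr_of_eventuallyEq (by filter_upwards [hB] with y hy using hy l j k)
    rw [pd, h'.fderiv]; rfl
  have hcomp : ∀ i j, ∑ m, christoffel g l i m x * christoffel g m j k x
      = stdBasis.coord l (B x (stdBasis i) (B x (stdBasis j) (stdBasis k))) := by
    intro i j
    simp only [hB.self_of_nhds]
    conv_rhs => rw [← sum_coord (B x (stdBasis j) (stdBasis k))]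
    simp only [map_sum, map_smul, smul_eq_mul]
    exact Finset.sum_congr rfl fun m _ => mul_comm _ _
  rw [riemann, Finset.sum_sub_distrib, hpd, hpd, hcomp, hcomp]
  simp only [map_add, map_sub]
  ring

/-- The matrix of left multiplication by `x`; its columns are the left-invariant frame at `x`. -/
noncomputable def leftMatrix (x : Quat) : Matrix (Fin 4) (Fin 4) ℝ :=
  LinearMap.toMatrix stdBasis stdBasis (LinearMap.mulLeft ℝ x)

lemma leftMatrix_apply (x : Quat) (i a : Fin 4) :
    leftMatrix x i a = stdBasis.coord i (x * stdBasis a) := by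
  simp only [leftMatrix, LinearMap.toMatrix_apply, LinearMap.mulLeft_apply, Module.Basis.coord_apply]

lemma leftMatrix_mul (x y : Quat) : leftMatrix x * leftMatrix y = leftMatrix (x * y) := by
  rw [leftMatrix, leftMatrix, leftMatrix, LinearMap.mulLeft_mul, LinearMap.toMatrix_comp _ stdBasis]

lemma leftMatrix_one : leftMatrix 1 = 1 := by
  rw [leftMatrix, LinearMap.mulLeft_one, LinearMap.toMatrix_id]

/-- The diagonal entries of `uMetric A B C` in the left-invariant frame, at height `t`. -/
def diagEntries (A B C : ℝ → ℝ) (t : ℝ) : Fin 4 → ℝ := ![A t, B t, C t, C t]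

lemma uMetric_eq_sum (A B C : ℝ → ℝ) (x v w : Quat) :
    uMetric A B C x v w = ∑ a, diagEntries A B C (height x) a *
      (stdBasis.coord a (x⁻¹ * v) * stdBasis.coord a (x⁻¹ * w)) := by
  rw [uMetric_apply, Fin.sum_univ_four]
  simp only [coord_zero, coord_one, coord_two, coord_three]
  simp only [diagEntries, Matrix.cons_val]
  ring

lemma uMetric_symm (A B C : ℝ → ℝ) (x v w : Quat) :
    uMetric A B C x v w = uMetric A B C x w v := by
  simp only [uMetric_apply]; ring

lemma gram_uMetric (A B C : ℝ → ℝ) (x : Quat) :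
    gram (uMetric A B C) x = (leftMatrix x⁻¹).transpose *
      Matrix.diagonal (diagEntries A B C (height x)) * leftMatrix x⁻¹ := by
  ext i j
  rw [Matrix.mul_apply]
  simp only [Matrix.mul_diagonal, Matrix.transpose_apply, leftMatrix_apply]
  rw [gram, Matrix.of_apply, uMetric_eq_sum]
  exact Finset.sum_congr rfl fun a _ => by ring

section

variable {A B C : ℝ → ℝ} {x : Quat}

lemma gram_uMetric_mul (hx : x ≠ 0) (hd : ∀ a, diagEntries A B C (height x) a ≠ 0) :
    gram (uMetric A B C) x * (leftMatrix x *
      Matrix.diagonal (fun a => (diagEntries A B C (height x) a)⁻¹) *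
        (leftMatrix x).transpose) = 1 := by
  have h1 : leftMatrix x⁻¹ * leftMatrix x = 1 := by
    rw [leftMatrix_mul, inv_mul_cancel₀ hx, leftMatrix_one]
  have h2 : leftMatrix x * leftMatrix x⁻¹ = 1 := by
    rw [leftMatrix_mul, mul_inv_cancel₀ hx, leftMatrix_one]
  have h3 : Matrix.diagonal (diagEntries A B C (height x)) *
      Matrix.diagonal (fun a => (diagEntries A B C (height x) a)⁻¹) = 1 := by
    rw [Matrix.diagonal_mul_diagonal]
    simp only [mul_inv_cancel₀ (hd _), Matrix.diagonal_one]
  rw [gram_uMetric]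
  calc _ = (leftMatrix x⁻¹).transpose * (Matrix.diagonal (diagEntries A B C (height x)) *
        (leftMatrix x⁻¹ * leftMatrix x) *
        Matrix.diagonal (fun a => (diagEntries A B C (height x) a)⁻¹)) *
        (leftMatrix x).transpose := by simp only [Matrix.mul_assoc]
    _ = 1 := by
      rw [h1, Matrix.mul_one, h3, Matrix.mul_one, ← Matrix.transpose_mul, h2, Matrix.transpose_one]

lemma gram_uMetric_inv (hx : x ≠ 0) (hd : ∀ a, diagEntries A B C (height x) a ≠ 0) :
    (gram (uMetric A B C) x)⁻¹ = leftMatrix x *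
      Matrix.diagonal (fun a => (diagEntries A B C (height x) a)⁻¹) * (leftMatrix x).transpose :=
  Matrix.inv_eq_right_inv (gram_uMetric_mul hx hd)

lemma isUnit_det_gram_uMetric (hx : x ≠ 0) (hd : ∀ a, diagEntries A B C (height x) a ≠ 0) :
    IsUnit (gram (uMetric A B C) x).det :=
  Matrix.isUnit_det_of_right_inverse (gram_uMetric_mul hx hd)

end

/-- The bilinear map of quaternions with the given values on pairs of basis vectors. -/
noncomputable def bilinearOf (G : Fin 4 → Fin 4 → Quat) : Quat →ₗ[ℝ] Quat →ₗ[ℝ] Quat :=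
  ∑ a, ∑ b, (stdBasis.coord a).smulRight ((stdBasis.coord b).smulRight (G a b))

lemma bilinearOf_apply (G : Fin 4 → Fin 4 → Quat) (p q : Quat) :
    bilinearOf G p q = ∑ a, ∑ b, (stdBasis.coord a p * stdBasis.coord b q) • G a b := by
  simp only [bilinearOf, LinearMap.sum_apply, LinearMap.smulRight_apply, LinearMap.smul_apply,
    smul_smul]

/-- A left-invariant connection on `J × S³`: `omega t a b` is `∇_{e_a} e_b` at height `t`, where a
left-invariant field `x ↦ x p` is identified with the quaternion `p`, and `omega'` is its derivative
in `t`.  The remaining conditions say that it is the Levi-Civita connection of the metric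
with diagonal entries `A`, `B`, `C`, `C`, whose derivatives are `A'`, `B'`, `C'`. -/
structure IsInvariantLeviCivita (J : Set ℝ) (A B C A' B' C' : ℝ → ℝ)
    (omega omega' : ℝ → Fin 4 → Fin 4 → Quat) : Prop where
  ne_zero : ∀ t ∈ J, ∀ a, diagEntries A B C t a ≠ 0
  derivA : ∀ t ∈ J, HasDerivAt A (A' t) t
  derivB : ∀ t ∈ J, HasDerivAt B (B' t) t
  derivC : ∀ t ∈ J, HasDerivAt C (C' t) t
  deriv : ∀ t ∈ J, ∀ a b, HasDerivAt (fun τ => omega τ a b) (omega' t a b) t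
  torsion : ∀ t ∈ J, ∀ p q,
    bilinearOf (omega t) p q - bilinearOf (omega t) q p = p * q - q * p
  metric : ∀ t ∈ J, ∀ p q r, p.re * ∑ a, diagEntries A' B' C' t a *
      (stdBasis.coord a q * stdBasis.coord a r)
    = (∑ a, diagEntries A B C t a *
        (stdBasis.coord a (bilinearOf (omega t) p q) * stdBasis.coord a r))
      + ∑ a, diagEntries A B C t a *
        (stdBasis.coord a q * stdBasis.coord a (bilinearOf (omega t) p r))

/-- The connection `omega`, in Cartesian coordinates: `x p ↦ (x q ↦ x (ω(p, q) - p q))`, the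
product `p q` being the derivative of the field `x ↦ x q`. -/
noncomputable def cartesianConnection (omega : ℝ → Fin 4 → Fin 4 → Quat) (x : Quat) :
    Quat →ₗ[ℝ] Quat →ₗ[ℝ] Quat :=
  ((bilinearOf (omega (height x)) - LinearMap.mul ℝ Quat).compl₁₂
    (LinearMap.mulLeft ℝ x⁻¹) (LinearMap.mulLeft ℝ x⁻¹)).compr₂ (LinearMap.mulLeft ℝ x)

lemma cartesianConnection_apply (omega : ℝ → Fin 4 → Fin 4 → Quat) (x v w : Quat) :
    cartesianConnection omega x v w
      = x * (bilinearOf (omega (height x)) (x⁻¹ * v) (x⁻¹ * w) - x⁻¹ * v * (x⁻¹ * w)) := rfl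

/-- The curvature `R(p, q) r` of an invariant connection, for left-invariant fields. -/
noncomputable def invariantCurvature (om om' : Fin 4 → Fin 4 → Quat) :
    Quat →ₗ[ℝ] Quat →ₗ[ℝ] Quat →ₗ[ℝ] Quat where
  toFun p := p.re • bilinearOf om' - (stdBasis.coord 0).smulRight (bilinearOf om' p)
    + (bilinearOf om).compr₂ (bilinearOf om p) - (bilinearOf om).compl₂ (bilinearOf om p)
    - bilinearOf om ∘ₗ (LinearMap.mul ℝ Quat p - (LinearMap.mul ℝ Quat).flip p)
  map_add' p q := by
    refine LinearMap.ext₂ fun r t => ?_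
    simp [-Quaternion.re_mul]
    module
  map_smul' c q := by
    refine LinearMap.ext₂ fun r t => ?_
    simp
    module

lemma invariantCurvature_apply (om om' : Fin 4 → Fin 4 → Quat) (p q r : Quat) :
    invariantCurvature om om' p q r = p.re • bilinearOf om' q r - q.re • bilinearOf om' p r
      + bilinearOf om p (bilinearOf om q r) - bilinearOf om q (bilinearOf om p r)
      - bilinearOf om (p * q - q * p) r := rfl

/-- A left-invariant bilinear map `B(x⁻¹ v, x⁻¹ w)` is differentiated by means of
`D_u (x⁻¹ v) = -(x⁻¹ u) (x⁻¹ v)`. -/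
lemma hasFDerivAt_bilinearOf {omega omega' : ℝ → Fin 4 → Fin 4 → Quat} {x : Quat} (hx : x ≠ 0)
    (h : ∀ a b, HasDerivAt (fun τ => omega τ a b) (omega' (height x) a b) (height x))
    (v w : Quat) : ∃ L : Quat →L[ℝ] Quat,
      HasFDerivAt (fun y => bilinearOf (omega (height y)) (y⁻¹ * v) (y⁻¹ * w)) L x ∧
      ∀ u, L u = (x⁻¹ * u).re • bilinearOf (omega' (height x)) (x⁻¹ * v) (x⁻¹ * w)
        - bilinearOf (omega (height x)) (x⁻¹ * u * (x⁻¹ * v)) (x⁻¹ * w)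
        - bilinearOf (omega (height x)) (x⁻¹ * v) (x⁻¹ * u * (x⁻¹ * w)) := by
  have hc : ∀ a v, HasFDerivAt (fun y : Quat => coordCLM a (y⁻¹ * v))
      (coordCLM a ∘L maurerCartanDeriv x v) x := fun a v =>
    (coordCLM a).hasFDerivAt.comp x (hasFDerivAt_inv_mul hx v)
  have ho : ∀ a b, HasFDerivAt (fun y : Quat => omega (height y) a b)
      (ContinuousLinearMap.toSpanSingleton ℝ (omega' (height x) a b) ∘L heightDeriv x) x :=
    fun a b => (h a b).hasFDerivAt.comp x (hasFDerivAt_height hx)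
  have hs := HasFDerivAt.fun_sum (u := Finset.univ) fun a _ =>
    HasFDerivAt.fun_sum (u := Finset.univ) fun b _ =>
      ((hc a v).mul (hc b w)).smul (ho a b)
  refine ⟨_, hs.congr_of_eventuallyEq (.of_forall fun y => ?_), fun u => ?_⟩
  · simp only [bilinearOf_apply]; rfl
  · simp only [bilinearOf_apply, Finset.smul_sum, ← Finset.sum_sub_distrib, sum_apply]
    refine Finset.sum_congr rfl fun a _ => Finset.sum_congr rfl fun b _ => ?_
    simp only [add_apply, smul_apply, Pi.mul_apply, ContinuousLinearMap.smulRight_apply,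
      ContinuousLinearMap.comp_apply, maurerCartanDeriv_apply, heightDeriv_apply, map_neg,
      smul_eq_mul, coordCLM_apply, ContinuousLinearMap.toSpanSingleton_apply]
    module

section

variable {J : Set ℝ} {A B C A' B' C' : ℝ → ℝ} {omega omega' : ℝ → Fin 4 → Fin 4 → Quat}

lemma hasFDerivAt_uMetric {x : Quat} (hx : x ≠ 0)
    (hA : HasDerivAt A (A' (height x)) (height x)) (hB : HasDerivAt B (B' (height x)) (height x))
    (hC : HasDerivAt C (C' (height x)) (height x)) (v w : Quat) :
    ∃ L : Quat →L[ℝ] ℝ, HasFDerivAt (fun y => uMetric A B C y v w) L x ∧ ∀ u, L u =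
      (x⁻¹ * u).re * (∑ a, diagEntries A' B' C' (height x) a *
        (stdBasis.coord a (x⁻¹ * v) * stdBasis.coord a (x⁻¹ * w)))
      - ∑ a, diagEntries A B C (height x) a *
        (stdBasis.coord a (x⁻¹ * u * (x⁻¹ * v)) * stdBasis.coord a (x⁻¹ * w)
          + stdBasis.coord a (x⁻¹ * v) * stdBasis.coord a (x⁻¹ * u * (x⁻¹ * w))) := by
  have hd : ∀ a, HasDerivAt (fun t => diagEntries A B C t a)
      (diagEntries A' B' C' (height x) a) (height x) := by
    intro a; fin_cases a
    · exact hA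
    · exact hB
    · exact hC
    · exact hC
  have hc : ∀ a v, HasFDerivAt (fun y : Quat => coordCLM a (y⁻¹ * v))
      (coordCLM a ∘L maurerCartanDeriv x v) x := fun a v =>
    (coordCLM a).hasFDerivAt.comp x (hasFDerivAt_inv_mul hx v)
  have h := HasFDerivAt.fun_sum (u := Finset.univ) fun a _ =>
    ((hd a).comp_hasFDerivAt x (hasFDerivAt_height hx)).mul ((hc a v).mul (hc a w))
  refine ⟨_, h.congr_of_eventuallyEq (.of_forall fun y => ?_), fun u => ?_⟩
  · simp only [uMetric_eq_sum]; rfl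
  · simp only [sum_apply, add_apply, smul_apply, Pi.mul_apply,
      ContinuousLinearMap.comp_apply, maurerCartanDeriv_apply, heightDeriv_apply, map_neg,
      smul_eq_mul, coordCLM_apply, Function.comp_apply]
    rw [Finset.mul_sum, ← Finset.sum_sub_distrib]
    exact Finset.sum_congr rfl fun a _ => by ring

lemma christoffel_uMetric (h : IsInvariantLeviCivita J A B C A' B' C' omega omega') {x : Quat}
    (hx : x ∈ shell J) (k i j : Fin 4) :
    christoffel (uMetric A B C) k i j x
      = stdBasis.coord k (cartesianConnection omega x (stdBasis i) (stdBasis j)) := by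
  obtain ⟨hx0, hxJ⟩ := hx
  refine christoffel_eq_of_isLeviCivita (B := fun v w => cartesianConnection omega x v w)
    (isUnit_det_gram_uMetric hx0 (h.ne_zero _ hxJ)) (uMetric_symm A B C x) ?_ ?_ k i j
  · intro v w
    have := h.torsion _ hxJ (x⁻¹ * v) (x⁻¹ * w)
    simp only [cartesianConnection_apply]
    congr 1
    rw [sub_eq_sub_iff_add_eq_add] at this ⊢
    rw [this, add_comm]
  · intro i j l
    obtain ⟨L, hL, hLu⟩ := hasFDerivAt_uMetric hx0 (h.derivA _ hxJ) (h.derivB _ hxJ)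
      (h.derivC _ hxJ) (stdBasis j) (stdBasis l)
    have hL' : HasFDerivAt (fun y => gram (uMetric A B C) y j l) L x := hL
    rw [pd, hL'.fderiv, hLu, h.metric _ hxJ]
    simp only [uMetric_eq_sum, cartesianConnection_apply, inv_mul_cancel_left₀ hx0, map_sub]
    rw [← Finset.sum_add_distrib, ← Finset.sum_sub_distrib, ← Finset.sum_add_distrib]
    exact Finset.sum_congr rfl fun a _ => by ring

lemma riemann_uMetric (hJ : IsOpen J)
    (h : IsInvariantLeviCivita J A B C A' B' C' omega omega') {x : Quat}
    (hx : x ∈ shell J) (l k i j : Fin 4) :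
    riemann (uMetric A B C) l k i j x
      = stdBasis.coord l (x * invariantCurvature (omega (height x)) (omega' (height x))
          (x⁻¹ * stdBasis i) (x⁻¹ * stdBasis j) (x⁻¹ * stdBasis k)) := by
  obtain ⟨hx0, hxJ⟩ := id hx
  choose M hM hMu using hasFDerivAt_bilinearOf (omega' := omega') hx0 (h.deriv _ hxJ)
  have hder := fun v w => (hasFDerivAt_id x).mul' ((hM v w).sub
      ((hasFDerivAt_inv_mul hx0 v).mul' (hasFDerivAt_inv_mul hx0 w)))
  rw [riemann_eq_of_christoffel (B := cartesianConnection omega) ?_ hder]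
  · congr 1
    set p := x⁻¹ * stdBasis i with hp
    set q := x⁻¹ * stdBasis j with hq
    set r := x⁻¹ * stdBasis k with hr
    have hp' : stdBasis i = x * p := by rw [hp, mul_inv_cancel_left₀ hx0]
    have hq' : stdBasis j = x * q := by rw [hq, mul_inv_cancel_left₀ hx0]
    have hr' : stdBasis k = x * r := by rw [hr, mul_inv_cancel_left₀ hx0]
    rw [hp', hq', hr']
    clear_value p q r
    simp [cartesianConnection_apply, inv_mul_cancel_left₀ hx0, invariantCurvature_apply, hMu]
    noncomm_ring
  · filter_upwards [(isOpen_shell hJ).mem_nhds hx] with y hy k i j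
    exact christoffel_uMetric h hy k i j

lemma sum_leftMatrix_smul {x : Quat} (hx : x ≠ 0) (a : Fin 4) :
    ∑ k, leftMatrix x k a • (x⁻¹ * stdBasis k) = stdBasis a := by
  simp only [leftMatrix_apply, ← mul_smul_comm, ← Finset.mul_sum]
  rw [sum_coord, inv_mul_cancel_left₀ hx]

/-- Contractions with the inverse metric may be taken in the left-invariant frame. -/
lemma sum_gram_inv {x : Quat} (hx : x ≠ 0) (hd : ∀ a, diagEntries A B C (height x) a ≠ 0)
    (h : Quat →ₗ[ℝ] Quat →ₗ[ℝ] ℝ) :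
    ∑ k, ∑ c, (gram (uMetric A B C) x)⁻¹ k c * h (x⁻¹ * stdBasis k) (x⁻¹ * stdBasis c)
      = ∑ a, (diagEntries A B C (height x) a)⁻¹ * h (stdBasis a) (stdBasis a) := by
  have h1 : ∀ a, h (stdBasis a) (stdBasis a) = ∑ k, ∑ c, leftMatrix x k a *
      (leftMatrix x c a * h (x⁻¹ * stdBasis k) (x⁻¹ * stdBasis c)) := by
    intro a
    conv_lhs => rw [← sum_leftMatrix_smul hx a]
    simp only [map_sum, map_smul, LinearMap.sum_apply, LinearMap.smul_apply, smul_eq_mul,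
      Finset.mul_sum]
    rw [Finset.sum_comm]
    exact Finset.sum_congr rfl fun k _ => Finset.sum_congr rfl fun c _ => by ring
  have h2 : ∀ k c, (gram (uMetric A B C) x)⁻¹ k c
      = ∑ a, leftMatrix x k a * (diagEntries A B C (height x) a)⁻¹ * leftMatrix x c a := by
    intro k c
    rw [gram_uMetric_inv hx hd, Matrix.mul_apply]
    simp only [Matrix.mul_diagonal, Matrix.transpose_apply]
  simp only [h1, h2, Finset.sum_mul, Finset.mul_sum]
  conv_rhs => rw [Finset.sum_comm]
  refine Finset.sum_congr rfl fun k _ => ?_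
  conv_rhs => rw [Finset.sum_comm]
  exact Finset.sum_congr rfl fun c _ => Finset.sum_congr rfl fun a _ => by ring

/-- The Ricci tensor is a trace, which may be taken in the left-invariant frame. -/
lemma ricci_uMetric (hJ : IsOpen J)
    (h : IsInvariantLeviCivita J A B C A' B' C' omega omega') {x : Quat}
    (hx : x ∈ shell J) (k j : Fin 4) :
    ricci (uMetric A B C) k j x = ∑ a, stdBasis.coord a
      (invariantCurvature (omega (height x)) (omega' (height x)) (stdBasis a)
        (x⁻¹ * stdBasis j) (x⁻¹ * stdBasis k)) := by
  set T : Quat →ₗ[ℝ] Quat := ((invariantCurvature (omega (height x)) (omega' (height x))).flip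
    (x⁻¹ * stdBasis j)).flip (x⁻¹ * stdBasis k) with hT
  have htr : ∀ S : Quat →ₗ[ℝ] Quat,
      LinearMap.trace ℝ Quat S = ∑ a, stdBasis.coord a (S (stdBasis a)) := by
    intro S
    rw [LinearMap.trace_eq_matrix_trace ℝ stdBasis, Matrix.trace]
    exact Finset.sum_congr rfl fun a _ => by
      rw [Matrix.diag_apply, LinearMap.toMatrix_apply, Module.Basis.coord_apply]
  have h1 : ricci (uMetric A B C) k j x
      = LinearMap.trace ℝ Quat (LinearMap.mulLeft ℝ x * (T * LinearMap.mulLeft ℝ x⁻¹)) := by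
    rw [htr]
    exact Finset.sum_congr rfl fun l _ => riemann_uMetric hJ h hx l k l j
  have h2 : LinearMap.mulLeft ℝ x⁻¹ * LinearMap.mulLeft ℝ x = 1 := by
    ext1 v
    exact inv_mul_cancel_left₀ hx.1 v
  rw [h1, LinearMap.trace_mul_comm, mul_assoc, h2, mul_one, htr]
  rfl

lemma sum_sum_mul_sum_comm {ι : Type*} [Fintype ι] (u : Matrix ι ι ℝ) (w : ι → ℝ)
    (H : ι → ι → ι → ℝ) :
    ∑ k, ∑ c, u k c * ∑ j, w j * H k c j = ∑ j, w j * ∑ k, ∑ c, u k c * H k c j := by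
  simp only [Finset.mul_sum]
  conv_rhs => rw [Finset.sum_comm]
  refine Finset.sum_congr rfl fun k _ => ?_
  conv_rhs => rw [Finset.sum_comm]
  exact Finset.sum_congr rfl fun c _ => Finset.sum_congr rfl fun j _ => by ring

lemma sum_reorder {ι : Type*} [Fintype ι] (f : ι → ι → ι → ι → ι → ι → ι → ι → ℝ) :
    ∑ a, ∑ k, ∑ i, ∑ j, ∑ b, ∑ c, ∑ d, ∑ e, f a k i j b c d e
      = ∑ k, ∑ c, ∑ i, ∑ d, ∑ j, ∑ e, ∑ a, ∑ b, f a k i j b c d e := by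
  let E : ι × ι × ι × ι × ι × ι × ι × ι ≃ ι × ι × ι × ι × ι × ι × ι × ι :=
    { toFun := fun ⟨a, k, i, j, b, c, d, e⟩ => ⟨k, c, i, d, j, e, a, b⟩
      invFun := fun ⟨k, c, i, d, j, e, a, b⟩ => ⟨a, k, i, j, b, c, d, e⟩
      left_inv := fun _ => rfl
      right_inv := fun _ => rfl }
  have h := Fintype.sum_equiv E (fun ⟨a, k, i, j, b, c, d, e⟩ => f a k i j b c d e)
    (fun ⟨k, c, i, d, j, e, a, b⟩ => f a k i j b c d e) (fun _ => rfl)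
  simpa only [Fintype.sum_prod_type] using h

/-- The norm of the curvature, computed in the left-invariant frame. -/
lemma riemannNormSq_uMetric (hJ : IsOpen J)
    (h : IsInvariantLeviCivita J A B C A' B' C' omega omega') {x : Quat} (hx : x ∈ shell J) :
    riemannNormSq (uMetric A B C) x = ∑ k, ∑ i, ∑ j, ∑ a,
      (diagEntries A B C (height x) k)⁻¹ * (diagEntries A B C (height x) i)⁻¹
        * (diagEntries A B C (height x) j)⁻¹ * diagEntries A B C (height x) a *
        (stdBasis.coord a (invariantCurvature (omega (height x)) (omega' (height x))
          (stdBasis i) (stdBasis j) (stdBasis k))) ^ 2 := by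
  obtain ⟨hx0, hxJ⟩ := id hx
  have hd := h.ne_zero _ hxJ
  set R := invariantCurvature (omega (height x)) (omega' (height x)) with hR
  set G := gram (uMetric A B C) x with hG
  set g : Quat →ₗ[ℝ] Quat →ₗ[ℝ] ℝ := (uMetric A B C x).compl₁₂ (LinearMap.mulLeft ℝ x)
    (LinearMap.mulLeft ℝ x) with hg
  have hgsum : ∀ p, g p p = ∑ a, diagEntries A B C (height x) a * stdBasis.coord a p ^ 2 := by
    intro p
    simp only [hg, LinearMap.compl₁₂_apply, LinearMap.mulLeft_apply, uMetric_eq_sum,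
      inv_mul_cancel_left₀ hx0, sq]
  set b : Fin 4 → Quat := fun k => x⁻¹ * stdBasis k with hb
  have hquad : ∀ k i j c d e, ∑ a, ∑ b, G a b *
      (riemann (uMetric A B C) a k i j x * riemann (uMetric A B C) b c d e x)
      = g (R (b i) (b j) (b k)) (R (b d) (b e) (b c)) := by
    intro k i j c d e
    have h1 : ∀ u v, uMetric A B C x u v
        = ∑ a, ∑ b, G a b * (stdBasis.coord a u * stdBasis.coord b v) := by
      intro u v
      conv_lhs => rw [← sum_coord u, ← sum_coord v]
      simp only [map_sum, map_smul, LinearMap.sum_apply, LinearMap.smul_apply, smul_eq_mul,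
        Finset.mul_sum, hG, gram, Matrix.of_apply]
      rw [Finset.sum_comm]
      exact Finset.sum_congr rfl fun a _ => Finset.sum_congr rfl fun b _ => by ring
    simp only [riemann_uMetric hJ h hx, hg, LinearMap.compl₁₂_apply, LinearMap.mulLeft_apply, h1]
    rfl
  clear_value R g
  calc riemannNormSq (uMetric A B C) x
      = ∑ k, ∑ c, G⁻¹ k c * ∑ i, ∑ d, G⁻¹ i d * ∑ j, ∑ e, G⁻¹ j e *
          g (R (b i) (b j) (b k)) (R (b d) (b e) (b c)) := by
        simp only [← hquad, Finset.mul_sum]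
        rw [riemannNormSq, sum_reorder]
        refine Finset.sum_congr rfl fun k _ => Finset.sum_congr rfl fun c _ =>
          Finset.sum_congr rfl fun i _ => Finset.sum_congr rfl fun d _ =>
          Finset.sum_congr rfl fun j _ => Finset.sum_congr rfl fun e _ =>
          Finset.sum_congr rfl fun a _ => Finset.sum_congr rfl fun b _ => ?_
        simp only [← hG]
        ring
    _ = _ := by
      have e1 : ∀ k c i d, ∑ j, ∑ e, G⁻¹ j e * g (R (b i) (b j) (b k)) (R (b d) (b e) (b c))
          = ∑ j, (diagEntries A B C (height x) j)⁻¹ *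
            g (R (b i) (stdBasis j) (b k)) (R (b d) (stdBasis j) (b c)) := fun k c i d =>
        sum_gram_inv hx0 hd (g.compl₁₂ ((R (b i)).flip (b k)) ((R (b d)).flip (b c)))
      have e2 : ∀ k c j, ∑ i, ∑ d, G⁻¹ i d *
            g (R (b i) (stdBasis j) (b k)) (R (b d) (stdBasis j) (b c))
          = ∑ i, (diagEntries A B C (height x) i)⁻¹ *
            g (R (stdBasis i) (stdBasis j) (b k)) (R (stdBasis i) (stdBasis j) (b c)) :=
        fun k c j => sum_gram_inv hx0 hd
          (g.compl₁₂ ((R.flip (stdBasis j)).flip (b k)) ((R.flip (stdBasis j)).flip (b c)))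
      have e3 : ∀ i j, ∑ k, ∑ c, G⁻¹ k c *
            g (R (stdBasis i) (stdBasis j) (b k)) (R (stdBasis i) (stdBasis j) (b c))
          = ∑ k, (diagEntries A B C (height x) k)⁻¹ *
            g (R (stdBasis i) (stdBasis j) (stdBasis k)) (R (stdBasis i) (stdBasis j) (stdBasis k)) :=
        fun i j => sum_gram_inv hx0 hd
          (g.compl₁₂ (R (stdBasis i) (stdBasis j)) (R (stdBasis i) (stdBasis j)))
      simp only [e1, sum_sum_mul_sum_comm, e2, e3, hgsum]
      simp only [Finset.mul_sum]
      conv_rhs => rw [Finset.sum_comm]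
      conv_rhs => enter [2, i]; rw [Finset.sum_comm]
      conv_rhs => rw [Finset.sum_comm]
      refine Finset.sum_congr rfl fun j _ => Finset.sum_congr rfl fun i _ =>
        Finset.sum_congr rfl fun k _ => Finset.sum_congr rfl fun a _ => ?_
      ring

end

/-! ### Curvature of the model metrics -/

/-- The Levi-Civita connection of the metric with `F = w²`, `C = C₀ e^{sz} / w²`,
`w = 1 + c e^{sz}`, in the left-invariant frame. -/
noncomputable def modelConnection (s w : ℝ) : Fin 4 → Fin 4 → Quat :=
  ![![(s * (2 / w - 3 / 2)) • stdBasis 0, (s / 2) • stdBasis 1, (s * (1 / w - 1 / 2)) • stdBasis 2,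
      (s * (1 / w - 1 / 2)) • stdBasis 3],
    ![(s / 2) • stdBasis 1, (-(2 * s * w ^ 4)) • stdBasis 0, (2 - w ^ 2) • stdBasis 3,
      (w ^ 2 - 2) • stdBasis 2],
    ![(s * (1 / w - 1 / 2)) • stdBasis 2, (-w ^ 2) • stdBasis 3,
      (-(s * (4 * w - 2 * w ^ 2))) • stdBasis 0, stdBasis 1],
    ![(s * (1 / w - 1 / 2)) • stdBasis 3, w ^ 2 • stdBasis 2, -stdBasis 1,
      (-(s * (4 * w - 2 * w ^ 2))) • stdBasis 0]]

/-- The derivative of `modelConnection s w` along a change `w'` of `w`. -/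
noncomputable def modelConnectionDeriv (s w w' : ℝ) : Fin 4 → Fin 4 → Quat :=
  ![![(-(2 * s * w' / w ^ 2)) • stdBasis 0, 0, (-(s * w' / w ^ 2)) • stdBasis 2,
      (-(s * w' / w ^ 2)) • stdBasis 3],
    ![0, (-(8 * s * w ^ 3 * w')) • stdBasis 0, (-(2 * w * w')) • stdBasis 3,
      (2 * w * w') • stdBasis 2],
    ![(-(s * w' / w ^ 2)) • stdBasis 2, (-(2 * w * w')) • stdBasis 3,
      (-(s * (4 - 4 * w) * w')) • stdBasis 0, 0],
    ![(-(s * w' / w ^ 2)) • stdBasis 3, (2 * w * w') • stdBasis 2, 0,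
      (-(s * (4 - 4 * w) * w')) • stdBasis 0]]

lemma hasDerivAt_modelConnection {s t w' : ℝ} {w : ℝ → ℝ} (hw : HasDerivAt w w' t)
    (h0 : w t ≠ 0) (a b : Fin 4) :
    HasDerivAt (fun τ => modelConnection s (w τ) a b) (modelConnectionDeriv s (w t) w' a b) t := by
  have hinv := hw.inv h0
  have h1 : HasDerivAt (fun τ => s * (2 / w τ - 3 / 2)) (-(2 * s * w' / w t ^ 2)) t := by
    have := ((hinv.const_mul 2).sub_const (3 / 2)).const_mul s
    simp only [div_eq_mul_inv] at this ⊢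
    exact this.congr_deriv (by ring)
  have h2 : HasDerivAt (fun τ => s * (1 / w τ - 1 / 2)) (-(s * w' / w t ^ 2)) t := by
    have := ((hinv.const_mul 1).sub_const (1 / 2)).const_mul s
    simp only [div_eq_mul_inv] at this ⊢
    exact this.congr_deriv (by ring)
  have h3 : HasDerivAt (fun τ => -(2 * s * w τ ^ 4)) (-(8 * s * w t ^ 3 * w')) t :=
    ((hw.pow 4).const_mul (2 * s)).neg.congr_deriv (by push_cast; ring)
  have hsq : HasDerivAt (fun τ => w τ ^ 2) (2 * w t * w') t :=
    (hw.pow 2).congr_deriv (by push_cast; ring)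
  have h4 : HasDerivAt (fun τ => -(s * (4 * w τ - 2 * w τ ^ 2))) (-(s * (4 - 4 * w t) * w')) t :=
    (((hw.const_mul 4).sub (hsq.const_mul 2)).const_mul s).neg.congr_deriv (by ring)
  have h5 : HasDerivAt (fun τ => 2 - w τ ^ 2) (-(2 * w t * w')) t := hsq.const_sub 2
  have h6 : HasDerivAt (fun τ => w τ ^ 2 - 2) (2 * w t * w') t := hsq.sub_const 2
  have h7 : HasDerivAt (fun τ => -w τ ^ 2) (-(2 * w t * w')) t := hsq.neg
  fin_cases a <;> fin_cases b <;> first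
    | exact hasDerivAt_const _ _
    | exact h1.smul_const _
    | exact h2.smul_const _
    | exact h3.smul_const _
    | exact h4.smul_const _
    | exact h5.smul_const _
    | exact h6.smul_const _
    | exact h7.smul_const _
    | exact hsq.smul_const _

lemma bilinearOf_modelConnection (s w : ℝ) (p q : Quat) :
    bilinearOf (modelConnection s w) p q =
      quat (s * (2 / w - 3 / 2) * p.re * q.re - 2 * s * w ^ 4 * p.imI * q.imI
          - s * (4 * w - 2 * w ^ 2) * (p.imJ * q.imJ + p.imK * q.imK))
        (s / 2 * (p.re * q.imI + p.imI * q.re) + (p.imJ * q.imK - p.imK * q.imJ))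
        (s * (1 / w - 1 / 2) * (p.re * q.imJ + p.imJ * q.re) + w ^ 2 * p.imK * q.imI
          + (w ^ 2 - 2) * p.imI * q.imK)
        (s * (1 / w - 1 / 2) * (p.re * q.imK + p.imK * q.re) + (2 - w ^ 2) * p.imI * q.imJ
          - w ^ 2 * p.imJ * q.imI) := by
  simp only [bilinearOf_apply, Fin.sum_univ_four, modelConnection, Matrix.cons_val, coord_zero,
    coord_one, coord_two, coord_three]
  ext <;> simp <;> ring

lemma bilinearOf_modelConnectionDeriv (s w w' : ℝ) (p q : Quat) :
    bilinearOf (modelConnectionDeriv s w w') p q =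
      quat (-(2 * s * w' / w ^ 2) * p.re * q.re - 8 * s * w ^ 3 * w' * p.imI * q.imI
          - s * (4 - 4 * w) * w' * (p.imJ * q.imJ + p.imK * q.imK))
        (0)
        (-(s * w' / w ^ 2) * (p.re * q.imJ + p.imJ * q.re) + 2 * w * w' * p.imK * q.imI
          + 2 * w * w' * p.imI * q.imK)
        (-(s * w' / w ^ 2) * (p.re * q.imK + p.imK * q.re) - 2 * w * w' * p.imI * q.imJ
          - 2 * w * w' * p.imJ * q.imI) := by
  simp only [bilinearOf_apply, Fin.sum_univ_four, modelConnectionDeriv, Matrix.cons_val, coord_zero,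
    coord_one, coord_two, coord_three]
  ext <;> simp <;> ring

/-- The curvature of the model metrics. After rescaling the left-invariant frame to one whose members
have equal length, it is `4 w (w - 1) (a₁ Λ₁ - a₂ Λ₂ / 2 - a₃ Λ₃ / 2)`, where `a₁, a₂, a₃` are the
components of `p ∧ q` that are self-dual (anti-self-dual, for one of the signs), and `Λ₁, Λ₂, Λ₃` are
the corresponding anticommuting complex structures. The coefficients `1, -1/2, -1/2` add up to zero,
which is the vanishing of the Ricci tensor. -/
lemma invariantCurvature_modelConnection {s w : ℝ} (hs : s = 1 ∨ s = -1) (hw : w ≠ 0)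
    (p q r : Quat) :
    invariantCurvature (modelConnection s w) (modelConnectionDeriv s w (s * (w - 1))) p q r =
      quat (4 * w * (w - 1) * (2 * w * (-(1 / 2 * (p.re * q.imI - p.imI * q.re) - s * (p.imJ * q.imK - p.imK * q.imJ))
            * w * r.imI
          + 1 / 2 * (1 / (2 * w) * (p.re * q.imJ - p.imJ * q.re)
            - s * w * (p.imK * q.imI - p.imI * q.imK)) * r.imJ
          + 1 / 2 * (1 / (2 * w) * (p.re * q.imK - p.imK * q.re)
            - s * w * (p.imI * q.imJ - p.imJ * q.imI)) * r.imK)))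
        (4 * w * (w - 1) * (1 / w * ((1 / 2 * (p.re * q.imI - p.imI * q.re) - s * (p.imJ * q.imK - p.imK * q.imJ))
            * (r.re / (2 * w))
          + 1 / 2 * (1 / (2 * w) * (p.re * q.imJ - p.imJ * q.re)
            - s * w * (p.imK * q.imI - p.imI * q.imK)) * s * r.imK
          - 1 / 2 * (1 / (2 * w) * (p.re * q.imK - p.imK * q.re)
            - s * w * (p.imI * q.imJ - p.imJ * q.imI)) * s * r.imJ)))
        (4 * w * (w - 1) * ((1 / 2 * (p.re * q.imI - p.imI * q.re) - s * (p.imJ * q.imK - p.imK * q.imJ)) * s * r.imK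
          - 1 / 2 * (1 / (2 * w) * (p.re * q.imJ - p.imJ * q.re)
            - s * w * (p.imK * q.imI - p.imI * q.imK)) * (r.re / (2 * w))
          + 1 / 2 * (1 / (2 * w) * (p.re * q.imK - p.imK * q.re)
            - s * w * (p.imI * q.imJ - p.imJ * q.imI)) * s * w * r.imI))
        (4 * w * (w - 1) * (-(1 / 2 * (p.re * q.imI - p.imI * q.re) - s * (p.imJ * q.imK - p.imK * q.imJ)) * s * r.imJ
          - 1 / 2 * (1 / (2 * w) * (p.re * q.imJ - p.imJ * q.re)
            - s * w * (p.imK * q.imI - p.imI * q.imK)) * s * w * r.imI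
          - 1 / 2 * (1 / (2 * w) * (p.re * q.imK - p.imK * q.re)
            - s * w * (p.imI * q.imJ - p.imJ * q.imI)) * (r.re / (2 * w)))) := by
  simp only [invariantCurvature_apply, bilinearOf_modelConnection, bilinearOf_modelConnectionDeriv]
  ext <;> simp only [Quaternion.re_add, Quaternion.re_sub, Quaternion.re_smul, Quaternion.re_mul,
    Quaternion.imI_add, Quaternion.imI_sub, Quaternion.imI_smul, Quaternion.imI_mul,
    Quaternion.imJ_add, Quaternion.imJ_sub, Quaternion.imJ_smul, Quaternion.imJ_mul,
    Quaternion.imK_add, Quaternion.imK_sub, Quaternion.imK_smul, Quaternion.imK_mul,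
    re_quat, imI_quat, imJ_quat, imK_quat, smul_eq_mul]
  all_goals rcases hs with rfl | rfl <;> field_simp <;> ring

/-- The conditions on `F` and `C` in `HasModelForm`, for given constants. -/
def IsModelOn (s c₀ c : ℝ) (J : Set ℝ) (F C : ℝ → ℝ) : Prop :=
  ∀ z ∈ J, 0 < 1 + c * Real.exp (s * z) ∧ F z = modelF s c z ∧ C z = modelC s c₀ c z

lemma isModelOn_modelDomain (s c₀ c : ℝ) :
    IsModelOn s c₀ c (modelDomain s c) (modelF s c) (modelC s c₀ c) :=
  fun _ hz => ⟨hz, rfl, rfl⟩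

lemma hasDerivAt_exp_mul (s z : ℝ) :
    HasDerivAt (fun t => Real.exp (s * t)) (s * Real.exp (s * z)) z := by
  simpa [mul_comm] using ((hasDerivAt_id z).const_mul s).exp

lemma hasDerivAt_one_add_mul_exp (s c z : ℝ) :
    HasDerivAt (fun t => 1 + c * Real.exp (s * t)) (s * ((1 + c * Real.exp (s * z)) - 1)) z :=
  (((hasDerivAt_exp_mul s z).const_mul c).const_add 1).congr_deriv (by ring)

lemma isOpen_modelDomain (s c : ℝ) : IsOpen (modelDomain s c) :=
  isOpen_lt continuous_const (by fun_prop)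

section

variable {s c₀ c : ℝ} {J : Set ℝ} {F C : ℝ → ℝ}

lemma IsModelOn.diagEntries_eq (h : IsModelOn s c₀ c J F C) {z w : ℝ} (hz : z ∈ J)
    (hw : w = 1 + c * Real.exp (s * z)) :
    diagEntries (fun z => C z * (1 / (4 * F z))) (fun z => C z * F z) C z =
      ![c₀ * Real.exp (s * z) / (4 * w ^ 4), c₀ * Real.exp (s * z),
        c₀ * Real.exp (s * z) / w ^ 2, c₀ * Real.exp (s * z) / w ^ 2] := by
  obtain ⟨hpos, hF, hC⟩ := h z hz
  have hw0 : w ≠ 0 := hw ▸ hpos.ne'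
  have hA : C z * (1 / (4 * F z)) = c₀ * Real.exp (s * z) / (4 * w ^ 4) := by
    rw [hF, hC, modelF, modelC, ← hw]; field_simp
  have hB : C z * F z = c₀ * Real.exp (s * z) := by
    rw [hF, hC, modelF, modelC, ← hw]; field_simp
  rw [modelC, ← hw] at hC
  change ![C z * (1 / (4 * F z)), C z * F z, C z, C z] = _
  rw [hA, hB, hC]

lemma IsModelOn.isInvariantLeviCivita (hJ : IsOpen J) (hc₀ : 0 < c₀)
    (h : IsModelOn s c₀ c J F C) :
    IsInvariantLeviCivita J (fun z => C z * (1 / (4 * F z))) (fun z => C z * F z) C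
      (fun z => 2 * s * (2 / (1 + c * Real.exp (s * z)) - 3 / 2) *
        (c₀ * Real.exp (s * z) / (4 * (1 + c * Real.exp (s * z)) ^ 4)))
      (fun z => s * (c₀ * Real.exp (s * z)))
      (fun z => 2 * s * (1 / (1 + c * Real.exp (s * z)) - 1 / 2) *
        (c₀ * Real.exp (s * z) / (1 + c * Real.exp (s * z)) ^ 2))
      (fun z => modelConnection s (1 + c * Real.exp (s * z)))
      (fun z => modelConnectionDeriv s (1 + c * Real.exp (s * z))
        (s * ((1 + c * Real.exp (s * z)) - 1))) := by
  have hev : ∀ z ∈ J, ∀ i, (fun t => diagEntries (fun z => C z * (1 / (4 * F z)))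
      (fun z => C z * F z) C t i) =ᶠ[𝓝 z] fun t => ![c₀ * Real.exp (s * t) /
        (4 * (1 + c * Real.exp (s * t)) ^ 4), c₀ * Real.exp (s * t),
        c₀ * Real.exp (s * t) / (1 + c * Real.exp (s * t)) ^ 2,
        c₀ * Real.exp (s * t) / (1 + c * Real.exp (s * t)) ^ 2] i := fun z hz i => by
    filter_upwards [hJ.mem_nhds hz] with t ht
    rw [h.diagEntries_eq ht rfl]
  constructor
  · intro z hz a
    have hw := (h z hz).1
    rw [h.diagEntries_eq hz rfl]
    have hq := mul_pos hc₀ (Real.exp_pos (s * z))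
    fin_cases a
    · exact (div_pos hq (by positivity)).ne'
    · exact hq.ne'
    · exact (div_pos hq (by positivity)).ne'
    · exact (div_pos hq (by positivity)).ne'
  · intro z hz
    have hw := (h z hz).1.ne'
    have hq := (hasDerivAt_exp_mul s z).const_mul c₀
    have hwd := hasDerivAt_one_add_mul_exp s c z
    refine HasDerivAt.congr_of_eventuallyEq ?_ (hev z hz 0)
    refine (hq.div ((hwd.pow 4).const_mul 4)
      (mul_ne_zero four_ne_zero (pow_ne_zero 4 hw))).congr_deriv ?_
    simp only [Pi.pow_apply]
    generalize 1 + c * Real.exp (s * z) = w at hw ⊢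
    field_simp
    ring
  · intro z hz
    refine HasDerivAt.congr_of_eventuallyEq ?_ (hev z hz 1)
    exact ((hasDerivAt_exp_mul s z).const_mul c₀).congr_deriv (by ring)
  · intro z hz
    have hw := (h z hz).1.ne'
    have hq := (hasDerivAt_exp_mul s z).const_mul c₀
    have hwd := hasDerivAt_one_add_mul_exp s c z
    refine HasDerivAt.congr_of_eventuallyEq ?_ (hev z hz 2)
    refine (hq.div (hwd.pow 2) (pow_ne_zero 2 hw)).congr_deriv ?_
    simp only [Pi.pow_apply]
    generalize 1 + c * Real.exp (s * z) = w at hw ⊢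
    field_simp
    ring
  · intro z hz a b
    exact hasDerivAt_modelConnection (hasDerivAt_one_add_mul_exp s c z) (h z hz).1.ne' a b
  · intro z hz p q
    rw [bilinearOf_modelConnection, bilinearOf_modelConnection]
    ext <;> simp <;> ring
  · intro z hz p q r
    have hw := (h z hz).1.ne'
    rw [h.diagEntries_eq hz rfl, bilinearOf_modelConnection, bilinearOf_modelConnection]
    simp only [Fin.sum_univ_four, diagEntries, Matrix.cons_val, coord_zero, coord_one, coord_two,
      coord_three, re_quat, imI_quat, imJ_quat, imK_quat]
    field_simp
    ring

lemma IsModelOn.ricciFlatOn (hs : s = 1 ∨ s = -1) (hJ : IsOpen J) (hc₀ : 0 < c₀)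
    (h : IsModelOn s c₀ c J F C) : RicciFlatOn (shell J) (zMetric F C) := by
  intro x hx k j
  have hw := (h _ hx.2).1.ne'
  rw [zMetric, ricci_uMetric hJ (h.isInvariantLeviCivita hJ hc₀) hx, Fin.sum_univ_four]
  simp only [invariantCurvature_modelConnection hs hw, coord_zero, coord_one, coord_two,
    coord_three, re_quat, imI_quat, imJ_quat, imK_quat, re_stdBasis, imI_stdBasis, imJ_stdBasis,
    imK_stdBasis, Fin.isValue, Fin.reduceEq, if_true, if_false]
  generalize 1 + c * Real.exp (s * height x) = w at hw ⊢
  rcases hs with rfl | rfl <;> field_simp <;> ring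

set_option maxHeartbeats 1600000 in
lemma IsModelOn.riemannNormSq_eq (hs : s = 1 ∨ s = -1) (hJ : IsOpen J) (hc₀ : 0 < c₀)
    (h : IsModelOn s c₀ c J F C) {x : Quat} (hx : x ∈ shell J) :
    riemannNormSq (zMetric F C) x
      = 384 * c ^ 2 * (1 + c * Real.exp (s * height x)) ^ 6 / c₀ ^ 2 := by
  have hw := (h _ hx.2).1.ne'
  rw [zMetric, riemannNormSq_uMetric hJ (h.isInvariantLeviCivita hJ hc₀) hx,
    h.diagEntries_eq hx.2 rfl]
  have hc : c ^ 2 = ((1 + c * Real.exp (s * height x)) - 1) ^ 2 / Real.exp (s * height x) ^ 2 := by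
    field_simp; ring
  have hq := (Real.exp_pos (s * height x)).ne'
  rw [hc]
  generalize 1 + c * Real.exp (s * height x) = w at hw ⊢
  generalize Real.exp (s * height x) = q at hq ⊢
  simp only [invariantCurvature_modelConnection hs hw, Fin.sum_univ_four]
  simp only [coord_zero, coord_one, coord_two,
    coord_three, re_quat, imI_quat, imJ_quat, imK_quat, re_stdBasis, imI_stdBasis, imJ_stdBasis,
    imK_stdBasis, Fin.isValue, Fin.reduceEq, if_true, if_false, Matrix.cons_val,
    mul_zero, zero_mul, mul_one, add_zero, zero_add, sub_zero, zero_sub, zero_div, neg_zero]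
  rcases hs with rfl | rfl <;> field_simp <;> ring

lemma IsModelOn.flatOn (hs : s = 1 ∨ s = -1) (hJ : IsOpen J) (hc₀ : 0 < c₀)
    (h : IsModelOn s c₀ 0 J F C) : FlatOn (shell J) (zMetric F C) := by
  intro x hx l k i j
  have hw := (h _ hx.2).1.ne'
  rw [zMetric, riemann_uMetric hJ (h.isInvariantLeviCivita hJ hc₀) hx,
    invariantCurvature_modelConnection hs hw]
  have h0 : quat 0 0 0 0 = 0 := rfl
  simp [h0]

lemma IsModelOn.exists_riemann_ne_zero (hs : s = 1 ∨ s = -1) (hJ : IsOpen J) (hc₀ : 0 < c₀)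
    (hc : c ≠ 0) (h : IsModelOn s c₀ c J F C) {x : Quat} (hx : x ∈ shell J) :
    ∃ l k i j, riemann (zMetric F C) l k i j x ≠ 0 := by
  by_contra! hzero
  have h1 := h.riemannNormSq_eq hs hJ hc₀ hx
  have h2 : riemannNormSq (zMetric F C) x = 0 := by simp [riemannNormSq, hzero]
  have hw := (h _ hx.2).1
  have h3 : 0 < 384 * c ^ 2 * (1 + c * Real.exp (s * height x)) ^ 6 / c₀ ^ 2 := by positivity
  rw [← h1, h2] at h3
  exact lt_irrefl _ h3

end

/-! ### Closed two-forms -/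

section

variable {E : Type*} [NormedAddCommGroup E] [NormedSpace ℝ E]

/-- The constant two-form `f ∧ g`. -/
noncomputable def wedge (f g : E →L[ℝ] ℝ) : E [⋀^Fin 2]→L[ℝ] ℝ :=
  ContinuousAlternatingMap.alternatizeUncurryFin
    (f.smulRight (ContinuousAlternatingMap.ofSubsingleton ℝ E ℝ (0 : Fin 1) g))

lemma wedge_apply (f g : E →L[ℝ] ℝ) (v w : E) : wedge f g ![v, w] = f v * g w - f w * g v := by
  simp [wedge, ContinuousAlternatingMap.alternatizeUncurryFin_apply, Fin.sum_univ_two,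
    Fin.removeNth]
  ring

/-- A differentiable family of alternating bilinear forms is a differentiable two-form. -/
lemma exists_differentiableOn_alternating {ι : Type*} [Fintype ι] {U : Set E} (b : ι → E)
    (c : ι → E →L[ℝ] ℝ) (B : E → E → E → ℝ)
    (hB : ∀ x v w, B x v w = ∑ i, ∑ j, c i v * c j w * B x (b i) (b j))
    (halt : ∀ x ∈ U, ∀ v w, B x v w = -B x w v)
    (hd : ∀ v w, ∀ x ∈ U, DifferentiableAt ℝ (fun y => B y v w) x) :
    ∃ β : E → E [⋀^Fin 2]→L[ℝ] ℝ, DifferentiableOn ℝ β U ∧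
      ∀ x ∈ U, ∀ v w, β x ![v, w] = B x v w := by
  refine ⟨fun x => ∑ i, ∑ j, (1 / 2 * B x (b i) (b j)) • wedge (c i) (c j), fun x hx => ?_,
    fun x hx v w => ?_⟩
  · exact (DifferentiableAt.fun_sum fun i _ => DifferentiableAt.fun_sum fun j _ =>
      ((hd (b i) (b j) x hx).const_mul (1 / 2)).smul_const (wedge (c i) (c j))
        ).differentiableWithinAt
  · have h2 : B x v w = 1 / 2 * (B x v w - B x w v) := by rw [halt x hx w v]; ring
    rw [h2, hB x v w, hB x w v, ← Finset.sum_sub_distrib, Finset.mul_sum]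
    simp only [ContinuousAlternatingMap.sum_apply, ContinuousAlternatingMap.smul_apply,
      smul_eq_mul, wedge_apply]
    refine Finset.sum_congr rfl fun i _ => ?_
    rw [← Finset.sum_sub_distrib, Finset.mul_sum]
    exact Finset.sum_congr rfl fun j _ => by ring

end

/-- Closedness of a two-form in terms of directional derivatives: `L x v w u` is the derivative
of `B(v, w)` along `u`. -/
lemma isClosedTwoFormOn_iff {U : Set Quat} (hU : IsOpen U) {B : BilinField}
    {L : Quat → Quat → Quat → (Quat →L[ℝ] ℝ)}
    (hL : ∀ x ∈ U, ∀ v w, HasFDerivAt (fun y => B y v w) (L x v w) x)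
    (halt : ∀ x ∈ U, ∀ v w, B x v w = -B x w v) :
    IsClosedTwoFormOn U B ↔ ∀ x ∈ U, ∀ u v w, L x v w u - L x u w v + L x u v w = 0 := by
  have key : ∀ β : Quat → Quat [⋀^Fin 2]→L[ℝ] ℝ, DifferentiableOn ℝ β U →
      (∀ x ∈ U, ∀ v w, β x ![v, w] = B x v w) → ∀ x ∈ U, ∀ u v w,
      extDeriv β x ![u, v, w] = L x v w u - L x u w v + L x u v w := by
    intro β hβ hβB x hx u v w
    have hf : ∀ v w, fderiv ℝ (fun y => β y ![v, w]) x = L x v w := fun v w =>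
      HasFDerivAt.fderiv ((hL x hx v w).congr_of_eventuallyEq (by
        filter_upwards [hU.mem_nhds hx] with y hy using hβB y hy v w))
    have e0 : (0 : Fin 3).removeNth ![u, v, w] = ![v, w] := by
      funext i; fin_cases i <;> rfl
    have e1 : (1 : Fin 3).removeNth ![u, v, w] = ![u, w] := by
      funext i; fin_cases i <;> rfl
    have e2 : (2 : Fin 3).removeNth ![u, v, w] = ![u, v] := by
      funext i; fin_cases i <;> rfl
    rw [extDeriv_apply (hβ.differentiableAt (hU.mem_nhds hx)), Fin.sum_univ_three, e0, e1, e2,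
      hf, hf, hf]
    simp
    ring
  constructor
  · rintro ⟨β, hβ, hβB, hclosed⟩ x hx u v w
    rw [← key β hβ hβB x hx u v w, hclosed x hx]
    rfl
  · intro h
    have hB : ∀ x v w, B x v w = ∑ i, ∑ j, coordCLM i v * coordCLM j w *
        B x (stdBasis i) (stdBasis j) := by
      intro x v w
      conv_lhs => rw [← sum_coord v, ← sum_coord w]
      simp only [map_sum, map_smul, LinearMap.sum_apply, LinearMap.smul_apply, smul_eq_mul,
        Finset.mul_sum, coordCLM_apply]
      rw [Finset.sum_comm]
      exact Finset.sum_congr rfl fun i _ => Finset.sum_congr rfl fun j _ => by ring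
    obtain ⟨β, hβ, hβB⟩ := exists_differentiableOn_alternating (U := U) stdBasis coordCLM
      (fun x v w => B x v w) hB halt fun v w x hx => (hL x hx v w).differentiableAt
    refine ⟨β, hβ, hβB, fun x hx => ?_⟩
    ext m
    have hm : m = ![m 0, m 1, m 2] := by
      funext i; fin_cases i <;> rfl
    rw [hm, key β hβ hβB x hx, h x hx]
    rfl

/-! ### The almost complex structure in the left-invariant frame -/

/-- The Hopf map `x ↦ x⁻¹ i x`, with values in the imaginary unit quaternions. -/
noncomputable def hopf (x : Quat) : Quat := x⁻¹ * stdBasis 1 * x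

lemma hopf_eq (x : Quat) : hopf x = (‖x‖ ^ 2)⁻¹ • quat 0
    (x.re ^ 2 + x.imI ^ 2 - x.imJ ^ 2 - x.imK ^ 2) (2 * (x.imI * x.imJ - x.re * x.imK))
    (2 * (x.imI * x.imK + x.re * x.imJ)) := by
  rw [hopf, inv_eq, Algebra.smul_mul_assoc, Algebra.smul_mul_assoc]
  congr 1
  ext <;> simp <;> ring

lemma hopf_re (x : Quat) : (hopf x).re = 0 := by
  rw [hopf_eq]; simp

lemma hopf_normSq {x : Quat} (hx : x ≠ 0) :
    (hopf x).imI ^ 2 + (hopf x).imJ ^ 2 + (hopf x).imK ^ 2 = 1 := by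
  have hn : ‖x‖ ^ 2 ≠ 0 := pow_ne_zero 2 (norm_ne_zero_iff.2 hx)
  rw [hopf_eq]
  simp only [Quaternion.imI_smul, Quaternion.imJ_smul, Quaternion.imK_smul, imI_quat, imJ_quat,
    imK_quat, smul_eq_mul]
  rw [norm_sq_eq] at hn ⊢
  field_simp
  ring

lemma hasFDerivAt_hopf {x : Quat} (hx : x ≠ 0) :
    ∃ L : Quat →L[ℝ] Quat, HasFDerivAt hopf L x ∧
      ∀ u, L u = hopf x * (x⁻¹ * u) - x⁻¹ * u * hopf x := by
  refine ⟨_, (hasFDerivAt_inv_mul hx (stdBasis 1)).mul' (hasFDerivAt_id x), fun u => ?_⟩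
  simp [hopf, mul_assoc, mul_inv_cancel_left₀ hx, sub_eq_add_neg]

/-- Left multiplication by the imaginary quaternion `n` if `s = 1`, and right multiplication by `-n`
if `s = -1`. -/
def mulMatrix (s : ℝ) (n : Quat) : Matrix (Fin 4) (Fin 4) ℝ :=
  !![0, -s * n.imI, -s * n.imJ, -s * n.imK;
     s * n.imI, 0, -n.imK, n.imJ;
     s * n.imJ, n.imK, 0, -n.imI;
     s * n.imK, -n.imJ, n.imI, 0]

lemma tMatrix_eq (x : Quat) : tMatrix x = (‖x‖ ^ 2)⁻¹ •
    !![‖x‖ ^ 2, 0, 0, 0;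
      0, -(x.re ^ 2 + x.imI ^ 2 - x.imJ ^ 2 - x.imK ^ 2), -(2 * (x.imI * x.imJ - x.re * x.imK)),
        -(2 * (x.imI * x.imK + x.re * x.imJ));
      0, -(2 * (x.imI * x.imJ + x.re * x.imK)), -(x.re ^ 2 - x.imI ^ 2 + x.imJ ^ 2 - x.imK ^ 2),
        -(2 * (x.imJ * x.imK - x.re * x.imI));
      0, -(2 * (x.imI * x.imK - x.re * x.imJ)), -(2 * (x.imJ * x.imK + x.re * x.imI)),
        -(x.re ^ 2 - x.imI ^ 2 - x.imJ ^ 2 + x.imK ^ 2)] := by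
  have hT : ∀ i j, tMatrix x i j
      = (‖x‖ ^ 2)⁻¹ * stdBasis.coord i (x * (star (stdBasis j) * star x)) := by
    intro i j
    simp only [tMatrix, Matrix.of_apply, eta, frame, LinearMap.comp_apply, LinearMap.mulLeft_apply,
      inv_eq, norm_star, star_star, star_mul, Algebra.smul_mul_assoc, map_smul, smul_eq_mul]
  ext i j
  rw [hT, Matrix.smul_apply, smul_eq_mul]
  congr 1
  fin_cases i <;> fin_cases j <;>
    simp only [Fin.zero_eta, Fin.mk_one, Fin.reduceFinMk, coord_zero, coord_one, coord_two,
      coord_three, norm_sq_eq, Matrix.of_apply, Matrix.cons_val] <;> simp <;> ring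

/-- Conjugation by `T` turns `J^{-s}`, which is left or right multiplication by `i` up to sign, into
multiplication on the other side by the Hopf image of the point. -/
lemma iMatrix_eq {s : ℝ} (hs : s = 1 ∨ s = -1) {x : Quat} (hx : x ≠ 0) :
    iMatrix s x = mulMatrix s (hopf x) := by
  have hn : ‖x‖ ^ 2 ≠ 0 := pow_ne_zero 2 (norm_ne_zero_iff.2 hx)
  rw [iMatrix, tMatrix_eq x, hopf_eq, mulMatrix]
  rw [norm_sq_eq] at hn ⊢
  ext i j
  simp only [Matrix.mul_apply, Fin.sum_univ_four, Matrix.transpose_apply, Matrix.smul_apply,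
    Quaternion.imI_smul, Quaternion.imJ_smul, Quaternion.imK_smul, imI_quat, imJ_quat,
    imK_quat, smul_eq_mul, jMatrix]
  fin_cases i <;> fin_cases j <;>
    simp only [Fin.zero_eta, Fin.mk_one, Fin.reduceFinMk, Matrix.of_apply, Matrix.cons_val] <;>
    rcases hs with rfl | rfl <;> field_simp <;> ring

/-- The form `n₁ (a η⁰∧η¹ + e η²∧η³) + n₂ (b η⁰∧η² + h η³∧η¹) + n₃ (b η⁰∧η³ + h η¹∧η²)`. -/
def omegaForm (a b e h : ℝ) (n p q : Quat) : ℝ :=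
  n.imI * (a * (p.re * q.imI - p.imI * q.re) + e * (p.imJ * q.imK - p.imK * q.imJ))
    + n.imJ * (b * (p.re * q.imJ - p.imJ * q.re) + h * (p.imK * q.imI - p.imI * q.imK))
    + n.imK * (b * (p.re * q.imK - p.imK * q.re) + h * (p.imI * q.imJ - p.imJ * q.imI))

lemma hasFDerivAt_omegaForm {a b e h : ℝ → ℝ} {a' b' e' h' : ℝ} {x : Quat} (hx : x ≠ 0)
    (ha : HasDerivAt a a' (height x)) (hb : HasDerivAt b b' (height x))
    (he : HasDerivAt e e' (height x)) (hh : HasDerivAt h h' (height x)) (v w : Quat) :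
    ∃ L : Quat →L[ℝ] ℝ, HasFDerivAt (fun y => omegaForm (a (height y)) (b (height y))
      (e (height y)) (h (height y)) (hopf y) (y⁻¹ * v) (y⁻¹ * w)) L x ∧
      ∀ u, L u = (x⁻¹ * u).re * omegaForm a' b' e' h' (hopf x) (x⁻¹ * v) (x⁻¹ * w)
        + omegaForm (a (height x)) (b (height x)) (e (height x)) (h (height x))
          (hopf x * (x⁻¹ * u) - x⁻¹ * u * hopf x) (x⁻¹ * v) (x⁻¹ * w)
        - omegaForm (a (height x)) (b (height x)) (e (height x)) (h (height x)) (hopf x)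
          (x⁻¹ * u * (x⁻¹ * v)) (x⁻¹ * w)
        - omegaForm (a (height x)) (b (height x)) (e (height x)) (h (height x)) (hopf x)
          (x⁻¹ * v) (x⁻¹ * u * (x⁻¹ * w)) := by
  obtain ⟨Ln, hLn, hLu⟩ := hasFDerivAt_hopf hx
  have N : ∀ i, HasFDerivAt (fun y => coordCLM i (hopf y)) (coordCLM i ∘L Ln) x := fun i =>
    (coordCLM i).hasFDerivAt.comp x hLn
  have P : ∀ i, HasFDerivAt (fun y : Quat => coordCLM i (y⁻¹ * v))
      (coordCLM i ∘L maurerCartanDeriv x v) x := fun i =>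
    (coordCLM i).hasFDerivAt.comp x (hasFDerivAt_inv_mul hx v)
  have Q : ∀ i, HasFDerivAt (fun y : Quat => coordCLM i (y⁻¹ * w))
      (coordCLM i ∘L maurerCartanDeriv x w) x := fun i =>
    (coordCLM i).hasFDerivAt.comp x (hasFDerivAt_inv_mul hx w)
  have W : ∀ i j, HasFDerivAt _ _ x := fun i j =>
    ((P i).fun_mul (Q j)).fun_sub ((P j).fun_mul (Q i))
  have H : ∀ {c : ℝ → ℝ} {c' : ℝ}, HasDerivAt c c' (height x) →
      HasFDerivAt (fun y => c (height y)) (c' • heightDeriv x) x := fun hc =>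
    hc.comp_hasFDerivAt x (hasFDerivAt_height hx)
  refine ⟨_, (((N 1).fun_mul (((H ha).fun_mul (W 0 1)).fun_add ((H he).fun_mul (W 2 3)))).fun_add
    ((N 2).fun_mul (((H hb).fun_mul (W 0 2)).fun_add ((H hh).fun_mul (W 3 1))))).fun_add
    ((N 3).fun_mul (((H hb).fun_mul (W 0 3)).fun_add ((H hh).fun_mul (W 1 2)))), fun u => ?_⟩
  simp only [add_apply, sub_apply, smul_apply, ContinuousLinearMap.comp_apply, hLu,
    maurerCartanDeriv_apply, heightDeriv_apply, smul_eq_mul, coordCLM_zero, coordCLM_one,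
    coordCLM_two, coordCLM_three]
  generalize x⁻¹ * u = p
  generalize x⁻¹ * v = q
  generalize x⁻¹ * w = r
  simp only [omegaForm, Quaternion.re_neg, Quaternion.imI_neg, Quaternion.imJ_neg,
    Quaternion.imK_neg, Quaternion.imI_sub, Quaternion.imJ_sub, Quaternion.imK_sub]
  ring

/-- The exterior derivative of `omegaForm` in the left-invariant coframe. -/
lemma extDeriv_omegaForm (a b e h a' b' e' h' : ℝ) {n : Quat} (u v w : Quat) :
    (u.re * omegaForm a' b' e' h' n v w + omegaForm a b e h (n * u - u * n) v w
        - omegaForm a b e h n (u * v) w - omegaForm a b e h n v (u * w))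
      - (v.re * omegaForm a' b' e' h' n u w + omegaForm a b e h (n * v - v * n) u w
        - omegaForm a b e h n (v * u) w - omegaForm a b e h n u (v * w))
      + (w.re * omegaForm a' b' e' h' n u v + omegaForm a b e h (n * w - w * n) u v
        - omegaForm a b e h n (w * u) v - omegaForm a b e h n u (w * v))
      = (e' + 2 * a - 4 * b) * n.imI *
          (u.re * (v.imJ * w.imK - v.imK * w.imJ) - v.re * (u.imJ * w.imK - u.imK * w.imJ)
            + w.re * (u.imJ * v.imK - u.imK * v.imJ))
        + (h' - 2 * a) * (n.imJ *
          (u.re * (v.imK * w.imI - v.imI * w.imK) - v.re * (u.imK * w.imI - u.imI * w.imK)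
            + w.re * (u.imK * v.imI - u.imI * v.imK))
          + n.imK *
          (u.re * (v.imI * w.imJ - v.imJ * w.imI) - v.re * (u.imI * w.imJ - u.imJ * w.imI)
            + w.re * (u.imI * v.imJ - u.imJ * v.imI))) := by
  simp only [omegaForm, Quaternion.re_mul, Quaternion.imI_mul, Quaternion.imJ_mul,
    Quaternion.imK_mul, Quaternion.imI_sub, Quaternion.imJ_sub, Quaternion.imK_sub]
  ring

/-- `I^s` in the left-invariant frame, for `n = hopf x`: the entries depend on `f = √F` through the
functions `α = 2f²`, `β = 2f`, `γ = 1/(2f²)`, `δ = 1/f`, `ε = 1/(2f)`, `φ = f` and `κ = 1`. -/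
def structureMap (s α β γ δ ε φ κ : ℝ) (n p : Quat) : Quat :=
  quat (-(s * (α * (n.imI * p.imI) + β * (n.imJ * p.imJ + n.imK * p.imK))))
    (s * (γ * (n.imI * p.re)) + δ * (n.imJ * p.imK - n.imK * p.imJ))
    (s * (ε * (n.imJ * p.re)) + φ * (n.imK * p.imI) - κ * (n.imI * p.imK))
    (s * (ε * (n.imK * p.re)) + κ * (n.imI * p.imJ) - φ * (n.imJ * p.imI))

/-- `structureMap` with the coefficients given by `f`. -/
noncomputable def leftStructure (s f : ℝ) (n p : Quat) : Quat :=
  structureMap s (2 * f ^ 2) (2 * f) (1 / (2 * f ^ 2)) (1 / f) (1 / (2 * f)) f 1 n p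

/-- In the left-invariant frame the matrix entries of `I^s` do not involve `C`, as its conformal factor
cancels between `f_a` and `σ^b`. -/
lemma iStructure_apply {s : ℝ} (hs : s = 1 ∨ s = -1) {F C : ℝ → ℝ} {x : Quat} (hx : x ≠ 0)
    (hF : 0 < F (height x)) (hC : 0 < C (height x)) (v : Quat) :
    iStructure s F C x v = x * leftStructure s (√(F (height x))) (hopf x) (x⁻¹ * v) := by
  have h0 : √(C (height x) / (4 * F (height x))) = √(C (height x)) / (2 * √(F (height x))) := by
    rw [Real.sqrt_div hC.le, Real.sqrt_mul (by norm_num)]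
    norm_num [show (4 : ℝ) = 2 ^ 2 by norm_num]
  have h1 : √(C (height x) * F (height x)) = √(C (height x)) * √(F (height x)) :=
    Real.sqrt_mul hC.le _
  have hf := (Real.sqrt_pos.2 hF).ne'
  have hc := (Real.sqrt_pos.2 hC).ne'
  conv_rhs => rw [← sum_coord (leftStructure s (√(F (height x))) (hopf x) (x⁻¹ * v))]
  simp only [iStructure, iMatrix_eq hs hx, LinearMap.sum_apply, LinearMap.smul_apply,
    LinearMap.smulRight_apply, sigma, unitFrame, frame, smul_smul, Finset.mul_sum, mul_smul_comm,
    ← Finset.sum_smul, eta, LinearMap.comp_apply, LinearMap.mulLeft_apply, smul_eq_mul]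
  refine Finset.sum_congr rfl fun a _ => ?_
  congr 1
  generalize √(F (height x)) = f at *
  generalize hcd : √(C (height x)) = c at *
  rw [Fin.sum_univ_four]
  fin_cases a <;>
    simp only [scale, h0, h1, hcd, Fin.zero_eta, Fin.mk_one, Fin.reduceFinMk, coord_zero, coord_one,
      coord_two, coord_three, mulMatrix, Matrix.of_apply, Matrix.cons_val, leftStructure,
      structureMap, re_quat, imI_quat, imJ_quat, imK_quat] <;>
    field_simp <;> ring

/-- The fundamental form is invariant up to the rotation of the Hopf image: with `f = √F` it is
`s C (n₁ η⁰∧η¹ / 2 + (n₂ η⁰∧η² + n₃ η⁰∧η³) / (2f)) + C (n₁ η²∧η³ + f (n₂ η³∧η¹ + n₃ η¹∧η²))`. -/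
lemma fundamentalForm_apply {s : ℝ} (hs : s = 1 ∨ s = -1) {F C : ℝ → ℝ} {x : Quat} (hx : x ≠ 0)
    (hF : 0 < F (height x)) (hC : 0 < C (height x)) (v w : Quat) :
    fundamentalForm (zMetric F C) (iStructure s F C) x v w
      = omegaForm (s * C (height x) / 2) (s * C (height x) / (2 * √(F (height x))))
          (C (height x)) (C (height x) * √(F (height x))) (hopf x) (x⁻¹ * v) (x⁻¹ * w) := by
  have hf := (Real.sqrt_pos.2 hF).ne'
  have hF2 : F (height x) = √(F (height x)) ^ 2 := (Real.sq_sqrt hF.le).symm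
  simp only [fundamentalForm, LinearMap.BilinForm.comp_apply, LinearMap.id_apply,
    zMetric, uMetric_apply, iStructure_apply hs hx hF hC, inv_mul_cancel_left₀ hx]
  rw [hF2, Real.sqrt_sq (Real.sqrt_nonneg _)]
  generalize √(F (height x)) = f at *
  simp only [leftStructure, structureMap, re_quat, imI_quat, imJ_quat, imK_quat, omegaForm]
  field_simp
  ring

/-! ### The Kähler condition as a pair of differential equations -/

/-- The height and the Hopf image of a point can be prescribed independently. -/
lemma exists_height_hopf (z : ℝ) {y : Quat} (hy : y ≠ 0) :
    ∃ x : Quat, x ≠ 0 ∧ height x = z ∧ hopf x = hopf y := by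
  have hn := norm_pos_iff.2 hy
  have ht : 0 < Real.exp z / ‖y‖ := div_pos (Real.exp_pos z) hn
  refine ⟨(Real.exp z / ‖y‖) • y, smul_ne_zero ht.ne' hy, ?_, ?_⟩
  · rw [height, norm_smul, Real.norm_of_nonneg ht.le, div_mul_cancel₀ _ hn.ne', Real.log_exp]
  · have h1 := smul_inv_smul₀ ht.ne' (y⁻¹ * stdBasis 1 * y)
    rw [hopf, hopf]
    rw [show ((Real.exp z / ‖y‖) • y)⁻¹ = (Real.exp z / ‖y‖)⁻¹ • y⁻¹ from smul_inv₀ _ _]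
    simp only [Algebra.smul_mul_assoc, mul_smul_comm, smul_smul]
    rw [mul_inv_cancel₀ ht.ne', one_smul]

/-- Closedness of the fundamental form, as differential equations for `f = √F` and `C`. -/
lemma isClosedTwoFormOn_fundamentalForm_iff {s : ℝ} (hs : s = 1 ∨ s = -1) {J : Set ℝ}
    {F C : ℝ → ℝ} (hJ : IsOpen J) (hF : ∀ z ∈ J, 0 < F z) (hC : ∀ z ∈ J, 0 < C z)
    {f' C' : ℝ → ℝ} (hf' : ∀ z ∈ J, HasDerivAt (fun t => √(F t)) (f' z) z)
    (hC' : ∀ z ∈ J, HasDerivAt C (C' z) z) :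
    IsClosedTwoFormOn (shell J) (fundamentalForm (zMetric F C) (iStructure s F C)) ↔
      ∀ z ∈ J, C' z = s * C z * (2 / √(F z) - 1) ∧
        C' z * √(F z) + C z * f' z = s * C z := by
  have hf0 : ∀ z ∈ J, √(F z) ≠ 0 := fun z hz => (Real.sqrt_pos.2 (hF z hz)).ne'
  have ha : ∀ z ∈ J, HasDerivAt (fun t => s * C t / 2) (s * C' z / 2) z := fun z hz =>
    ((hC' z hz).const_mul s).div_const 2
  have hb : ∀ z ∈ J, HasDerivAt (fun t => s * C t / (2 * √(F t)))
      ((s * C' z * (2 * √(F z)) - s * C z * (2 * f' z)) / (2 * √(F z)) ^ 2) z := fun z hz =>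
    ((hC' z hz).const_mul s).fun_div ((hf' z hz).const_mul 2) (mul_ne_zero two_ne_zero (hf0 z hz))
  have hh : ∀ z ∈ J, HasDerivAt (fun t => C t * √(F t)) (C' z * √(F z) + C z * f' z) z :=
    fun z hz => (hC' z hz).fun_mul (hf' z hz)
  have key : ∀ x ∈ shell J, ∀ v w, ∃ L : Quat →L[ℝ] ℝ, HasFDerivAt
      (fun y => fundamentalForm (zMetric F C) (iStructure s F C) y v w) L x ∧
      ∀ u, L u = _ := fun x hx v w => by
    obtain ⟨L, hL, hLu⟩ := hasFDerivAt_omegaForm hx.1 (ha _ hx.2) (hb _ hx.2) (hC' _ hx.2)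
      (hh _ hx.2) v w
    refine ⟨L, hL.congr_of_eventuallyEq ?_, hLu⟩
    filter_upwards [(isOpen_shell hJ).mem_nhds hx] with y hy
    exact fundamentalForm_apply hs hy.1 (hF _ hy.2) (hC _ hy.2) v w
  choose! L hL hLu using key
  rw [isClosedTwoFormOn_iff (isOpen_shell hJ) hL]
  · constructor
    · intro h z hz
      have hf := hf0 z hz
      constructor
      -- the components of `dω` at a point with Hopf image `i`, along `e₀, e₂, e₃`
      · obtain ⟨x, hx0, hxz, hxn⟩ := exists_height_hopf z (one_ne_zero (α := Quat))
        have hxJ : x ∈ shell J := ⟨hx0, hxz.symm ▸ hz⟩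
        have h1 := h x hxJ (x * stdBasis 0) (x * stdBasis 2) (x * stdBasis 3)
        rw [hLu x hxJ, hLu x hxJ, hLu x hxJ] at h1
        simp only [inv_mul_cancel_left₀ hx0] at h1
        rw [extDeriv_omegaForm, hxn, hxz, hopf_eq] at h1
        simp at h1
        field_simp at h1 ⊢
        linarith
      -- the Hopf image of `i + j` is `j`; the vectors are `e₀, e₃, e₁`
      · have hy : quat 0 1 1 0 ≠ 0 := fun h => by simpa using congrArg QuaternionAlgebra.imI h
        obtain ⟨x, hx0, hxz, hxn⟩ := exists_height_hopf z hy
        have hxJ : x ∈ shell J := ⟨hx0, hxz.symm ▸ hz⟩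
        have h1 := h x hxJ (x * stdBasis 0) (x * stdBasis 3) (x * stdBasis 1)
        rw [hLu x hxJ, hLu x hxJ, hLu x hxJ] at h1
        simp only [inv_mul_cancel_left₀ hx0] at h1
        rw [extDeriv_omegaForm, hxn, hxz, hopf_eq, norm_sq_eq] at h1
        simp at h1
        linarith
    · intro h x hx u v w
      obtain ⟨h1, h2⟩ := h _ hx.2
      have hf := hf0 _ hx.2
      rw [hLu x hx, hLu x hx, hLu x hx, extDeriv_omegaForm, h2]
      have h3 : C' (height x) + 2 * (s * C (height x) / 2)
          - 4 * (s * C (height x) / (2 * √(F (height x)))) = 0 := by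
        rw [h1]; field_simp; ring
      rw [h3]
      ring
  · intro x hx v w
    rw [fundamentalForm_apply hs hx.1 (hF _ hx.2) (hC _ hx.2),
      fundamentalForm_apply hs hx.1 (hF _ hx.2) (hC _ hx.2)]
    simp only [omegaForm]
    ring

/-- The differential equations of `isClosedTwoFormOn_fundamentalForm_iff` integrate to the model
form: `(f - 1) e^{-sz}` and `C f² e^{-sz}` are constant. -/
lemma hasModelForm_of_ode {s : ℝ} {J : Set ℝ} {F C : ℝ → ℝ}
    (hJ : IsOpen J) (hconn : IsPreconnected J) (hne : J.Nonempty) (hF : ∀ z ∈ J, 0 < F z)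
    (hC : ∀ z ∈ J, 0 < C z)
    {f' C' : ℝ → ℝ} (hf' : ∀ z ∈ J, HasDerivAt (fun t => √(F t)) (f' z) z)
    (hC' : ∀ z ∈ J, HasDerivAt C (C' z) z)
    (h : ∀ z ∈ J, C' z = s * C z * (2 / √(F z) - 1) ∧
        C' z * √(F z) + C z * f' z = s * C z) : HasModelForm s J F C := by
  have hf0 : ∀ z ∈ J, 0 < √(F z) := fun z hz => Real.sqrt_pos.2 (hF z hz)
  have hfd : ∀ z ∈ J, f' z = s * (√(F z) - 1) := by
    intro z hz
    obtain ⟨h1, h2⟩ := h z hz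
    have hf := (hf0 z hz).ne'
    rw [h1] at h2
    have : C z * (f' z - s * (√(F z) - 1)) = 0 := by
      field_simp at h2
      linarith
    have := (mul_eq_zero.1 this).resolve_left (hC z hz).ne'
    linarith
  have he := hasDerivAt_exp_mul (-s)
  obtain ⟨c₁, h1⟩ := hJ.exists_is_const_of_deriv_eq_zero hconn
    (f := fun z => (√(F z) - 1) * Real.exp (-s * z))
    (fun z hz => (((hf' z hz).sub_const 1).fun_mul (he z)).differentiableAt.differentiableWithinAt)
    (fun z hz => by
      rw [(((hf' z hz).sub_const 1).fun_mul (he z)).deriv, hfd z hz]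
      simp only [Pi.zero_apply]
      ring)
  obtain ⟨c₀, h0⟩ := hJ.exists_is_const_of_deriv_eq_zero hconn
    (f := fun z => C z * √(F z) ^ 2 * Real.exp (-s * z))
    (fun z hz => (((hC' z hz).fun_mul ((hf' z hz).fun_pow 2)).fun_mul
      (he z)).differentiableAt.differentiableWithinAt)
    (fun z hz => by
      have hf := (hf0 z hz).ne'
      rw [(((hC' z hz).fun_mul ((hf' z hz).fun_pow 2)).fun_mul (he z)).deriv, hfd z hz,
        (h z hz).1]
      simp only [Pi.zero_apply]
      field_simp
      ring)
  have hexp : ∀ z, Real.exp (-s * z) * Real.exp (s * z) = 1 := fun z => by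
    rw [← Real.exp_add]; simp
  have hw : ∀ z ∈ J, √(F z) = 1 + c₁ * Real.exp (s * z) := fun z hz => by
    rw [← h1 z hz, mul_assoc, hexp]; ring
  refine ⟨c₀, c₁, ?_, fun z hz => ⟨?_, ?_, ?_⟩⟩
  · obtain ⟨z, hz⟩ := hne
    rw [← h0 z hz]
    have := hf0 z hz
    have := hC z hz
    positivity
  · rw [← hw z hz]; exact hf0 z hz
  · rw [modelF, ← hw z hz, Real.sq_sqrt (hF z hz).le]
  · have hf := (hf0 z hz).ne'
    rw [modelC, ← hw z hz, ← h0 z hz, mul_assoc, hexp]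
    field_simp

/-! ### Integrability -/

lemma quat_eq_sum (a b c d : ℝ) : quat a b c d =
    a • stdBasis 0 + b • stdBasis 1 + c • stdBasis 2 + d • stdBasis 3 := by
  ext <;> simp

/-- The derivative along `u = x p` has one term for each dependence on the base point: the factor `x`,
the height (with derivative `p.re`), the Hopf image (with derivative `[n, p]`) and `x⁻¹ v`. -/
lemma hasFDerivAt_leftStructure {s : ℝ} {f : ℝ → ℝ} {f' : ℝ} {x : Quat} (hx : x ≠ 0)
    (hf : HasDerivAt f f' (height x)) (hf0 : f (height x) ≠ 0) (v : Quat) :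
    ∃ L : Quat →L[ℝ] Quat, HasFDerivAt
      (fun y => y * leftStructure s (f (height y)) (hopf y) (y⁻¹ * v)) L x ∧
      ∀ u, L u = x * (x⁻¹ * u * leftStructure s (f (height x)) (hopf x) (x⁻¹ * v)
        + (x⁻¹ * u).re • structureMap s (4 * f (height x) * f') (2 * f')
          (-f' / f (height x) ^ 3) (-f' / f (height x) ^ 2) (-f' / (2 * f (height x) ^ 2)) f' 0
          (hopf x) (x⁻¹ * v)
        + leftStructure s (f (height x)) (hopf x * (x⁻¹ * u) - x⁻¹ * u * hopf x) (x⁻¹ * v)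
        - leftStructure s (f (height x)) (hopf x) (x⁻¹ * u * (x⁻¹ * v))) := by
  obtain ⟨Ln, hLn, hLu⟩ := hasFDerivAt_hopf hx
  have N : ∀ i, HasFDerivAt (fun y => coordCLM i (hopf y)) (coordCLM i ∘L Ln) x := fun i =>
    (coordCLM i).hasFDerivAt.comp x hLn
  have P : ∀ i, HasFDerivAt (fun y : Quat => coordCLM i (y⁻¹ * v))
      (coordCLM i ∘L maurerCartanDeriv x v) x := fun i =>
    (coordCLM i).hasFDerivAt.comp x (hasFDerivAt_inv_mul hx v)
  have W : ∀ i j, HasFDerivAt _ _ x := fun i j => (N i).fun_mul (P j)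
  have H : ∀ {c : ℝ → ℝ} {c' : ℝ}, HasDerivAt c c' (height x) →
      HasFDerivAt (fun y => c (height y)) (c' • heightDeriv x) x := fun hc =>
    hc.comp_hasFDerivAt x (hasFDerivAt_height hx)
  have dα : HasDerivAt (fun t => 2 * f t ^ 2) (4 * f (height x) * f') (height x) :=
    ((hf.fun_pow 2).const_mul 2).congr_deriv (by push_cast; ring)
  have dβ : HasDerivAt (fun t => 2 * f t) (2 * f') (height x) := hf.const_mul 2
  have dγ : HasDerivAt (fun t => 1 / (2 * f t ^ 2)) (-f' / f (height x) ^ 3) (height x) :=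
    ((hasDerivAt_const _ (1 : ℝ)).fun_div dα (by positivity)).congr_deriv (by field_simp; ring)
  have dδ : HasDerivAt (fun t => 1 / f t) (-f' / f (height x) ^ 2) (height x) :=
    ((hasDerivAt_const _ (1 : ℝ)).fun_div hf hf0).congr_deriv (by field_simp; ring)
  have dε : HasDerivAt (fun t => 1 / (2 * f t)) (-f' / (2 * f (height x) ^ 2)) (height x) :=
    ((hasDerivAt_const _ (1 : ℝ)).fun_div dβ (by positivity)).congr_deriv (by field_simp; ring)
  have dκ : HasDerivAt (fun _ : ℝ => (1 : ℝ)) 0 (height x) := hasDerivAt_const _ _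
  have c0 := ((((H dα).fun_mul (W 1 1)).fun_add
    ((H dβ).fun_mul ((W 2 2).fun_add (W 3 3)))).const_mul s).fun_neg
  have c1 := (((H dγ).fun_mul (W 1 0)).const_mul s).fun_add
    ((H dδ).fun_mul ((W 2 3).fun_sub (W 3 2)))
  have c2 := ((((H dε).fun_mul (W 2 0)).const_mul s).fun_add ((H hf).fun_mul (W 3 1))).fun_sub
    ((H dκ).fun_mul (W 1 3))
  have c3 := ((((H dε).fun_mul (W 3 0)).const_mul s).fun_add ((H dκ).fun_mul (W 1 2))).fun_sub
    ((H hf).fun_mul (W 2 1))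
  have hsum := (hasFDerivAt_id x).mul' ((((c0.smul_const (stdBasis 0)).fun_add
    (c1.smul_const (stdBasis 1))).fun_add (c2.smul_const (stdBasis 2))).fun_add
    (c3.smul_const (stdBasis 3)))
  refine ⟨_, hsum.congr_of_eventuallyEq (.of_forall fun y => ?_), fun u => ?_⟩
  · simp only [leftStructure, structureMap, quat_eq_sum]
    rfl
  · have hu : ∀ A K : Quat, x * A + u * K = x * (x⁻¹ * u * K + A) := fun A K => by
      rw [mul_add, ← mul_assoc, mul_inv_cancel_left₀ hx, add_comm]
    simp only [add_apply, sub_apply, neg_apply, smul_apply, ContinuousLinearMap.comp_apply,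
      hLu, ContinuousLinearMap.smulRight_apply, ContinuousLinearMap.id_apply, id,
      maurerCartanDeriv_apply, heightDeriv_apply, smul_eq_mul, coordCLM_zero, coordCLM_one,
      coordCLM_two, coordCLM_three, op_smul_eq_mul]
    rw [← quat_eq_sum, ← quat_eq_sum, hu, add_sub_assoc, add_assoc (x⁻¹ * u * _)]
    congr 2
    generalize x⁻¹ * u = p
    generalize x⁻¹ * v = q
    generalize hopf x = n
    generalize f (height x) = r
    ext <;> simp only [leftStructure, structureMap, Quaternion.re_add, Quaternion.re_sub,
      Quaternion.re_smul, Quaternion.re_neg,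
      Quaternion.imI_add, Quaternion.imI_sub, Quaternion.imI_smul, Quaternion.imI_neg,
      Quaternion.imJ_add, Quaternion.imJ_sub, Quaternion.imJ_smul, Quaternion.imJ_neg,
      Quaternion.imK_add, Quaternion.imK_sub, Quaternion.imK_smul, Quaternion.imK_neg,
      re_quat, imI_quat, imJ_quat, imK_quat, smul_eq_mul] <;> ring_nf

set_option maxHeartbeats 8000000 in
/-- The Nijenhuis tensor of `I^s` in the left-invariant frame, where `f' = s (f - 1)`; `D p q` is the
derivative along `x p` of the field `I v`, `v = x q`, multiplied on the left by `x⁻¹`. -/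
lemma nijenhuis_leftStructure {s f : ℝ} (hs : s = 1 ∨ s = -1) (hf : f ≠ 0) {n : Quat}
    (hn : n.re = 0) (p q : Quat)
    {D : Quat → Quat → Quat} (hD : ∀ p q, D p q = p * leftStructure s f n q
        + p.re • structureMap s (4 * f * (s * (f - 1))) (2 * (s * (f - 1)))
          (-(s * (f - 1)) / f ^ 3) (-(s * (f - 1)) / f ^ 2) (-(s * (f - 1)) / (2 * f ^ 2))
          (s * (f - 1)) 0 n q
        + leftStructure s f (n * p - p * n) q - leftStructure s f n (p * q)) :
    D (leftStructure s f n p) q - D (leftStructure s f n q) p + leftStructure s f n (D q p)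
      - leftStructure s f n (D p q) = 0 := by
  simp only [hD]
  ext <;> simp only [leftStructure, structureMap, Quaternion.re_add, Quaternion.re_sub,
      Quaternion.re_smul, Quaternion.re_mul, Quaternion.re_zero,
      Quaternion.imI_add, Quaternion.imI_sub, Quaternion.imI_smul, Quaternion.imI_mul,
      Quaternion.imJ_add, Quaternion.imJ_sub, Quaternion.imJ_smul, Quaternion.imJ_mul,
      Quaternion.imK_add, Quaternion.imK_sub, Quaternion.imK_smul, Quaternion.imK_mul,
      Quaternion.imI_zero, Quaternion.imJ_zero, Quaternion.imK_zero,
      re_quat, imI_quat, imJ_quat, imK_quat, smul_eq_mul, hn]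
  all_goals rcases hs with rfl | rfl <;> field_simp <;> ring

lemma leftStructure_sq {s f : ℝ} (hs : s = 1 ∨ s = -1) (hf : f ≠ 0) {n : Quat}
    (hn : n.imI ^ 2 + n.imJ ^ 2 + n.imK ^ 2 = 1) (p : Quat) :
    leftStructure s f n (leftStructure s f n p) = -p := by
  have hn1 : n.imI ^ 2 = 1 - n.imJ ^ 2 - n.imK ^ 2 := by linarith
  ext <;> simp only [leftStructure, structureMap, re_quat, imI_quat, imJ_quat, imK_quat,
    Quaternion.re_neg, Quaternion.imI_neg, Quaternion.imJ_neg, Quaternion.imK_neg] <;>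
    rcases hs with rfl | rfl <;> field_simp <;> ring_nf <;> simp only [hn1] <;> ring

lemma contDiffAt_quat {n : WithTop ℕ∞} {x : Quat} {a b c d : Quat → ℝ} (ha : ContDiffAt ℝ n a x)
    (hb : ContDiffAt ℝ n b x) (hc : ContDiffAt ℝ n c x) (hd : ContDiffAt ℝ n d x) :
    ContDiffAt ℝ n (fun y => quat (a y) (b y) (c y) (d y)) x := by
  simp only [quat_eq_sum]
  exact (((ha.smul contDiffAt_const).add (hb.smul contDiffAt_const)).add
    (hc.smul contDiffAt_const)).add (hd.smul contDiffAt_const)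

lemma contDiffAt_coordCLM_comp {n : WithTop ℕ∞} {x : Quat} {h : Quat → Quat} (hh : ContDiffAt ℝ n h x)
    (i : Fin 4) : ContDiffAt ℝ n (fun y => coordCLM i (h y)) x :=
  (coordCLM i).contDiff.contDiffAt.comp x hh

lemma contDiffAt_leftStructure {s : ℝ} {f : ℝ → ℝ} {x : Quat} (hx : x ≠ 0)
    (hf : ContDiffAt ℝ ∞ f (height x)) (hf0 : f (height x) ≠ 0) (v : Quat) :
    ContDiffAt ℝ ∞ (fun y => y * leftStructure s (f (height y)) (hopf y) (y⁻¹ * v)) x := by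
  have hfh : ContDiffAt ℝ ∞ (fun y => f (height y)) x := hf.comp x (contDiffAt_height hx)
  have hinv := contDiffAt_inv_quat hx
  have hN : ContDiffAt ℝ ∞ hopf x := (hinv.mul contDiffAt_const).mul contDiffAt_id
  have hP : ContDiffAt ℝ ∞ (fun y : Quat => y⁻¹ * v) x := hinv.mul contDiffAt_const
  have N0 := contDiffAt_coordCLM_comp hN
  have P0 := contDiffAt_coordCLM_comp hP
  have n1 : ContDiffAt ℝ ∞ (fun y => (hopf y).imI) x := N0 1
  have n2 : ContDiffAt ℝ ∞ (fun y => (hopf y).imJ) x := N0 2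
  have n3 : ContDiffAt ℝ ∞ (fun y => (hopf y).imK) x := N0 3
  have p0 : ContDiffAt ℝ ∞ (fun y : Quat => (y⁻¹ * v).re) x := P0 0
  have p1 : ContDiffAt ℝ ∞ (fun y : Quat => (y⁻¹ * v).imI) x := P0 1
  have p2 : ContDiffAt ℝ ∞ (fun y : Quat => (y⁻¹ * v).imJ) x := P0 2
  have p3 : ContDiffAt ℝ ∞ (fun y : Quat => (y⁻¹ * v).imK) x := P0 3
  have h2 : (2 : ℝ) * f (height x) ^ 2 ≠ 0 := mul_ne_zero two_ne_zero (pow_ne_zero 2 hf0)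
  have h3 : (2 : ℝ) * f (height x) ≠ 0 := mul_ne_zero two_ne_zero hf0
  have g1 := (contDiffAt_const (c := (1 : ℝ))).div hfh hf0
  have g2 := (contDiffAt_const (c := (1 : ℝ))).div (contDiffAt_const.mul hfh) h3
  have g3 := (contDiffAt_const (c := (1 : ℝ))).div (contDiffAt_const.mul (hfh.pow 2)) h2
  have hs : ContDiffAt ℝ ∞ (fun _ : Quat => s) x := contDiffAt_const
  have h2' : ContDiffAt ℝ ∞ (fun _ : Quat => (2 : ℝ)) x := contDiffAt_const
  have h1' : ContDiffAt ℝ ∞ (fun _ : Quat => (1 : ℝ)) x := contDiffAt_const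
  refine contDiffAt_id.mul (contDiffAt_quat ?_ ?_ ?_ ?_)
  · exact (hs.mul (((h2'.mul (hfh.pow 2)).mul (n1.mul p1)).add
      ((h2'.mul hfh).mul ((n2.mul p2).add (n3.mul p3))))).neg
  · exact (hs.mul (g3.mul (n1.mul p0))).add (g1.mul ((n2.mul p3).sub (n3.mul p2)))
  · exact ((hs.mul (g2.mul (n2.mul p0))).add (hfh.mul (n3.mul p1))).sub
      (h1'.mul (n1.mul p3))
  · exact ((hs.mul (g2.mul (n3.mul p0))).add (h1'.mul (n1.mul p2))).sub
      (hfh.mul (n2.mul p1))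

lemma IsModelOn.sqrt_eq {s c₀ c : ℝ} {J : Set ℝ} {F C : ℝ → ℝ} (h : IsModelOn s c₀ c J F C)
    {z : ℝ} (hz : z ∈ J) : √(F z) = 1 + c * Real.exp (s * z) := by
  rw [(h z hz).2.1, modelF, Real.sqrt_sq (h z hz).1.le]

lemma IsModelOn.pos_F {s c₀ c : ℝ} {J : Set ℝ} {F C : ℝ → ℝ} (h : IsModelOn s c₀ c J F C)
    {z : ℝ} (hz : z ∈ J) : 0 < F z := by
  rw [(h z hz).2.1, modelF]; exact pow_pos (h z hz).1 2

lemma IsModelOn.pos_C {s c₀ c : ℝ} {J : Set ℝ} {F C : ℝ → ℝ} (h : IsModelOn s c₀ c J F C)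
    (hc₀ : 0 < c₀) {z : ℝ} (hz : z ∈ J) : 0 < C z := by
  rw [(h z hz).2.2, modelC]
  have := (h z hz).1
  positivity

/-- The model metrics are Kähler for `I^s`. -/
lemma IsModelOn.isKahlerOn {s c₀ c : ℝ} (hs : s = 1 ∨ s = -1) {J : Set ℝ} {F C : ℝ → ℝ}
    (hJ : IsOpen J) (hc₀ : 0 < c₀) (h : IsModelOn s c₀ c J F C) :
    IsKahlerOn (shell J) (zMetric F C) (iStructure s F C) := by
  set w : ℝ → ℝ := fun z => 1 + c * Real.exp (s * z) with hwdef
  have hw : ∀ z, HasDerivAt w (s * (w z - 1)) z := hasDerivAt_one_add_mul_exp s c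
  have hF : ∀ z ∈ J, 0 < F z := fun z hz => h.pos_F hz
  have hC : ∀ z ∈ J, 0 < C z := fun z hz => h.pos_C hc₀ hz
  have hw0 : ∀ z ∈ J, w z ≠ 0 := fun z hz => (h z hz).1.ne'
  have hI : ∀ x ∈ shell J, ∀ v, iStructure s F C x v
      = x * leftStructure s (w (height x)) (hopf x) (x⁻¹ * v) := fun x hx v => by
    rw [iStructure_apply hs hx.1 (hF _ hx.2) (hC _ hx.2), h.sqrt_eq hx.2]
  have hI' : ∀ x ∈ shell J, ∀ v, (fun y => iStructure s F C y v) =ᶠ[𝓝 x]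
      fun y => y * leftStructure s (w (height y)) (hopf y) (y⁻¹ * v) := fun x hx v => by
    filter_upwards [(isOpen_shell hJ).mem_nhds hx] with y hy using hI y hy v
  constructor
  · intro v x hx
    have hwc : ContDiff ℝ ∞ w := by rw [hwdef]; fun_prop
    exact ((contDiffAt_leftStructure hx.1 hwc.contDiffAt (hw0 _ hx.2) v).congr_of_eventuallyEq
      (hI' x hx v)).contDiffWithinAt
  · intro x hx v
    rw [hI x hx, hI x hx, inv_mul_cancel_left₀ hx.1,
      leftStructure_sq hs (hw0 _ hx.2) (hopf_normSq hx.1), mul_neg, mul_inv_cancel_left₀ hx.1]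
  · intro x hx v v'
    have hn := hopf_normSq hx.1
    have hwx := hw0 _ hx.2
    have hFw : F (height x) = w (height x) ^ 2 := (h _ hx.2).2.1
    rw [hI x hx, hI x hx, zMetric, uMetric_apply, uMetric_apply, inv_mul_cancel_left₀ hx.1,
      inv_mul_cancel_left₀ hx.1, hFw]
    generalize w (height x) = f at *
    generalize x⁻¹ * v = p
    generalize x⁻¹ * v' = q
    generalize hopf x = n at *
    have hn1 : n.imI ^ 2 = 1 - n.imJ ^ 2 - n.imK ^ 2 := by linarith
    simp only [leftStructure, structureMap, re_quat, imI_quat, imJ_quat, imK_quat]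
    rcases hs with rfl | rfl <;> field_simp <;> ring_nf <;> simp only [hn1] <;> ring
  · intro x hx v v'
    choose L hL hLu using hasFDerivAt_leftStructure (s := s) hx.1 (hw (height x)) (hw0 _ hx.2)
    have hfd : ∀ v, fderiv ℝ (fun y => iStructure s F C y v) x = L v := fun v =>
      ((hL v).congr_of_eventuallyEq (hI' x hx v)).fderiv
    have hN := nijenhuis_leftStructure hs (hw0 _ hx.2) (hopf_re x) (x⁻¹ * v) (x⁻¹ * v')
      (fun p q => rfl)
    simp only [nijenhuis, VectorField.lieBracket, hfd, fderiv_const_apply, zero_apply, sub_zero,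
      zero_sub, map_neg, sub_neg_eq_add]
    simp only [hI x hx, hLu, inv_mul_cancel_left₀ hx.1]
    rw [← mul_sub, ← mul_add, ← mul_sub, hN, mul_zero]
  · have hwsq : ∀ z ∈ J, HasDerivAt (fun t => √(F t)) (s * (w z - 1)) z := fun z hz =>
      (hw z).congr_of_eventuallyEq (by
        filter_upwards [hJ.mem_nhds hz] with t ht using h.sqrt_eq ht)
    have hL := h.isInvariantLeviCivita hJ hc₀
    refine (isClosedTwoFormOn_fundamentalForm_iff hs hJ hF hC hwsq hL.derivC).2 fun z hz => ?_
    have hwz := hw0 z hz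
    rw [h.sqrt_eq hz, (h z hz).2.2, modelC]
    change w z ≠ 0 at hwz
    simp only [hwdef] at hwz ⊢
    generalize 1 + c * Real.exp (s * z) = r at *
    constructor
    · field_simp
    · field_simp
      ring

/-! ### The Kähler criterion -/

section

variable {s : ℝ} {J : Set ℝ} {F C : ℝ → ℝ}

lemma IsAnsatz.hasModelForm (hs : s = 1 ∨ s = -1) (h : IsAnsatz J F C)
    (hcl : IsClosedTwoFormOn (shell J) (fundamentalForm (zMetric F C) (iStructure s F C))) :
    HasModelForm s J F C := by
  have hf : ∀ z ∈ J, HasDerivAt (fun t => √(F t)) (deriv (fun t => √(F t)) z) z := fun z hz =>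
    (((h.smoothF.contDiffAt (h.isOpen.mem_nhds hz)).differentiableAt (by simp)).sqrt
      (h.posF z hz).ne').hasDerivAt
  have hc : ∀ z ∈ J, HasDerivAt C (deriv C z) z := fun z hz =>
    ((h.smoothC.contDiffAt (h.isOpen.mem_nhds hz)).differentiableAt (by simp)).hasDerivAt
  exact hasModelForm_of_ode h.isOpen h.interval.isPreconnected h.nonempty h.posF h.posC hf hc
    ((isClosedTwoFormOn_fundamentalForm_iff hs h.isOpen h.posF h.posC hf hc).1 hcl)

lemma HasModelForm.isKahlerOn (hs : s = 1 ∨ s = -1) (hJ : IsOpen J) (h : HasModelForm s J F C) :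
    IsKahlerOn (shell J) (zMetric F C) (iStructure s F C) := by
  obtain ⟨c₀, c, hc₀, h⟩ := h
  exact IsModelOn.isKahlerOn hs hJ hc₀ h

lemma HasModelForm.ricciFlatOn (hs : s = 1 ∨ s = -1) (hJ : IsOpen J) (h : HasModelForm s J F C) :
    RicciFlatOn (shell J) (zMetric F C) := by
  obtain ⟨c₀, c, hc₀, h⟩ := h
  exact IsModelOn.ricciFlatOn hs hJ hc₀ h

end

/-! ### Changes of the radial coordinate -/

/-- The map `(z, u) ↦ (k z, u)` of `ℝ × S³`. -/
noncomputable def radialMap (k : ℝ → ℝ) (x : Quat) : Quat :=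
  Real.exp (k (height x) - height x) • x

lemma exp_height {x : Quat} (hx : x ≠ 0) : Real.exp (height x) = ‖x‖ :=
  Real.exp_log (norm_pos_iff.2 hx)

lemma radialMap_ne_zero (k : ℝ → ℝ) {x : Quat} (hx : x ≠ 0) : radialMap k x ≠ 0 :=
  smul_ne_zero (Real.exp_pos _).ne' hx

lemma height_exp_smul (t : ℝ) {x : Quat} (hx : x ≠ 0) :
    height (Real.exp t • x) = t + height x := by
  rw [height, norm_smul, Real.norm_of_nonneg (Real.exp_pos t).le,
    Real.log_mul (Real.exp_pos t).ne' (norm_ne_zero_iff.2 hx), Real.log_exp, height]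

lemma height_radialMap (k : ℝ → ℝ) {x : Quat} (hx : x ≠ 0) :
    height (radialMap k x) = k (height x) := by
  rw [radialMap, height_exp_smul _ hx, sub_add_cancel]

lemma contDiffAt_radialMap {k : ℝ → ℝ} {x : Quat} (hx : x ≠ 0)
    (hk : ContDiffAt ℝ ∞ k (height x)) : ContDiffAt ℝ ∞ (radialMap k) x :=
  ((hk.comp x (contDiffAt_height hx)).sub (contDiffAt_height hx)).exp.smul contDiffAt_id

/-- A radial map pulls `η⁰` back to `k' η⁰` and preserves `η¹, η², η³`. -/
lemma inv_mul_fderiv_radialMap {k : ℝ → ℝ} {k' : ℝ} {x : Quat} (hx : x ≠ 0)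
    (hk : HasDerivAt k k' (height x)) (v : Quat) :
    (radialMap k x)⁻¹ * fderiv ℝ (radialMap k) x v =
      quat (k' * (x⁻¹ * v).re) (x⁻¹ * v).imI (x⁻¹ * v).imJ (x⁻¹ * v).imK := by
  have hh := hasFDerivAt_height hx
  have h := (((hk.comp_hasFDerivAt x hh).fun_sub hh).exp).fun_smul (hasFDerivAt_id x)
  have h' : HasFDerivAt (radialMap k) _ x := h
  rw [h'.fderiv, radialMap]
  simp only [add_apply, smul_apply, sub_apply, ContinuousLinearMap.id_apply,
    ContinuousLinearMap.smulRight_apply, heightDeriv_apply, Function.comp_apply, id, smul_eq_mul]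
  rw [show (Real.exp (k (height x) - height x) • x)⁻¹
    = (Real.exp (k (height x) - height x))⁻¹ • x⁻¹ from smul_inv₀ _ _]
  have he := (Real.exp_pos (k (height x) - height x)).ne'
  simp only [mul_add, Algebra.smul_mul_assoc, mul_smul_comm, inv_mul_cancel₀ hx, smul_smul]
  generalize x⁻¹ * v = p
  ext <;> simp
  field_simp
  ring

lemma isDiffeo_radialMap {J J' : Set ℝ} (hJ : IsOpen J) (hJ' : IsOpen J') {k l : ℝ → ℝ}
    (hk : ContDiffOn ℝ ∞ k J) (hl : ContDiffOn ℝ ∞ l J') (hkJ : MapsTo k J J')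
    (hlJ : MapsTo l J' J) (hkl : InvOn l k J J') :
    IsDiffeo (radialMap k) (shell J) (shell J') := by
  have key : ∀ {J J' : Set ℝ} {k l : ℝ → ℝ}, IsOpen J → ContDiffOn ℝ ∞ k J → MapsTo k J J' →
      LeftInvOn l k J → MapsTo (radialMap k) (shell J) (shell J') ∧
        ContDiffOn ℝ ∞ (radialMap k) (shell J) ∧
        LeftInvOn (radialMap l) (radialMap k) (shell J) := by
    intro J J' k l hJ hk hkJ hkl
    refine ⟨fun x hx => ⟨radialMap_ne_zero k hx.1, ?_⟩, fun x hx => ?_, fun x hx => ?_⟩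
    · rw [height_radialMap k hx.1]; exact hkJ hx.2
    · exact (contDiffAt_radialMap hx.1
        (hk.contDiffAt (hJ.mem_nhds hx.2))).contDiffWithinAt
    · rw [radialMap, height_radialMap k hx.1, hkl hx.2, radialMap, smul_smul, ← Real.exp_add]
      simp
  obtain ⟨h1, h2, h3⟩ := key hJ hk hkJ hkl.1
  obtain ⟨h4, h5, h6⟩ := key hJ' hl hlJ hkl.2
  exact ⟨h1, h2, radialMap l, h4, h5, h3, h6⟩

lemma uMetric_radialMap {A B C k : ℝ → ℝ} {k' : ℝ} {x : Quat} (hx : x ≠ 0)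
    (hk : HasDerivAt k k' (height x)) (v w : Quat) :
    uMetric A B C (radialMap k x) (fderiv ℝ (radialMap k) x v) (fderiv ℝ (radialMap k) x w) =
      A (k (height x)) * k' ^ 2 * ((x⁻¹ * v).re * (x⁻¹ * w).re)
      + B (k (height x)) * ((x⁻¹ * v).imI * (x⁻¹ * w).imI)
      + C (k (height x)) * ((x⁻¹ * v).imJ * (x⁻¹ * w).imJ + (x⁻¹ * v).imK * (x⁻¹ * w).imK) := by
  rw [uMetric_apply, height_radialMap k hx, inv_mul_fderiv_radialMap hx hk,
    inv_mul_fderiv_radialMap hx hk]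
  simp only [re_quat, imI_quat, imJ_quat, imK_quat]
  ring

lemma isHomothety_radialMap {J J' : Set ℝ} (hJ : IsOpen J) (hJ' : IsOpen J')
    {k l k' : ℝ → ℝ} (hk : ContDiffOn ℝ ∞ k J) (hl : ContDiffOn ℝ ∞ l J') (hkJ : MapsTo k J J')
    (hlJ : MapsTo l J' J) (hkl : InvOn l k J J') (hk' : ∀ z ∈ J, HasDerivAt k (k' z) z)
    {lam : ℝ} (hlam : 0 < lam) {A B C A' B' C' : ℝ → ℝ}
    (hA : ∀ z ∈ J, A' (k z) * k' z ^ 2 = lam * A z) (hB : ∀ z ∈ J, B' (k z) = lam * B z)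
    (hC : ∀ z ∈ J, C' (k z) = lam * C z) :
    IsHomothety lam (radialMap k) (shell J) (uMetric A B C) (shell J') (uMetric A' B' C') := by
  refine ⟨hlam, isDiffeo_radialMap hJ hJ' hk hl hkJ hlJ hkl, fun x hx v w => ?_⟩
  rw [uMetric_radialMap hx.1 (hk' _ hx.2), hA _ hx.2, hB _ hx.2, hC _ hx.2, uMetric_apply]
  ring

/-! ### The model metrics up to homothety -/

lemma mem_modelDomain_neg_one {s z : ℝ} : z ∈ modelDomain s (-1) ↔ s * z < 0 := by
  change 0 < 1 + -1 * Real.exp (s * z) ↔ _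
  rw [← Real.exp_lt_one_iff]
  constructor <;> intro h <;> linarith

lemma modelDomain_neg_one (s : ℝ) : modelDomain s (-1) = {z | s * z < 0} :=
  Set.ext fun _ => mem_modelDomain_neg_one

lemma modelDomain_eq_univ (s : ℝ) {c : ℝ} (hc : 0 ≤ c) : modelDomain s c = univ :=
  Set.eq_univ_of_forall fun z => by
    change 0 < 1 + c * Real.exp (s * z)
    positivity

lemma isAnsatz_modelDomain {s : ℝ} (hs : s ≠ 0) {c : ℝ} (hc : c = 0 ∨ c = -1 ∨ c = 1) :
    IsAnsatz (modelDomain s c) (modelF s c) (modelC s 1 c) := by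
  have hne : ∀ z ∈ modelDomain s c, (1 + c * Real.exp (s * z)) ^ 2 ≠ 0 := fun z hz =>
    pow_ne_zero 2 (ne_of_gt hz)
  refine ⟨isOpen_modelDomain s c, ?_, ?_, ?_, ?_, fun z hz => ?_, fun z hz => ?_⟩
  · rcases hc with rfl | rfl | rfl
    · rw [modelDomain_eq_univ s le_rfl]; exact ordConnected_univ
    · rw [modelDomain_neg_one]
      refine ⟨fun a ha b hb z hz => ?_⟩
      simp only [mem_ofPred_eq, mem_Icc] at ha hb hz ⊢
      rcases le_total 0 s with h | h <;> nlinarith [hz.1, hz.2]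
    · rw [modelDomain_eq_univ s zero_le_one]; exact ordConnected_univ
  · rcases hc with rfl | rfl | rfl
    · rw [modelDomain_eq_univ s le_rfl]; exact univ_nonempty
    · exact ⟨-s, mem_modelDomain_neg_one.2 (by nlinarith [mul_self_pos.2 hs])⟩
    · rw [modelDomain_eq_univ s zero_le_one]; exact univ_nonempty
  · unfold modelF; fun_prop
  · unfold modelC
    exact ContDiffOn.div (by fun_prop) (by fun_prop) hne
  · exact pow_pos hz 2
  · exact div_pos (by positivity) (pow_pos hz 2)

/-- A translation by `s log |c|` turns the constant `c` into its sign. -/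
lemma IsModelOn.exists_homothetic {s c₀ c : ℝ} (hs : s = 1 ∨ s = -1) {J : Set ℝ} {F C : ℝ → ℝ}
    (hJ : IsOpen J) (hc₀ : 0 < c₀) (h : IsModelOn s c₀ c J F C) :
    ∃ c' : ℝ, (c' = 0 ∨ c' = -1 ∨ c' = 1) ∧ ∃ τ : ℝ,
      (fun z => z + τ) '' J ⊆ modelDomain s c' ∧
      Homothetic (shell J) (zMetric F C) (shell ((fun z => z + τ) '' J)) (model s c') := by
  obtain ⟨c', b, τ, hc', hb, hcb, hτ⟩ : ∃ c' b τ : ℝ, (c' = 0 ∨ c' = -1 ∨ c' = 1) ∧ 0 < b ∧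
      c = c' * b ∧ Real.exp (s * τ) = b := by
    have hss : s * s = 1 := by rcases hs with rfl | rfl <;> norm_num
    have hexp : ∀ b : ℝ, 0 < b → Real.exp (s * (s * Real.log b)) = b := fun b hb => by
      rw [← mul_assoc, hss, one_mul, Real.exp_log hb]
    rcases lt_trichotomy c 0 with hc | hc | hc
    · exact ⟨-1, -c, _, by simp, by linarith, by ring, hexp _ (by linarith)⟩
    · exact ⟨0, 1, _, by simp, one_pos, by simp [hc], hexp 1 one_pos⟩
    · exact ⟨1, c, _, by simp, hc, by ring, hexp c hc⟩
  have hq : ∀ z, Real.exp (s * (z + τ)) = b * Real.exp (s * z) := fun z => by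
    rw [mul_add, Real.exp_add, hτ, mul_comm]
  have hw : ∀ z, 1 + c' * Real.exp (s * (z + τ)) = 1 + c * Real.exp (s * z) := fun z => by
    rw [hq, hcb]; ring
  have hF : ∀ z ∈ J, modelF s c' (z + τ) = F z := fun z hz => by
    rw [(h z hz).2.1, modelF, modelF, hw]
  have hC : ∀ z ∈ J, modelC s 1 c' (z + τ) = b / c₀ * C z := fun z hz => by
    rw [(h z hz).2.2, modelC, modelC, hw, hq]
    field_simp
  have hinv : ∀ y ∈ (fun z => z + τ) '' J, y - τ ∈ J := by
    rintro _ ⟨z, hz, rfl⟩; simpa using hz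
  refine ⟨c', hc', τ, ?_, b / c₀, radialMap fun z => z + τ, ?_⟩
  · rintro _ ⟨z, hz, rfl⟩
    change 0 < 1 + c' * Real.exp (s * (z + τ))
    rw [hw]; exact (h z hz).1
  · refine isHomothety_radialMap (l := fun y => y - τ) (k' := fun _ => 1) hJ
      (isOpenMap_add_right τ _ hJ) (by fun_prop) (by fun_prop) (mapsTo_image _ _) hinv
      ⟨fun z _ => by simp, fun z _ => by simp⟩ (fun z _ => (hasDerivAt_id z).add_const τ)
      (div_pos hb hc₀) (fun z hz => ?_) (fun z hz => ?_) hC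
    · rw [hF z hz, hC z hz]; ring
    · rw [hF z hz, hC z hz]; ring

/-- With `q = e^{sz}`, the coordinate of the Taub-NUT metric is `r = m (1 + q) / (1 - q)`. -/
lemma exists_isHomothety_taubNUT {s : ℝ} (hs : s = 1 ∨ s = -1) {m : ℝ} (hm : 0 < m) :
    ∃ φ : Quat → Quat, IsHomothety (4 * m ^ 2) φ (shell (modelDomain s (-1))) (model s (-1))
      (shell (Ioi m)) (taubNUT m) := by
  have hss : s * s = 1 := by rcases hs with rfl | rfl <;> norm_num
  have hs2 : s ^ 2 = 1 := by rw [sq, hss]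
  have hlt : ∀ z ∈ modelDomain s (-1), 0 < 1 - Real.exp (s * z) := fun z hz => by
    have : 0 < 1 + -1 * Real.exp (s * z) := hz
    linarith
  refine ⟨radialMap fun z => m * (1 + Real.exp (s * z)) / (1 - Real.exp (s * z)),
    isHomothety_radialMap (l := fun r => s * Real.log ((r - m) / (r + m)))
      (k' := fun z => 2 * m * s * Real.exp (s * z) / (1 - Real.exp (s * z)) ^ 2)
      (isOpen_modelDomain _ _) isOpen_Ioi ?_ ?_ ?_ ?_ ⟨?_, ?_⟩ ?_ (by positivity) ?_ ?_ ?_⟩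
  · exact ContDiffOn.div (by fun_prop) (by fun_prop) fun z hz => (hlt z hz).ne'
  · refine contDiffOn_const.mul (ContDiffOn.log (ContDiffOn.div (by fun_prop) (by fun_prop) ?_) ?_)
    · intro r hr
      have : m < r := hr
      exact (by linarith : (0:ℝ) < r + m).ne'
    · intro r hr
      have : m < r := hr
      exact (div_pos (by linarith : (0:ℝ) < r - m) (by linarith : (0:ℝ) < r + m)).ne'
  · intro z hz
    have h1 := hlt z hz
    have h2 := Real.exp_pos (s * z)
    change m < _
    rw [lt_div_iff₀ h1]
    nlinarith
  · intro r hr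
    have hr' : m < r := hr
    have h1 : (0:ℝ) < r + m := by linarith
    rw [mem_modelDomain_neg_one, ← mul_assoc, hss, one_mul]
    refine Real.log_neg (div_pos (by linarith) h1) ((div_lt_one h1).2 (by linarith))
  · intro z hz
    have h1 := (hlt z hz).ne'
    have h2 : (m * (1 + Real.exp (s * z)) / (1 - Real.exp (s * z)) - m) /
        (m * (1 + Real.exp (s * z)) / (1 - Real.exp (s * z)) + m) = Real.exp (s * z) := by
      field_simp
      ring
    simp only [h2, Real.log_exp, ← mul_assoc, hss, one_mul]
  · intro r hr
    have hr' : m < r := hr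
    have h1 : (0:ℝ) < r + m := by linarith
    have h2 : (0:ℝ) < r - m := by linarith
    have h3 : 1 - (r - m) / (r + m) = 2 * m / (r + m) := by field_simp; ring
    have h4 : 1 + (r - m) / (r + m) = 2 * r / (r + m) := by field_simp; ring
    simp only [← mul_assoc, hss, one_mul, Real.exp_log (div_pos h2 h1), h3, h4]
    field_simp
  · intro z hz
    have h1 := (hlt z hz).ne'
    have hq := hasDerivAt_exp_mul s z
    refine (((hq.const_add 1).const_mul m).fun_div (hq.const_sub 1) h1).congr_deriv ?_
    field_simp
    ring
  all_goals
    intro z hz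
    have h1 := (hlt z hz).ne'
    have h2 := (Real.exp_pos (s * z)).ne'
    have h3 : 1 + -1 * Real.exp (s * z) = 1 - Real.exp (s * z) := by ring
    have h4 : m * (1 + Real.exp (s * z)) / (1 - Real.exp (s * z)) + m
        = 2 * m / (1 - Real.exp (s * z)) := by field_simp; ring
    have h5 : m * (1 + Real.exp (s * z)) / (1 - Real.exp (s * z)) - m
        = 2 * m * Real.exp (s * z) / (1 - Real.exp (s * z)) := by field_simp; ring
    simp only [modelF, modelC, h3, sq_sub_sq, h4, h5]
    generalize 1 - Real.exp (s * z) = r at *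
    generalize Real.exp (s * z) = q at *
  · field_simp
    rw [hs2]
    ring
  · field_simp
  · field_simp
    ring

/-! ### The ALF end -/

lemma riemannNormSq_model {s c : ℝ} (hs : s = 1 ∨ s = -1) {x : Quat}
    (hx : x ∈ shell (modelDomain s c)) :
    riemannNormSq (model s c) x = 384 * c ^ 2 * (1 + c * Real.exp (s * height x)) ^ 6 := by
  rw [model, (isModelOn_modelDomain s 1 c).riemannNormSq_eq hs (isOpen_modelDomain s c) one_pos hx]
  norm_num

lemma model_apply {s c : ℝ} {x : Quat} (hx : x ∈ shell (modelDomain s c)) (v w : Quat) :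
    model s c x v w =
      Real.exp (s * height x) / (4 * (1 + c * Real.exp (s * height x)) ^ 4)
          * ((x⁻¹ * v).re * (x⁻¹ * w).re)
        + Real.exp (s * height x) * ((x⁻¹ * v).imI * (x⁻¹ * w).imI)
        + Real.exp (s * height x) / (1 + c * Real.exp (s * height x)) ^ 2
          * ((x⁻¹ * v).imJ * (x⁻¹ * w).imJ + (x⁻¹ * v).imK * (x⁻¹ * w).imK) := by
  have hw : 1 + c * Real.exp (s * height x) ≠ 0 := ne_of_gt hx.2
  rw [model, zMetric, uMetric_apply, modelF, modelC]
  generalize 1 + c * Real.exp (s * height x) = r at *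
  field_simp

lemma tendsto_radius_atTop (s : ℝ) :
    Tendsto (fun z => 1 / (2 * (1 - Real.exp (s * z)))) (𝓝[modelDomain s (-1)] 0) atTop := by
  simp only [one_div]
  refine tendsto_inv_nhdsGT_zero.comp (tendsto_nhdsWithin_iff.2 ⟨?_, ?_⟩)
  · have : Continuous fun z => 2 * (1 - Real.exp (s * z)) := by fun_prop
    simpa using (this.tendsto 0).mono_left nhdsWithin_le_nhds
  · filter_upwards [self_mem_nhdsWithin] with z hz
    have : 0 < 1 + -1 * Real.exp (s * z) := hz
    change 0 < 2 * (1 - Real.exp (s * z))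
    linarith

/-- With `q = e^{sz}`, the coordinate `ρ = 1 / (2 (1 - q))` makes the ratios of `g_{-1}` to the model
along `e₀, e₁, e₂, e₃` equal to `1/q, q, q, q`. -/
lemma hasALFEnd_model {s : ℝ} (hs : s = 1 ∨ s = -1) :
    HasALFEnd (shell (modelDomain s (-1))) (model s (-1))
      (comap height (𝓝[modelDomain s (-1)] 0)) := by
  have hss : s * s = 1 := by rcases hs with rfl | rfl <;> norm_num
  set J : Set ℝ := {z | s * z < 0 ∧ 1 / 2 < Real.exp (s * z)} with hJdef
  have hJo : IsOpen J :=
    (isOpen_lt (f := fun z : ℝ => s * z) (g := fun _ => 0) (by fun_prop) continuous_const).inter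
      (isOpen_lt (f := fun _ => 1 / 2) (g := fun z : ℝ => Real.exp (s * z)) continuous_const
        (by fun_prop))
  have hJs : J ⊆ modelDomain s (-1) := fun z hz => mem_modelDomain_neg_one.2 hz.1
  have hd : ∀ z ∈ J, 0 < 1 - Real.exp (s * z) := fun z hz => by
    have := Real.exp_lt_one_iff.2 hz.1; linarith
  have hl : ∀ ρ ∈ Ioi (1 : ℝ), 1 / 2 < 1 - 1 / (2 * ρ) ∧ 1 - 1 / (2 * ρ) < 1 := fun ρ hρ => by
    have h1 : (1 : ℝ) < ρ := hρ
    have h2 : 1 / (2 * ρ) < 1 / 2 := by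
      rw [div_lt_div_iff₀ (by linarith) two_pos]; linarith
    have h3 : 0 < 1 / (2 * ρ) := by positivity
    constructor <;> linarith
  have h0 : (0 : ℝ) ∉ J := fun h => by simpa using h.1
  have hk' : ∀ z ∈ J, HasDerivAt (fun z => 1 / (2 * (1 - Real.exp (s * z))))
      (s * Real.exp (s * z) / (2 * (1 - Real.exp (s * z)) ^ 2)) z := fun z hz => by
    have h1 := (hd z hz).ne'
    refine ((hasDerivAt_const z (1 : ℝ)).fun_div (((hasDerivAt_exp_mul s z).const_sub 1).const_mul 2)
      (mul_ne_zero two_ne_zero h1)).congr_deriv ?_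
    field_simp
    ring
  have hmem : J ∈ 𝓝[modelDomain s (-1)] 0 := by
    rw [modelDomain_neg_one]
    refine inter_mem self_mem_nhdsWithin (mem_nhdsWithin_of_mem_nhds ?_)
    exact (isOpen_lt (f := fun _ => 1 / 2) (g := fun z : ℝ => Real.exp (s * z)) continuous_const
      (by fun_prop)).mem_nhds (by norm_num)
  refine ⟨shell J, mem_comap.2 ⟨J, hmem, fun x hx => ⟨?_, hx⟩⟩, isOpen_shell hJo,
    fun x hx => ⟨hx.1, hJs hx.2⟩, 1, 1, 3, one_pos, one_pos,
    radialMap fun z => 1 / (2 * (1 - Real.exp (s * z))), ?_, ?_, ?_⟩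
  · rintro rfl
    exact h0 (by simpa [height] using hx)
  · refine isDiffeo_radialMap (l := fun ρ => s * Real.log (1 - 1 / (2 * ρ))) hJo isOpen_Ioi
      ?_ ?_ ?_ ?_ ⟨?_, ?_⟩
    · exact ContDiffOn.div (by fun_prop) (by fun_prop) fun z hz =>
        mul_ne_zero two_ne_zero (hd z hz).ne'
    · refine contDiffOn_const.mul (ContDiffOn.log (contDiffOn_const.sub
        (ContDiffOn.div (by fun_prop) (by fun_prop) fun ρ hρ => ?_)) fun ρ hρ => ?_)
      · have : (1 : ℝ) < ρ := hρ
        positivity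
      · have := (hl ρ hρ).1
        exact ne_of_gt (by linarith)
    · intro z hz
      have h1 := hd z hz
      have h2 := hz.2
      change 1 < 1 / (2 * (1 - Real.exp (s * z)))
      rw [lt_div_iff₀ (by linarith)]
      linarith
    · intro ρ hρ
      obtain ⟨h1, h2⟩ := hl ρ hρ
      have h3 : 0 < 1 - 1 / (2 * ρ) := by linarith
      simp only [hJdef, mem_ofPred_eq, ← mul_assoc, hss, one_mul, Real.exp_log h3]
      exact ⟨Real.log_neg h3 h2, h1⟩
    · intro z hz
      have h1 := (hd z hz).ne'
      have h2 : 1 - 1 / (2 * (1 / (2 * (1 - Real.exp (s * z))))) = Real.exp (s * z) := by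
        field_simp
        ring
      simp only [h2, Real.log_exp, ← mul_assoc, hss, one_mul]
    · intro ρ hρ
      have h1 : (1 : ℝ) < ρ := hρ
      have h3 : 0 < 1 - 1 / (2 * ρ) := by linarith [(hl ρ hρ).1]
      simp only [← mul_assoc, hss, one_mul, Real.exp_log h3]
      field_simp
      ring
  · refine ((tendsto_radius_atTop s).comp tendsto_comap).congr' ?_
    filter_upwards [preimage_mem_comap hmem] with x hx
    rw [height_radialMap _ (by rintro rfl; exact h0 (by simpa [height] using hx))]
    rfl
  · intro x hx
    have hxm : x ∈ shell (modelDomain s (-1)) := ⟨hx.1, hJs hx.2⟩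
    have hw : 1 + -1 * Real.exp (s * height x) = 1 - Real.exp (s * height x) := by ring
    have hq := hx.2.2
    have hd0 := hd _ hx.2
    rw [height_radialMap _ hx.1]
    refine ⟨fun v => ?_, ?_⟩
    · rw [alfModel, uMetric_radialMap hx.1 (hk' _ hx.2), model_apply hxm, hw]
      have hs2 : (s * Real.exp (s * height x) / (2 * (1 - Real.exp (s * height x)) ^ 2)) ^ 2
          = Real.exp (s * height x) ^ 2 / (4 * (1 - Real.exp (s * height x)) ^ 4) := by
        rw [div_pow, mul_pow, sq s, hss]; ring
      rw [hs2]
      obtain ⟨d, hdd⟩ : ∃ d, d = 1 - Real.exp (s * height x) := ⟨_, rfl⟩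
      rw [← hdd] at hd0 ⊢
      have hqd : Real.exp (s * height x) = 1 - d := by linarith
      rw [hqd] at hq ⊢
      generalize x⁻¹ * v = p
      have ha : 0 ≤ (1 - d) / (4 * d ^ 3) * p.re ^ 2 :=
        mul_nonneg (div_nonneg (by linarith) (by positivity)) (sq_nonneg _)
      have hb : 0 ≤ d * p.imI ^ 2 := by positivity
      have he : 0 ≤ (p.imJ ^ 2 + p.imK ^ 2) / d := by positivity
      have hR : 3 / (1 / (2 * d)) * (1 * ((1 - d) ^ 2 / (4 * d ^ 4)) * (p.re * p.re)
          + 1 ^ 2 * (p.imI * p.imI) + 4 * (1 / (2 * d)) ^ 2 * (p.imJ * p.imJ + p.imK * p.imK))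
          = 6 * (1 - d) * ((1 - d) / (4 * d ^ 3) * p.re ^ 2) + 6 * (d * p.imI ^ 2)
            + 6 * ((p.imJ ^ 2 + p.imK ^ 2) / d) := by
        field_simp; ring
      have hL : (1 - d) / (4 * d ^ 4) * (p.re * p.re) + (1 - d) * (p.imI * p.imI)
          + (1 - d) / d ^ 2 * (p.imJ * p.imJ + p.imK * p.imK)
          - (1 * ((1 - d) ^ 2 / (4 * d ^ 4)) * (p.re * p.re) + 1 ^ 2 * (p.imI * p.imI)
            + 4 * (1 / (2 * d)) ^ 2 * (p.imJ * p.imJ + p.imK * p.imK))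
          = (1 - d) / (4 * d ^ 3) * p.re ^ 2 - d * p.imI ^ 2 - (p.imJ ^ 2 + p.imK ^ 2) / d := by
        field_simp; ring
      rw [hR, hL]
      -- here the condition `q > 1/2` on the neighbourhood of the end is used
      have h6 := mul_le_mul_of_nonneg_right (show 1 ≤ 6 * (1 - d) by linarith) ha
      rw [abs_le]
      constructor <;> linarith
    · rw [riemannNormSq_model hs hxm, hw]
      generalize 1 - Real.exp (s * height x) = d at *
      refine Real.sqrt_le_iff.2 ⟨by positivity, ?_⟩
      have h6 : 0 < d ^ 6 := by positivity
      field_simp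
      norm_num

/-! ### The nuts -/

/-- The extension of `g_c` over the nut, in the coordinate `y` on `ℝ⁴` with `|y|² = e^{sz}`: with
`ρ = |y|²`, it is `(1 + c ρ)⁻² (|dy|² + (2c + c²ρ) ⟨y i, dy⟩² - (2c + c²ρ) (1 + c ρ)⁻² ⟨y, dy⟩²)`. -/
noncomputable def nutMetric (c : ℝ) : BilinField := fun y =>
  ((1 + c * ‖y‖ ^ 2) ^ 2)⁻¹ • (∑ i, LinearMap.BilinForm.linMulLin (stdBasis.coord i) (stdBasis.coord i)
    + (2 * c + c ^ 2 * ‖y‖ ^ 2) • LinearMap.BilinForm.linMulLin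
        (stdBasis.coord 1 ∘ₗ LinearMap.mulLeft ℝ (star y))
        (stdBasis.coord 1 ∘ₗ LinearMap.mulLeft ℝ (star y))
    - ((2 * c + c ^ 2 * ‖y‖ ^ 2) * ((1 + c * ‖y‖ ^ 2) ^ 2)⁻¹) • LinearMap.BilinForm.linMulLin
        (stdBasis.coord 0 ∘ₗ LinearMap.mulLeft ℝ (star y))
        (stdBasis.coord 0 ∘ₗ LinearMap.mulLeft ℝ (star y)))

lemma nutMetric_apply (c : ℝ) (y v w : Quat) : nutMetric c y v w = ((1 + c * ‖y‖ ^ 2) ^ 2)⁻¹ *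
    (v.re * w.re + v.imI * w.imI + v.imJ * w.imJ + v.imK * w.imK
      + (2 * c + c ^ 2 * ‖y‖ ^ 2) * ((star y * v).imI * (star y * w).imI)
      - (2 * c + c ^ 2 * ‖y‖ ^ 2) * ((1 + c * ‖y‖ ^ 2) ^ 2)⁻¹
        * ((star y * v).re * (star y * w).re)) := by
  simp only [nutMetric, LinearMap.add_apply, LinearMap.sub_apply, LinearMap.smul_apply,
    Fin.sum_univ_four, LinearMap.BilinForm.linMulLin_apply, coord_zero,
    coord_one, coord_two, coord_three, smul_eq_mul, LinearMap.comp_apply,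
    LinearMap.mulLeft_apply]

lemma exp_two_mul_height {x : Quat} (hx : x ≠ 0) : Real.exp (2 * height x) = ‖x‖ ^ 2 := by
  rw [← exp_height hx, ← Real.exp_nat_mul]; norm_num

lemma nutMetric_eq_uMetric {c : ℝ} {y : Quat} (hy : y ≠ 0) (hc : 1 + c * ‖y‖ ^ 2 ≠ 0) :
    nutMetric c y = uMetric (fun t => Real.exp (2 * t) / (1 + c * Real.exp (2 * t)) ^ 4)
      (fun t => Real.exp (2 * t)) (fun t => Real.exp (2 * t) / (1 + c * Real.exp (2 * t)) ^ 2) y := by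
  refine LinearMap.ext₂ fun v w => ?_
  rw [nutMetric_apply, uMetric_apply, exp_two_mul_height hy]
  obtain ⟨p, rfl⟩ : ∃ p, v = y * p := ⟨y⁻¹ * v, (mul_inv_cancel_left₀ hy v).symm⟩
  obtain ⟨q, rfl⟩ : ∃ q, w = y * q := ⟨y⁻¹ * w, (mul_inv_cancel_left₀ hy w).symm⟩
  have hstar : ∀ p, star y * (y * p) = ‖y‖ ^ 2 • p := fun p => by
    have := congrArg (‖y‖ ^ 2 • ·) (inv_mul_cancel_left₀ hy p)
    simpa only [inv_eq, Algebra.smul_mul_assoc, smul_smul,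
      mul_inv_cancel₀ (pow_ne_zero 2 (norm_ne_zero_iff.2 hy)), one_smul] using this
  rw [hstar, hstar, inv_mul_cancel_left₀ hy, inv_mul_cancel_left₀ hy]
  have hin : (y * p).re * (y * q).re + (y * p).imI * (y * q).imI + (y * p).imJ * (y * q).imJ
      + (y * p).imK * (y * q).imK
      = ‖y‖ ^ 2 * (p.re * q.re + p.imI * q.imI + p.imJ * q.imJ + p.imK * q.imK) := by
    rw [norm_sq_eq]
    simp only [Quaternion.re_mul, Quaternion.imI_mul, Quaternion.imJ_mul, Quaternion.imK_mul]
    ring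
  rw [hin]
  simp only [Quaternion.re_smul, Quaternion.imI_smul, smul_eq_mul]
  generalize ‖y‖ ^ 2 = r at *
  field_simp
  ring

lemma uMetric_pos {A B C : ℝ → ℝ} {x : Quat} (hx : x ≠ 0) (hA : 0 < A (height x))
    (hB : 0 < B (height x)) (hC : 0 < C (height x)) {v : Quat} (hv : v ≠ 0) :
    0 < uMetric A B C x v v := by
  have h1 := norm_sq_eq (x⁻¹ * v)
  have h2 := pow_pos (norm_pos_iff.2 (mul_ne_zero (inv_ne_zero hx) hv)) 2
  rw [uMetric_apply]
  generalize x⁻¹ * v = p at *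
  have b0 := mul_nonneg hA.le (mul_self_nonneg p.re)
  have b1 := mul_nonneg hB.le (mul_self_nonneg p.imI)
  have b2 := mul_nonneg hC.le (mul_self_nonneg p.imJ)
  have b3 := mul_nonneg hC.le (mul_self_nonneg p.imK)
  by_contra hle
  have e0 : A (height x) * (p.re * p.re) = 0 := by linarith
  have e1 : B (height x) * (p.imI * p.imI) = 0 := by linarith
  have e2 : C (height x) * (p.imJ * p.imJ) = 0 := by linarith
  have e3 : C (height x) * (p.imK * p.imK) = 0 := by linarith
  rw [sq, sq, sq, sq, sq, (mul_eq_zero.1 e0).resolve_left hA.ne',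
    (mul_eq_zero.1 e1).resolve_left hB.ne', (mul_eq_zero.1 e2).resolve_left hC.ne',
    (mul_eq_zero.1 e3).resolve_left hC.ne'] at h1
  nlinarith

lemma contDiff_star_quat {n : WithTop ℕ∞} : ContDiff ℝ n (fun y : Quat => star y) := by
  have h : (fun y : Quat => star y) = fun y =>
      quat (coordCLM 0 y) (-coordCLM 1 y) (-coordCLM 2 y) (-coordCLM 3 y) := by
    funext y
    ext <;> simp
  rw [h]
  exact contDiff_iff_contDiffAt.2 fun y => contDiffAt_quat (coordCLM 0).contDiff.contDiffAt
    (coordCLM 1).contDiff.contDiffAt.neg (coordCLM 2).contDiff.contDiffAt.neg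
    (coordCLM 3).contDiff.contDiffAt.neg

lemma isRiemannianOn_nutMetric {c : ℝ} (hc : |c| ≤ 1) :
    IsRiemannianOn (Metric.ball 0 1) (nutMetric c) := by
  have hpos : ∀ y ∈ Metric.ball (0 : Quat) 1, 0 < 1 + c * ‖y‖ ^ 2 := fun y hy => by
    have h1 : ‖y‖ < 1 := mem_ball_zero_iff.1 hy
    have h2 : ‖y‖ ^ 2 < 1 := by nlinarith [norm_nonneg y]
    nlinarith [neg_le_of_abs_le hc, sq_nonneg ‖y‖]
  refine ⟨fun v w y hy => ?_, fun y hy v w => ?_, fun y hy v hv => ?_⟩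
  · have hne := pow_ne_zero 2 (hpos y hy).ne'
    have hn : ContDiffAt ℝ ∞ (fun y : Quat => ‖y‖ ^ 2) y := (contDiff_norm_sq ℝ).contDiffAt
    have hd : ContDiffAt ℝ ∞ (fun y : Quat => ((1 + c * ‖y‖ ^ 2) ^ 2)⁻¹) y :=
      ((contDiffAt_const.add (contDiffAt_const.mul hn)).pow 2).inv hne
    have he : ContDiffAt ℝ ∞ (fun y : Quat => 2 * c + c ^ 2 * ‖y‖ ^ 2) y :=
      contDiffAt_const.add (contDiffAt_const.mul hn)
    have hp : ∀ i (v : Quat), ContDiffAt ℝ ∞ (fun y : Quat => coordCLM i (star y * v)) y :=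
      fun i v => contDiffAt_coordCLM_comp
        (contDiff_star_quat.contDiffAt.mul contDiffAt_const) i
    simp only [nutMetric_apply]
    exact (hd.mul ((contDiffAt_const.add (he.mul ((hp 1 v).mul (hp 1 w)))).sub
      ((he.mul hd).mul ((hp 0 v).mul (hp 0 w))))).contDiffWithinAt
  · rw [nutMetric_apply, nutMetric_apply]
    ring
  · rcases eq_or_ne y 0 with rfl | hy0
    · have h1 := norm_sq_eq v
      have h2 := pow_pos (norm_pos_iff.2 hv) 2
      rw [nutMetric_apply]
      simp only [norm_zero, star_zero, zero_mul, Quaternion.re_zero, Quaternion.imI_zero]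
      norm_num
      linarith
    · have hw : 0 < 1 + c * Real.exp (2 * height y) := by
        rw [exp_two_mul_height hy0]; exact hpos y hy
      rw [nutMetric_eq_uMetric hy0 (hpos y hy).ne']
      exact uMetric_pos hy0 (by positivity) (by positivity) (by positivity) hv

lemma IsHomothety.congr_right {lam : ℝ} {φ : Quat → Quat} {U V : Set Quat} {g h h' : BilinField}
    (H : IsHomothety lam φ U g V h) (hh : ∀ y ∈ V, h y = h' y) : IsHomothety lam φ U g V h' :=
  ⟨H.1, H.2.1, fun x hx v w => by rw [← hh _ (H.2.1.1 hx), H.2.2 x hx]⟩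

lemma ball_diff_zero : Metric.ball (0 : Quat) 1 \ {0} = shell (Iio 0) := by
  ext y
  simp only [shell, height, Set.mem_sdiff, mem_ball_zero_iff, mem_singleton_iff, mem_ofPred_eq, mem_Iio]
  constructor
  · rintro ⟨h1, h2⟩
    exact ⟨h2, Real.log_neg (norm_pos_iff.2 h2) h1⟩
  · rintro ⟨h1, h2⟩
    exact ⟨(Real.log_neg_iff (norm_pos_iff.2 h1)).1 h2, h1⟩

lemma hasNut_model {s c : ℝ} (hs : s = 1 ∨ s = -1) (hc : |c| ≤ 1) :
    HasNut (shell (modelDomain s c)) (model s c) (comap (fun x => s * height x) atBot) := by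
  have hss : s * s = 1 := by rcases hs with rfl | rfl <;> norm_num
  set J : Set ℝ := {z | s * z < 0} with hJdef
  have hJo : IsOpen J := isOpen_lt (by fun_prop) (by fun_prop)
  have hw : ∀ z ∈ J, 0 < 1 + c * Real.exp (s * z) := fun z hz => by
    have h1 := Real.exp_lt_one_iff.2 hz
    nlinarith [neg_le_of_abs_le hc, Real.exp_pos (s * z)]
  have hlin : ∀ z, 2 * (s * z / 2) = s * z := fun z => by ring
  refine ⟨shell J, mem_comap.2 ⟨Iio 0, Iio_mem_atBot 0, fun x hx => ⟨?_, hx⟩⟩, isOpen_shell hJo,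
    fun x hx => ⟨hx.1, hw _ hx.2⟩, 1, one_pos, nutMetric c, isRiemannianOn_nutMetric hc,
    radialMap fun z => s * z / 2, ?_, ?_⟩
  · rintro rfl
    simp [height] at hx
  · rw [ball_diff_zero]
    refine IsHomothety.congr_right (isHomothety_radialMap (l := fun t => 2 * s * t)
      (k' := fun _ => s / 2) hJo isOpen_Iio (by fun_prop) (by fun_prop) ?_ ?_ ⟨?_, ?_⟩ ?_ one_pos
      (A' := fun t => Real.exp (2 * t) / (1 + c * Real.exp (2 * t)) ^ 4)
      (B' := fun t => Real.exp (2 * t))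
      (C' := fun t => Real.exp (2 * t) / (1 + c * Real.exp (2 * t)) ^ 2) ?_ ?_ ?_) ?_
    · intro z hz
      have : s * z < 0 := hz
      change s * z / 2 < 0
      linarith
    · intro t ht
      have : t < 0 := ht
      change s * (2 * s * t) < 0
      calc s * (2 * s * t) = 2 * (s * s) * t := by ring
        _ < 0 := by rw [hss]; linarith
    · intro z _
      change 2 * s * (s * z / 2) = z
      calc 2 * s * (s * z / 2) = s * s * z := by ring
        _ = z := by rw [hss, one_mul]
    · intro t _
      change s * (2 * s * t) / 2 = t
      calc s * (2 * s * t) / 2 = s * s * t := by ring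
        _ = t := by rw [hss, one_mul]
    · intro z _
      exact ((hasDerivAt_id z).const_mul s).div_const 2 |>.congr_deriv (by ring)
    · intro z hz
      have h1 := (hw z hz).ne'
      have h2 : (s / 2) ^ 2 = 1 / 4 := by rw [div_pow, sq s, hss]; norm_num
      simp only [hlin, h2, modelF, modelC]
      generalize 1 + c * Real.exp (s * z) = r at *
      field_simp
    · intro z hz
      have h1 := (hw z hz).ne'
      simp only [hlin, modelF, modelC]
      generalize 1 + c * Real.exp (s * z) = r at *
      field_simp
    · intro z hz
      simp only [hlin, modelC, one_mul]
    · rintro y hy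
      refine (nutMetric_eq_uMetric hy.1 ?_).symm
      have he := exp_two_mul_height hy.1
      have h1 : height y < 0 := hy.2
      have h2 : ‖y‖ ^ 2 < 1 := by rw [← he, Real.exp_lt_one_iff]; linarith
      have := neg_le_of_abs_le hc
      have h3 : 0 < ‖y‖ ^ 2 := by rw [← he]; positivity
      nlinarith
  · rw [tendsto_zero_iff_norm_tendsto_zero]
    have h1 : Tendsto (fun x => Real.exp (s * height x / 2)) (comap (fun x => s * height x) atBot)
        (𝓝 0) :=
      (Real.tendsto_exp_atBot.comp (tendsto_id.atBot_div_const two_pos)).comp tendsto_comap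
    refine squeeze_zero (fun x => norm_nonneg _) (fun x => ?_) h1
    rcases eq_or_ne x 0 with rfl | hx
    · simp only [radialMap, smul_zero, norm_zero]; positivity
    · rw [← exp_height (radialMap_ne_zero _ hx), height_radialMap _ hx]

/-! ### The curvature singularity -/

lemma model_radial (s : ℝ) {c : ℝ} {x : Quat} (hx : x ∈ shell (modelDomain s c)) :
    model s c x x x
      = Real.exp (s * height x) / (4 * (1 + c * Real.exp (s * height x)) ^ 4) := by
  rw [model_apply hx, inv_mul_cancel₀ hx.1]
  simp

lemma height_exp_smul_of_norm {u : Quat} (hu : ‖u‖ = 1) (t : ℝ) :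
    height (Real.exp t • u) = t := by
  rw [height_exp_smul t (norm_ne_zero_iff.1 (hu ▸ one_ne_zero)), height, hu, Real.log_one,
    add_zero]

lemma mem_shell_modelDomain_one (s : ℝ) {x : Quat} (hx : x ≠ 0) : x ∈ shell (modelDomain s 1) :=
  ⟨hx, by rw [modelDomain_eq_univ s zero_le_one]; trivial⟩

lemma hasCurvatureSingularity_model {s : ℝ} (hs : s = 1 ∨ s = -1) :
    HasCurvatureSingularity s (model s 1) := by
  constructor
  · have h : Tendsto (fun x => Real.exp (s * height x)) (comap (fun x => s * height x) atTop)
        atTop := Real.tendsto_exp_atTop.comp tendsto_comap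
    refine tendsto_atTop_mono' _ ?_ h
    filter_upwards [preimage_mem_comap (Ioi_mem_atTop 0)] with x hx
    have hx0 : x ≠ 0 := by rintro rfl; simp [height] at hx
    rw [riemannNormSq_model hs (mem_shell_modelDomain_one s hx0)]
    have hq := Real.exp_pos (s * height x)
    generalize Real.exp (s * height x) = q at *
    have h1 : 1 + q ≤ (1 + q) ^ 6 := le_self_pow₀ (by linarith) (by norm_num)
    linarith
  · intro u hu
    have hu0 : u ≠ 0 := norm_ne_zero_iff.1 (hu ▸ one_ne_zero)
    have hfun : (fun t : ℝ => √(model s 1 (Real.exp t • u) (Real.exp t • u) (Real.exp t • u)))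
        = fun t => √(Real.exp (s * t) / (4 * (1 + Real.exp (s * t)) ^ 4)) := by
      funext t
      rw [model_radial s (mem_shell_modelDomain_one s (smul_ne_zero (Real.exp_pos t).ne' hu0)),
        height_exp_smul_of_norm hu, one_mul]
    have hint : MeasureTheory.IntegrableOn (fun t => Real.exp (-(s * t))) {t : ℝ | 0 < s * t} := by
      rcases hs with rfl | rfl
      · have h1 : {t : ℝ | 0 < 1 * t} = Ioi 0 := by ext t; simp
        rw [h1]
        simpa using integrableOn_exp_neg_Ioi 0
      · have h1 : {t : ℝ | 0 < -1 * t} = Iio 0 := by ext t; simp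
        rw [h1]
        simpa using (integrableOn_exp_Iic 0).mono_set Iio_subset_Iic_self
    rw [hfun]
    have hmeas : MeasurableSet {t : ℝ | 0 < s * t} :=
      measurableSet_lt measurable_const (measurable_const.mul measurable_id)
    refine MeasureTheory.Integrable.mono' hint ?_ ?_
    · refine (Continuous.aestronglyMeasurable ?_)
      refine (Continuous.div (by fun_prop) (by fun_prop) fun t => ?_).sqrt
      positivity
    · filter_upwards [MeasureTheory.ae_restrict_mem hmeas] with t ht
      rw [Real.norm_of_nonneg (Real.sqrt_nonneg _), Real.exp_neg]
      have h1 : 1 < Real.exp (s * t) := Real.one_lt_exp_iff.2 ht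
      generalize Real.exp (s * t) = q at *
      refine Real.sqrt_le_iff.2 ⟨by positivity, ?_⟩
      rw [inv_pow, ← one_div, div_le_div_iff₀ (by positivity) (by positivity), one_mul]
      have h2 : q ^ 4 ≤ (1 + q) ^ 4 := pow_le_pow_left₀ (by linarith) (by linarith) 4
      have h3 : q * q ^ 2 ≤ q ^ 4 := by nlinarith [pow_pos (zero_lt_one.trans h1) 3]
      nlinarith

/-! ### The two non-flat models are not homothetic -/

/-- A function whose radial derivative is dominated by that of `2 arctan (e^{sz/2})` is bounded
above, because it is so on the unit sphere. -/
lemma exists_forall_le_of_fderiv_radial_le {s : ℝ} (hs : s = 1 ∨ s = -1) {F : Quat → ℝ}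
    (hF : ∀ y ≠ 0, DifferentiableAt ℝ F y) {K : ℝ}
    (hK : ∀ y ≠ 0, |fderiv ℝ F y y|
      ≤ K * (Real.exp (s * height y / 2) / (1 + Real.exp (s * height y)))) :
    ∃ B, ∀ y ≠ 0, F y ≤ B := by
  have hne : ∀ u ∈ Metric.sphere (0 : Quat) 1, u ≠ 0 := fun u hu =>
    norm_ne_zero_iff.1 ((mem_sphere_zero_iff_norm.1 hu).symm ▸ one_ne_zero)
  obtain ⟨M, hM⟩ := (isCompact_sphere (0 : Quat) 1).bddAbove_image
    (f := F) fun u hu => (hF u (hne u hu)).continuousAt.continuousWithinAt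
  have hK0 : 0 ≤ K := by
    have h1 := (abs_nonneg _).trans (hK 1 one_ne_zero)
    exact nonneg_of_mul_nonneg_left h1 (by positivity)
  refine ⟨M + K * (2 * Real.pi), fun y hy => ?_⟩
  set G : ℝ → ℝ := fun t => s * (2 * Real.arctan (Real.exp (s * t / 2))) with hGdef
  have hG : ∀ t, HasDerivAt G (Real.exp (s * t / 2) / (1 + Real.exp (s * t))) t := fun t => by
    have h1 : HasDerivAt (fun t => s * t / 2) (s / 2) t :=
      (((hasDerivAt_id t).const_mul s).div_const 2).congr_deriv (by ring)
    refine ((h1.exp.arctan.const_mul 2).const_mul s).congr_deriv ?_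
    have h2 : Real.exp (s * t / 2) ^ 2 = Real.exp (s * t) := by
      rw [← Real.exp_nat_mul]; congr 1; push_cast; ring
    rw [h2]
    rcases hs with rfl | rfl <;> ring_nf
  have hGb : ∀ t, |G t| ≤ Real.pi := fun t => by
    have h1 := Real.arctan_pos.2 (Real.exp_pos (s * t / 2))
    have h2 := Real.arctan_lt_pi_div_two (Real.exp (s * t / 2))
    simp only [hGdef]
    rw [abs_le]
    rcases hs with rfl | rfl <;> constructor <;> linarith
  have hyn := norm_pos_iff.2 hy
  obtain ⟨u, hu, huy⟩ : ∃ u : Quat, ‖u‖ = 1 ∧ Real.exp (height y) • u = y := by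
    refine ⟨‖y‖⁻¹ • y, ?_, ?_⟩
    · rw [norm_smul, norm_inv, norm_norm, inv_mul_cancel₀ hyn.ne']
    · rw [exp_height hy, smul_inv_smul₀ hyn.ne']
  have hu0 : u ≠ 0 := norm_ne_zero_iff.1 (hu ▸ one_ne_zero)
  have hγ : ∀ t, HasDerivAt (fun t => F (Real.exp t • u))
      (fderiv ℝ F (Real.exp t • u) (Real.exp t • u)) t := fun t =>
    (hF _ (smul_ne_zero (Real.exp_pos t).ne' hu0)).hasFDerivAt.comp_hasDerivAt t
      ((Real.hasDerivAt_exp t).smul_const u)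
  have hb : ∀ t, |fderiv ℝ F (Real.exp t • u) (Real.exp t • u)|
      ≤ K * (Real.exp (s * t / 2) / (1 + Real.exp (s * t))) := fun t => by
    have := hK (Real.exp t • u) (smul_ne_zero (Real.exp_pos t).ne' hu0)
    rwa [height_exp_smul_of_norm hu] at this
  have h1 : Monotone fun t => K * G t - F (Real.exp t • u) :=
    monotone_of_hasDerivAt_nonneg (fun t => ((hG t).const_mul K).fun_sub (hγ t)) fun t => by
      have := (abs_le.1 (hb t)).2
      change (0 : ℝ) ≤ _
      linarith
  have h2 : Monotone fun t => K * G t + F (Real.exp t • u) :=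
    monotone_of_hasDerivAt_nonneg (fun t => ((hG t).const_mul K).fun_add (hγ t)) fun t => by
      have := (abs_le.1 (hb t)).1
      change (0 : ℝ) ≤ _
      linarith
  have hFu : F u ≤ M := hM (mem_image_of_mem F (mem_sphere_zero_iff_norm.2 hu))
  have g0 := abs_le.1 (hGb 0)
  have gt := abs_le.1 (hGb (height y))
  rcases le_total 0 (height y) with ht | ht
  · have h3 := h1 ht
    simp only [Real.exp_zero, one_smul, huy] at h3
    nlinarith [mul_le_mul_of_nonneg_left (show G (height y) - G 0 ≤ 2 * Real.pi by linarith) hK0]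
  · have h3 := h2 ht
    simp only [Real.exp_zero, one_smul, huy] at h3
    nlinarith [mul_le_mul_of_nonneg_left (show G 0 - G (height y) ≤ 2 * Real.pi by linarith) hK0]

/-- The function `-log (1 - e^{sz})` has bounded gradient for `g_{-1}`. -/
lemma hasFDerivAt_neg_log {s : ℝ} (hs : s = 1 ∨ s = -1) {x : Quat}
    (hx : x ∈ shell (modelDomain s (-1))) :
    ∃ L : Quat →L[ℝ] ℝ, HasFDerivAt (fun y => -Real.log (1 - Real.exp (s * height y))) L x ∧
      ∀ v, L v ^ 2 ≤ 4 * model s (-1) x v v := by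
  have h1 : 0 < 1 + -1 * Real.exp (s * height x) := hx.2
  have h2 : 0 < 1 - Real.exp (s * height x) := by linarith
  have hd := (((hasDerivAt_exp_mul s (height x)).const_sub 1).log h2.ne').fun_neg
  refine ⟨_, hd.comp_hasFDerivAt x (hasFDerivAt_height hx.1), fun v => ?_⟩
  rw [model_apply hx, show 1 + -1 * Real.exp (s * height x) = 1 - Real.exp (s * height x) by ring]
  simp only [smul_apply, heightDeriv_apply, smul_eq_mul]
  have hs2 : s ^ 2 = 1 := by rcases hs with rfl | rfl <;> norm_num
  obtain ⟨d, hdd⟩ : ∃ d, d = 1 - Real.exp (s * height x) := ⟨_, rfl⟩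
  have hq := Real.exp_pos (s * height x)
  rw [← hdd] at h2 ⊢
  have hqd : Real.exp (s * height x) = 1 - d := by linarith
  rw [hqd] at hq ⊢
  generalize x⁻¹ * v = p
  have e1 : (-(-(s * (1 - d)) / d) * p.re) ^ 2 = (1 - d) ^ 2 / d ^ 2 * p.re ^ 2 := by
    calc (-(-(s * (1 - d)) / d) * p.re) ^ 2 = s ^ 2 * ((1 - d) ^ 2 / d ^ 2 * p.re ^ 2) := by ring
      _ = _ := by rw [hs2, one_mul]
  have e2 : (1 - d) ^ 2 / d ^ 2 ≤ (1 - d) / d ^ 4 := by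
    rw [div_le_div_iff₀ (by positivity) (by positivity)]
    have : (1 - d) * d ^ 2 ≤ 1 := by nlinarith
    have h4 : 0 < (1 - d) * d ^ 2 := by positivity
    calc (1 - d) ^ 2 * d ^ 4 = ((1 - d) * d ^ 2) * ((1 - d) * d ^ 2) := by ring
      _ ≤ ((1 - d) * d ^ 2) * 1 := by gcongr
      _ = _ := by ring
  have e3 := mul_le_mul_of_nonneg_right e2 (sq_nonneg p.re)
  have e4 : 0 ≤ (1 - d) * (p.imI * p.imI) + (1 - d) / d ^ 2 * (p.imJ * p.imJ + p.imK * p.imK) :=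
    add_nonneg (mul_nonneg hq.le (mul_self_nonneg _)) (mul_nonneg (by positivity)
      (add_nonneg (mul_self_nonneg _) (mul_self_nonneg _)))
  have e5 : 4 * ((1 - d) / (4 * d ^ 4) * (p.re * p.re)) = (1 - d) / d ^ 4 * p.re ^ 2 := by
    field_simp
  rw [e1]
  linarith

/-- Were the two metrics homothetic, the transplant to `M_1` of the function `-log (1 - e^{sz})`,
which is unbounded on `M_{-1}` but has bounded gradient there, would be bounded, because every
radial curve of `M_1` has finite length. -/
lemma not_homothetic_model {s : ℝ} (hs : s = 1 ∨ s = -1) :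
    ¬ Homothetic (shell (modelDomain s (-1))) (model s (-1))
        (shell (modelDomain s 1)) (model s 1) := by
  rintro ⟨lam, φ, hlam, ⟨hφ, hφs, ψ, hψ, hψs, hinv⟩, hiso⟩
  have hss : s * s = 1 := by rcases hs with rfl | rfl <;> norm_num
  set f : Quat → ℝ := fun y => -Real.log (1 - Real.exp (s * height y)) with hf
  have hmem : ∀ y : Quat, y ≠ 0 → y ∈ shell (modelDomain s 1) :=
    fun y hy => mem_shell_modelDomain_one s hy
  have hU := isOpen_shell (isOpen_modelDomain s (-1))
  have hV := isOpen_shell (isOpen_modelDomain s 1)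
  have hψd : ∀ y ≠ 0, DifferentiableAt ℝ ψ y := fun y hy =>
    (hψs.contDiffAt (hV.mem_nhds (hmem y hy))).differentiableAt (by simp)
  have hφd : ∀ x ∈ shell (modelDomain s (-1)), DifferentiableAt ℝ φ x := fun x hx =>
    (hφs.contDiffAt (hU.mem_nhds hx)).differentiableAt (by simp)
  choose! L hL hLb using fun x hx => hasFDerivAt_neg_log (x := x) hs hx
  have hcomp : ∀ y ≠ 0, HasFDerivAt (fun y => f (ψ y)) (L (ψ y) ∘L fderiv ℝ ψ y) y := fun y hy =>
    (hL _ (hψ (hmem y hy))).comp y (hψd y hy).hasFDerivAt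
  have hdd : ∀ y ≠ 0, fderiv ℝ φ (ψ y) (fderiv ℝ ψ y y) = y := fun y hy => by
    have h1 := (hφd _ (hψ (hmem y hy))).hasFDerivAt.comp y (hψd y hy).hasFDerivAt
    have h2 : φ ∘ ψ =ᶠ[𝓝 y] id := by
      filter_upwards [hV.mem_nhds (hmem y hy)] with w hw using hinv.2 hw
    have h3 := h1.unique ((hasFDerivAt_id y).congr_of_eventuallyEq h2)
    exact DFunLike.congr_fun h3 y
  obtain ⟨B, hB⟩ := exists_forall_le_of_fderiv_radial_le hs (F := fun y => f (ψ y))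
    (K := 1 / √lam) (fun y hy => (hcomp y hy).differentiableAt) fun y hy => by
      rw [(hcomp y hy).fderiv]
      have h1 := hLb _ (hψ (hmem y hy)) (fderiv ℝ ψ y y)
      have h2 := hiso _ (hψ (hmem y hy)) (fderiv ℝ ψ y y) (fderiv ℝ ψ y y)
      rw [hdd y hy, hinv.2 (hmem y hy), model_radial s (hmem y hy), one_mul] at h2
      have h3 : Real.exp (s * height y / 2) ^ 2 = Real.exp (s * height y) := by
        rw [← Real.exp_nat_mul]; congr 1; push_cast; ring
      refine abs_le_of_sq_le_sq ?_ (by positivity)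
      refine h1.trans ?_
      have h4 : (1 / √lam * (Real.exp (s * height y / 2) / (1 + Real.exp (s * height y)))) ^ 2
          = Real.exp (s * height y) / (lam * (1 + Real.exp (s * height y)) ^ 2) := by
        rw [mul_pow, div_pow, div_pow, h3, Real.sq_sqrt hlam.le]
        field_simp
      rw [h4]
      have hq := Real.exp_pos (s * height y)
      generalize Real.exp (s * height y) = q at *
      have h5 : model s (-1) (ψ y) (fderiv ℝ ψ y y) (fderiv ℝ ψ y y)
          = q / (4 * (1 + q) ^ 4) / lam := by
        rw [h2]; field_simp
      rw [h5]
      have h6 : (1 + q) ^ 2 ≤ (1 + q) ^ 4 := pow_le_pow_right₀ (by linarith) (by norm_num)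
      calc 4 * (q / (4 * (1 + q) ^ 4) / lam) = q / (lam * (1 + q) ^ 4) := by field_simp
        _ ≤ q / (lam * (1 + q) ^ 2) := by gcongr
  -- a point of `M_{-1}` at which `-log (1 - e^{sz}) = |B| + 1`
  have he : Real.exp (-(|B| + 1)) < 1 := Real.exp_lt_one_iff.2 (by linarith [abs_nonneg B])
  have he0 := Real.exp_pos (-(|B| + 1))
  set t := s * Real.log (1 - Real.exp (-(|B| + 1))) with ht
  have hst : Real.exp (s * t) = 1 - Real.exp (-(|B| + 1)) := by
    rw [ht, ← mul_assoc, hss, one_mul, Real.exp_log (by linarith)]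
  have hht : height (Real.exp t • (1 : Quat)) = t := height_exp_smul_of_norm norm_one t
  have hx : Real.exp t • (1 : Quat) ∈ shell (modelDomain s (-1)) := by
    refine ⟨smul_ne_zero (Real.exp_pos t).ne' one_ne_zero, ?_⟩
    rw [hht]
    change 0 < 1 + -1 * Real.exp (s * t)
    rw [hst]
    linarith
  have h1 := hB (φ (Real.exp t • (1 : Quat))) (hφ hx).1
  simp only [hinv.1 hx, hf, hht, hst, sub_sub_cancel, Real.log_exp] at h1
  linarith [le_abs_self B]

end UTwo

theorem mainTheorem10 (s : ℝ) (hs : s = 1 ∨ s = -1) :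
    -- the Kähler condition for `I^s`, and Ricci-flatness
    (∀ (J : Set ℝ) (F C : ℝ → ℝ), IsAnsatz J F C →
      (IsClosedTwoFormOn (shell J) (fundamentalForm (zMetric F C) (iStructure s F C)) ↔
        HasModelForm s J F C) ∧
      (IsKahlerOn (shell J) (zMetric F C) (iStructure s F C) ↔ HasModelForm s J F C) ∧
      (HasModelForm s J F C → RicciFlatOn (shell J) (zMetric F C))) ∧
    -- up to homothety, the metrics are pieces of the flat metric and of two others
    (∀ (J : Set ℝ) (F C : ℝ → ℝ), IsAnsatz J F C →
      IsKahlerOn (shell J) (zMetric F C) (iStructure s F C) →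
      ∃ c : ℝ, (c = 0 ∨ c = -1 ∨ c = 1) ∧ ∃ τ : ℝ,
        (fun z => z + τ) '' J ⊆ modelDomain s c ∧
        Homothetic (shell J) (zMetric F C) (shell ((fun z => z + τ) '' J)) (model s c)) ∧
    (∀ c : ℝ, (c = 0 ∨ c = -1 ∨ c = 1) →
      IsAnsatz (modelDomain s c) (modelF s c) (modelC s 1 c) ∧
      IsKahlerOn (shell (modelDomain s c)) (model s c)
        (iStructure s (modelF s c) (modelC s 1 c))) ∧
    FlatOn (shell (modelDomain s 0)) (model s 0) ∧
    (∀ c : ℝ, (c = -1 ∨ c = 1) →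
      ∀ x ∈ shell (modelDomain s c), ∃ l k i j, riemann (model s c) l k i j x ≠ 0) ∧
    ¬ Homothetic (shell (modelDomain s (-1))) (model s (-1))
        (shell (modelDomain s 1)) (model s 1) ∧
    -- the first is the Taub-NUT metric, with an ALF end at `z = 0` and a nut at `z = -s ∞`
    modelDomain s (-1) = {z | s * z < 0} ∧
    (∀ m : ℝ, 0 < m → ∃ φ : Quat → Quat,
      IsHomothety (4 * m ^ 2) φ (shell (modelDomain s (-1))) (model s (-1))
        (shell (Ioi m)) (taubNUT m)) ∧
    HasALFEnd (shell (modelDomain s (-1))) (model s (-1))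
      (comap height (𝓝[modelDomain s (-1)] 0)) ∧
    HasNut (shell (modelDomain s (-1))) (model s (-1))
      (comap (fun x => s * height x) atBot) ∧
    -- the second has a nut at `z = -s ∞` and a curvature singularity at `z = s ∞`
    modelDomain s 1 = univ ∧
    HasNut (shell (modelDomain s 1)) (model s 1) (comap (fun x => s * height x) atBot) ∧
    HasCurvatureSingularity s (model s 1) := by
  have hs0 : s ≠ 0 := by rcases hs with rfl | rfl <;> norm_num
  refine ⟨fun J F C h => ?_, fun J F C h hK => ?_, fun c hc => ?_, ?_, ?_,
    not_homothetic_model hs, modelDomain_neg_one s, fun m hm => exists_isHomothety_taubNUT hs hm,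
    hasALFEnd_model hs, hasNut_model hs (by norm_num), modelDomain_eq_univ s zero_le_one,
    hasNut_model hs (by norm_num), hasCurvatureSingularity_model hs⟩
  · exact ⟨⟨h.hasModelForm hs, fun H => (H.isKahlerOn hs h.isOpen).closed⟩,
      ⟨fun H => h.hasModelForm hs H.closed, fun H => H.isKahlerOn hs h.isOpen⟩,
      fun H => H.ricciFlatOn hs h.isOpen⟩
  · obtain ⟨c₀, c, hc₀, H⟩ := h.hasModelForm hs hK.closed
    exact IsModelOn.exists_homothetic hs h.isOpen hc₀ H
  · exact ⟨isAnsatz_modelDomain hs0 hc,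
      (isModelOn_modelDomain s 1 c).isKahlerOn hs (isOpen_modelDomain s c) one_pos⟩
  · exact (isModelOn_modelDomain s 1 0).flatOn hs (isOpen_modelDomain s 0) one_pos
  · intro c hc x hx
    exact (isModelOn_modelDomain s 1 c).exists_riemann_ne_zero hs (isOpen_modelDomain s c) one_pos
      (by rcases hc with rfl | rfl <;> norm_num) hx
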